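/- **Setting.** An instance $\mathcal I=(\mathcal M,\mathcal J)$ of makespan minimization on identical machines consists of a finite set $\mathcal M$ of machines and a finite set $\mathcal J$ of jobs with non-negative integer processing times $p_j$. For an assignment $\sigma:\mathcal J\to\mathcal M$, the load of machine $i$ is $\sum_{j:\sigma(j)=i}p_j$, and the makespan of $\sigma$ is the maximum load. $C^*_{\max}(\mathcal I)$ denotes the minimum makespan, and an assignment is optimal if it attains it. In the reoptimization problem $R(\Pi_{ID})$ we are given an instance $\mathcal I_0=(\mathcal M_0,\mathcal J_0)$, an assignment $\sigma_0:\mathcal J_0\to\mathcal M_0$, and a new instance $\mathcal I=(\mathcal M,\mathcal J)$ with $\mathcal M\neq\emptyset$, obtained by adding and removing jobs and machines. The transition cost of $j\in\mathcal J$ for $\sigma:\mathcal J\to\mathcal M$ is $1$ if $j\notin\mathcal J_0$ or $\sigma_0(j)\ne\sigma(j)$, and $0$ otherwise; the transition cost of $\sigma$ is the sum over $j\in\mathcal J$. An algorithm is an $(r,\rho)$-reapproximation if on every input it outputs an assignment for $\mathcal I$ whose makespan is at most $\rho\, C^*_{\max}(\mathcal I)$ and whose transition cost is at most $r$ times the minimum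 transition cost of an optimal assignment for $\mathcal I$. **Algorithm $\mathcal A_{ID}$**, for an error parameter $\epsilon>0$. Let $\epsilon_0=1/\lceil 4/\epsilon\rceil$. 1. By an approximation scheme (binary search over makespan targets, testing whether the rounded large jobs fit and the total processing time is at most $|\mathcal M|$ times the target) find an integer $T$ with $C^*_{\max}(\mathcal I)\le T\le(1+\epsilon_0)C^*_{\max}(\mathcal I)$. 2. Regard machines as bins of capacity $1$ and jobs as items of size $\alpha_j=p_j/T$. An item is small if $\alpha_j\le\epsilon_0$ and large otherwise; sizes of large items are rounded down to multiples of $\epsilon_0^2$. (If $T=0$, all items are small.) 3. For every feasible assignment $C^1,\dots,C^m$ of the rounded large items to the $m=|\mathcal M|$ bins (up to the order of the bins and exchanging items of equal rounded size): (i) form a complete bipartite graph between the machines of $\mathcal M\cup\mathcal M_0$ and $C^1,\dots,C^m$, padded by $|\mathcal M_0\setminus\mathcal M|$ empty vertices. An edge at a padding vertex costs $0$. An edge between $i\in\mathcal M$ and $C^k$ costs the number of places of $C^k$ that cannot be filled by large jobs of $\mathcal J$ that were on $i$, plus the number of small jobs of $\mathcal J$ that were on $i$ and are omitted when all of these are added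 to $C^k$ and then the largest are omitted until the total size is at most $1$. An edge between a removed machine and some $C^k$ has a prohibitive cost, $|\mathcal J|+1$; (ii) find a minimum cost perfect matching, keep the jobs it keeps in place, and put the other large jobs into the unfilled places of their rounded sizes; (iii) add the remaining small jobs by relaxed First-Fit, with bin capacity $1+\epsilon_0$ with respect to the original sizes. 4. Output a solution of minimum transition cost among those constructed. **Theorem.** For every real $\epsilon>0$, algorithm $\mathcal A_{ID}$ is a $(1,1+\epsilon)$-reapproximation for $R(\Pi_{ID})$, and for fixed $\epsilon$ it runs in polynomial time: there is a polynomial $P$, depending only on $\epsilon$, such that on every input the number of steps (with arithmetic on integers charged by bit operations) is at most $P$ of the binary encoding length of $(\mathcal I_0,\sigma_0,\mathcal I)$. -/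

import Mathlib

namespace Reopt

/-! ## Makespan minimization on identical machines and its reoptimization variant

Machines and jobs are named by natural numbers. An instance lists its machines and its jobs, an
assignment `J → M` is given by the list of its pairs `(j, σ j)`. -/

/-- A job: its name and its processing time (the same on all machines). -/
structure Job where
  id : ℕ
  time : ℕ

/-- An instance `(M, J)` of makespan minimization on identical machines. -/
structure Instance where
  machines : List ℕ
  jobs : List Job

/-- Machines and jobs have distinct names, and there is at least one machine if there are jobs. -/
def Instance.Valid (I : Instance) : Prop :=
  I.machines.Nodup ∧ (I.jobs.map Job.id).Nodup ∧ (I.jobs ≠ [] → I.machines ≠ [])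

/-- `σ` is (the list of pairs of) a map from the jobs of `I` to the machines of `I`. -/
def IsAssignment (I : Instance) (σ : List (ℕ × ℕ)) : Prop :=
  (σ.map Prod.fst).Perm (I.jobs.map Job.id) ∧ ∀ x ∈ σ, x.2 ∈ I.machines

/-- The load of machine `i`: the total processing time of the jobs assigned to it. -/
def load (I : Instance) (σ : List (ℕ × ℕ)) (i : ℕ) : ℕ :=
  ((I.jobs.filter fun j => σ.lookup j.id = some i).map Job.time).sum

/-- The maximum load over all machines. -/
def makespan (I : Instance) (σ : List (ℕ × ℕ)) : ℕ :=
  I.machines.toFinset.sup (load I σ)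

/-- The minimum makespan of an assignment. -/
noncomputable def optMakespan (I : Instance) : ℕ :=
  sInf {C | ∃ σ, IsAssignment I σ ∧ makespan I σ = C}

/-- Input of the reoptimization problem: the initial instance, an assignment for it, and the
new instance. A machine or job that occurs in both instances has the same name in both. -/
structure Input where
  old : Instance
  σ₀ : List (ℕ × ℕ)
  new : Instance

/-- A well-formed input. The new instance is obtained by arbitrary additions and removals of jobs
and machines, with at least one machine remaining. -/
def Input.Valid (R : Input) : Prop :=
  R.old.Valid ∧ R.new.Valid ∧ R.new.machines ≠ [] ∧ IsAssignment R.old R.σ₀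

/-- The `{0,1}` transition cost of job `j`: it is `1` if `j` is not a job of the initial instance,
or if `σ₀ j ≠ σ j`; otherwise it is `0`. -/
def jobCost (R : Input) (σ : List (ℕ × ℕ)) (j : ℕ) : ℕ :=
  if j ∉ R.old.jobs.map Job.id ∨ R.σ₀.lookup j ≠ σ.lookup j then 1 else 0

/-- The total transition cost of the jobs of the new instance. -/
def transitionCost (R : Input) (σ : List (ℕ × ℕ)) : ℕ :=
  (R.new.jobs.map fun j => jobCost R σ j.id).sum

/-- The minimum transition cost to an optimal assignment of the new instance. -/
noncomputable def minTransitionCost (R : Input) : ℕ :=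
  sInf {c | ∃ σ, IsAssignment R.new σ ∧ makespan R.new σ = optMakespan R.new ∧
    transitionCost R σ = c}

/-- `A` is an `(r, ρ)`-reapproximation: it outputs an assignment of makespan at most `ρ` times the
minimum makespan, and of transition cost at most `r` times the minimum transition cost to an
optimal assignment. -/
def IsReapproximation (r ρ : ℝ) (A : Input → List (ℕ × ℕ)) : Prop :=
  ∀ R : Input, R.Valid →
    IsAssignment R.new (A R) ∧
    (makespan R.new (A R) : ℝ) ≤ ρ * optMakespan R.new ∧
    (transitionCost R (A R) : ℝ) ≤ r * minTransitionCost R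

/-- Number of symbols needed to write `n` in binary, with a separator. -/
def numSize (n : ℕ) : ℕ := n.size + 1

/-- The encoding length of an instance; all numbers are written in binary. -/
def Instance.size (I : Instance) : ℕ :=
  (I.machines.map numSize).sum + (I.jobs.map fun j => numSize j.id + numSize j.time).sum

/-- The encoding length of an input. -/
def Input.size (R : Input) : ℕ :=
  R.old.size + (R.σ₀.map fun x => numSize x.1 + numSize x.2).sum + R.new.size

/-! ## Programs with step counts

A program returns a value and the number of steps used. Convention for all programs below: every
call of a list- or counter-processing program (including each recursive call) is charged at least
one step, and besides calling other programs it does only a bounded number of constructor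
applications, pattern matches, field accesses and tests of Booleans. Every operation on numbers is
charged by the number of bit operations of the schoolbook method. -/

/-- A value together with the number of steps used to compute it. -/
structure Timed (α : Type) where
  val : α
  time : ℕ

instance : Monad Timed where
  pure a := ⟨a, 0⟩
  bind x f := ⟨(f x.val).val, x.time + (f x.val).time⟩

/-- `A` runs in time polynomial in the encoding length of its input. -/
def RunsInPolyTime {β : Type} (A : Input → Timed β) : Prop :=
  ∃ P : Polynomial ℕ, ∀ R : Input, R.Valid → (A R).time ≤ P.eval R.size

/-- Spend `n` steps. -/
def tick (n : ℕ) : Timed Unit := ⟨(), n⟩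

def addN (a b : ℕ) : Timed ℕ := ⟨a + b, a.size + b.size + 1⟩

def subN (a b : ℕ) : Timed ℕ := ⟨a - b, a.size + b.size + 1⟩

def mulN (a b : ℕ) : Timed ℕ := ⟨a * b, (a.size + 1) * (b.size + 1)⟩

def divN (a b : ℕ) : Timed ℕ := ⟨a / b, (a.size + 1) * (b.size + 1)⟩

def leN (a b : ℕ) : Timed Bool := ⟨decide (a ≤ b), a.size + b.size + 1⟩

def ltN (a b : ℕ) : Timed Bool := ⟨decide (a < b), a.size + b.size + 1⟩

def eqN (a b : ℕ) : Timed Bool := ⟨decide (a = b), a.size + b.size + 1⟩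

/-- The number of binary digits. -/
def bitsN (a : ℕ) : Timed ℕ := ⟨a.size, (a.size + 1) * (a.size + 1)⟩

/-! ### Lists -/

def lengthT {α : Type} : List α → Timed ℕ
  | [] => do tick 1; pure 0
  | _ :: l => do
      tick 1
      let k ← lengthT l
      addN k 1

def appendT {α : Type} : List α → List α → Timed (List α)
  | [], l => do tick 1; pure l
  | a :: k, l => do
      tick 1
      let r ← appendT k l
      pure (a :: r)

def concatT {α : Type} : List (List α) → Timed (List α)
  | [] => do tick 1; pure []
  | k :: l => do
      tick 1
      let r ← concatT l
      appendT k r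

def mapT {α β : Type} (f : α → Timed β) : List α → Timed (List β)
  | [] => do tick 1; pure []
  | a :: l => do
      tick 1
      let b ← f a
      let r ← mapT f l
      pure (b :: r)

def filterT {α : Type} (p : α → Timed Bool) : List α → Timed (List α)
  | [] => do tick 1; pure []
  | a :: l => do
      tick 1
      let b ← p a
      let r ← filterT p l
      if b then pure (a :: r) else pure r

/-- Sum of the values of `f`. -/
def sumT {α : Type} (f : α → Timed ℕ) : List α → Timed ℕ
  | [] => do tick 1; pure 0
  | a :: l => do
      tick 1
      let x ← f a
      let r ← sumT f l
      addN x r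

def memT (a : ℕ) : List ℕ → Timed Bool
  | [] => do tick 1; pure false
  | b :: l => do
      tick 1
      let e ← eqN a b
      if e then pure true else memT a l

def lookupT (a : ℕ) : List (ℕ × ℕ) → Timed (Option ℕ)
  | [] => do tick 1; pure none
  | x :: l => do
      tick 1
      let e ← eqN a x.1
      if e then pure (some x.2) else lookupT a l

/-- The first element satisfying `p`, and the list without it. -/
def takeFirst {α : Type} (p : α → Timed Bool) : List α → Timed (Option (α × List α))
  | [] => do tick 1; pure none
  | a :: l => do
      tick 1
      let b ← p a
      if b then pure (some (a, l))
      else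
        let r ← takeFirst p l
        match r with
        | none => pure none
        | some (c, k) => pure (some (c, a :: k))

/-- Are two lists of numbers equal up to order? -/
def sameContent : List ℕ → List ℕ → Timed Bool
  | [], [] => do tick 1; pure true
  | [], _ :: _ => do tick 1; pure false
  | a :: k, l => do
      tick 1
      let r ← takeFirst (eqN a) l
      match r with
      | none => pure false
      | some (_, l1) => sameContent k l1

/-- `[a, a + 1, …]` with `n` entries. -/
def interval (a : ℕ) : ℕ → Timed (List ℕ)
  | 0 => do tick 1; pure []
  | n + 1 => do
      tick (n.size + 1)
      let b ← addN a 1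
      let r ← interval b n
      pure (a :: r)

/-- All multisets of `k` entries of a list. -/
def multisets {α : Type} : ℕ → List α → Timed (List (List α))
  | 0, _ => do tick 1; pure [[]]
  | _ + 1, [] => do tick 1; pure []
  | k + 1, a :: l => do
      tick (k.size + 1)
      let r ← multisets k (a :: l)
      let r1 ← mapT (fun s => do tick 1; pure (a :: s)) r
      let r2 ← multisets (k + 1) l
      appendT r1 r2
  termination_by k l => (k, l.length)

/-! ### Minimum cost perfect matching in a complete bipartite graph

Rows of the graph bid for columns: an unmatched row takes a column for which (scaled) cost plus
price is minimum, raises its price by one, and replaces the row that held the column. -/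

/-- A column of the graph, its price and the row that holds it. -/
structure Slot (α β : Type) where
  col : β
  price : ℕ
  owner : Option α

/-- Scaled cost plus price of a column for the row `a`. -/
def offer {α β : Type} (cost : α → β → Timed ℕ) (scale : ℕ) (a : α) (s : Slot α β) :
    Timed ℕ := do
  let c ← cost a s.col
  let d ← mulN scale c
  addN d s.price

/-- The smaller of `x` and the minimum offer of row `a`. -/
def minOffer {α β : Type} (cost : α → β → Timed ℕ) (scale : ℕ) (a : α) (x : ℕ) :
    List (Slot α β) → Timed ℕ
  | [] => do tick 1; pure x
  | s :: l => do
      tick 1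
      let y ← offer cost scale a s
      let b ← leN x y
      if b then minOffer cost scale a x l else minOffer cost scale a y l

/-- Row `a` takes the first column at which its offer is `x`; also return the previous owner. -/
def takeSlot {α β : Type} (cost : α → β → Timed ℕ) (scale : ℕ) (a : α) (x : ℕ) :
    List (Slot α β) → Timed (List (Slot α β) × Option α)
  | [] => do tick 1; pure ([], none)
  | s :: l => do
      tick 1
      let y ← offer cost scale a s
      let b ← eqN x y
      if b then
        let p ← addN s.price 1
        pure (⟨s.col, p, some a⟩ :: l, s.owner)
      else
        let r ← takeSlot cost scale a x l
        pure (s :: r.1, r.2)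

/-- Process the list of unmatched rows, with a bound on the number of bids. -/
def auction {α β : Type} (cost : α → β → Timed ℕ) (scale : ℕ) :
    ℕ → List α → List (Slot α β) → Timed (List (Slot α β))
  | 0, _, slots => do tick 1; pure slots
  | _ + 1, [], slots => do tick 1; pure slots
  | _ + 1, _ :: _, [] => do tick 1; pure []
  | n + 1, a :: queue, s :: slots => do
      tick (n.size + 1)
      let x0 ← offer cost scale a s
      let x ← minOffer cost scale a x0 slots
      let r ← takeSlot cost scale a x (s :: slots)
      match r.2 with
      | none => auction cost scale n queue r.1
      | some b => auction cost scale n (b :: queue) r.1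

/-- The pairs of a matching. -/
def matchedPairs {α β : Type} : List (Slot α β) → Timed (List (α × β))
  | [] => do tick 1; pure []
  | s :: l => do
      tick 1
      let r ← matchedPairs l
      match s.owner with
      | none => pure r
      | some a => pure ((a, s.col) :: r)

/-- A minimum cost perfect matching between two lists of the same length, for edge costs at most
`maxCost`. -/
def minCostMatching {α β : Type} (cost : α → β → Timed ℕ) (maxCost : ℕ)
    (rows : List α) (cols : List β) : Timed (List (α × β)) := do
  let slots ← mapT (fun u => do tick 1; pure (Slot.mk u 0 none)) cols
  let l ← lengthT rows
  let scale ← addN l 1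
  let c ← mulN scale maxCost
  let c1 ← addN c 1
  let bids ← mulN l c1
  let final ← auction cost scale bids rows slots
  matchedPairs final

/-! ## The algorithm

The error parameter is `ε₀ = 1/q`. For a makespan bound `T`, a job of processing time `p` has size
`p/T`; it is large if `p/T > 1/q`, and its rounded size is `⌊(p/T) / ε₀²⌋ = ⌊p q²/T⌋` in
multiples of `ε₀² = 1/q²`. -/

/-- A job of the new instance, with the machine it was assigned to initially (if any). -/
structure Item where
  id : ℕ
  time : ℕ
  home : Option ℕ

/-- A configuration of one machine: the rounded sizes of its large items. -/
abbrev Config := List ℕ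

def makeItems (σ₀ : List (ℕ × ℕ)) : List Job → Timed (List Item) :=
  mapT fun j => do
    let h ← lookupT j.id σ₀
    pure ⟨j.id, j.time, h⟩

def insertItem (x : Item) : List Item → Timed (List Item)
  | [] => do tick 1; pure [x]
  | y :: l => do
      tick 1
      let b ← leN y.time x.time
      if b then pure (x :: y :: l)
      else
        let r ← insertItem x l
        pure (y :: r)

/-- Sort by non-increasing processing time. -/
def sortItems : List Item → Timed (List Item)
  | [] => do tick 1; pure []
  | x :: l => do
      tick 1
      let r ← sortItems l
      insertItem x r

/-- Split into large items, with their rounded sizes, and small items. -/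
def splitItems (q T : ℕ) : List Item → Timed (List (ℕ × Item) × List Item)
  | [] => do tick 1; pure ([], [])
  | x :: l => do
      tick 1
      let r ← splitItems q T l
      let a ← mulN x.time q
      let b ← ltN T a
      if b then
        let c ← mulN a q
        let d ← divN c T
        pure ((d, x) :: r.1, r.2)
      else pure (r.1, x :: r.2)

/-- The multisets of at most `k` entries of `sizes` with sum at most `cap`. -/
def configsUpTo (cap : ℕ) (sizes : List ℕ) : ℕ → Timed (List Config)
  | 0 => do tick 1; pure [[]]
  | k + 1 => do
      tick (k.size + 1)
      let r ← multisets (k + 1) sizes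
      let r1 ← filterT (fun C => do
        let s ← sumT pure C
        leN s cap) r
      let r2 ← configsUpTo cap sizes k
      appendT r1 r2

/-- All configurations of rounded large items in a bin of capacity `1`: the rounded sizes are
`q, …, q²`, the capacity is `q²`, all in multiples of `ε₀²`. -/
def binConfigs (q : ℕ) : Timed (List Config) := do
  let qq ← mulN q q
  let a ← subN qq q
  let b ← addN a 1
  let sizes ← interval q b
  configsUpTo qq sizes q

/-- All feasible assignments of rounded large items, of the given rounded sizes, to `m` bins, up to
the order of the bins and up to exchanging items of the same rounded size. -/
def configurations (q m : ℕ) (sizes : List ℕ) : Timed (List (List Config)) := do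
  let bins ← binConfigs q
  let all ← multisets m bins
  filterT (fun C => do
    let s ← concatT C
    sameContent s sizes) all

/-- The rounded sizes of large items. -/
def sizesOf (large : List (ℕ × Item)) : Timed (List ℕ) :=
  mapT (fun x => do tick 1; pure x.1) large

/-! ### Step 1: an approximation scheme for the minimum makespan -/

/-- The test of the dual approximation scheme: the total processing time is at most `m T`, and the
rounded large items fit into `m` bins of capacity `1`. -/
def fits (q m total : ℕ) (items : List Item) (T : ℕ) : Timed Bool := do
  let c ← mulN m T
  let b ← leN total c
  if b then
    let s ← splitItems q T items
    let sizes ← sizesOf s.1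
    let cs ← configurations q m sizes
    match cs with
    | [] => pure false
    | _ :: _ => pure true
  else pure false

/-- Binary search between `lo` and `hi`. -/
def search (q m total : ℕ) (items : List Item) : ℕ → ℕ → ℕ → Timed ℕ
  | 0, _, hi => do tick 1; pure hi
  | n + 1, lo, hi => do
      tick (n.size + 1)
      let b ← ltN lo hi
      if b then
        let s ← addN lo hi
        let mid ← divN s 2
        let ok ← fits q m total items mid
        if ok then search q m total items n lo mid
        else
          let lo1 ← addN mid 1
          search q m total items n lo1 hi
      else pure hi

/-- A bound `T` with `C ≤ T ≤ (1 + 1/q) C`, where `C` is the minimum makespan. -/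
def approxMakespan (q m : ℕ) (items : List Item) : Timed ℕ := do
  let total ← sumT (fun x => pure x.time) items
  let n ← bitsN total
  let T1 ← search q m total items n 0 total
  let d ← divN T1 q
  addN T1 d

/-! ### Step 5: the solution for one configuration -/

/-- A vertex of the bipartite graph: a machine, whether it belongs to the new instance, and the
jobs of the new instance that were assigned to it initially. -/
structure Vertex where
  machine : ℕ
  present : Bool
  large : List (ℕ × Item)
  small : List Item

/-- Was `x` assigned to machine `i` initially? -/
def isHome (i : ℕ) (x : Item) : Timed Bool := do
  tick 1
  match x.home with
  | none => pure false
  | some h => eqN h i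

def makeVertices (present : Bool) (large : List (ℕ × Item)) (small : List Item) :
    List ℕ → Timed (List Vertex) :=
  mapT fun i => do
    let L ← filterT (fun y => isHome i y.2) large
    let S ← filterT (isHome i) small
    pure ⟨i, present, L, S⟩

/-- Large items kept on a machine, places of its configuration that are left vacant (given by
rounded size), and the other large items that were there initially. -/
structure LargeFit where
  kept : List Item
  vacant : List ℕ
  rest : List (ℕ × Item)

/-- Fill the places of a configuration with large items of the machine. -/
def keepLarge : Config → List (ℕ × Item) → Timed LargeFit
  | [], L => do tick 1; pure ⟨[], [], L⟩
  | r :: C, L => do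
      tick 1
      let f ← takeFirst (fun y => eqN r y.1) L
      match f with
      | some (y, L1) => do
          let k ← keepLarge C L1
          pure ⟨y.2 :: k.kept, k.vacant, k.rest⟩
      | none => do
          let k ← keepLarge C L
          pure ⟨k.kept, r :: k.vacant, k.rest⟩

/-- Omit items from the head of the list until the total size, `w` times the processing times plus
the size of the other items, is at most `cap`. Returns the kept and the omitted items. -/
def omitLargest (w cap : ℕ) : ℕ → List Item → Timed (List Item × List Item)
  | _, [] => do tick 1; pure ([], [])
  | total, x :: l => do
      tick 1
      let b ← leN total cap
      if b then pure (x :: l, [])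
      else
        let a ← mulN w x.time
        let t ← subN total a
        let r ← omitLargest w cap t l
        pure (r.1, x :: r.2)

/-- Add to the configuration `C` all given small items (in non-increasing order), then omit the
largest ones until the total size does not exceed `1`. Sizes are multiplied by `q² T`. -/
def keepSmall (q T : ℕ) (C : Config) (S : List Item) : Timed (List Item × List Item) := do
  let w ← mulN q q
  let cap ← mulN w T
  let s ← sumT (fun x => pure x.time) S
  let a ← mulN w s
  let c ← sumT pure C
  let d ← mulN c T
  let total ← addN a d
  omitLargest w cap total S

/-- The cost of an edge of the bipartite graph. Columns are the configurations of the `m` bins,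
and `none` for the empty configurations that pad them. A machine that was removed can host no jobs;
its edges to the bins get a cost, `forbidden`, that exceeds all others. -/
def edgeCost (q T forbidden : ℕ) (v : Vertex) (u : Option Config) : Timed ℕ := do
  tick 1
  match u with
  | none => pure 0
  | some C =>
      if v.present then
        let f ← keepLarge C v.large
        let s ← keepSmall q T C v.small
        let a ← lengthT f.vacant
        let b ← lengthT s.2
        addN a b
      else pure forbidden

/-- A machine during the construction of the schedule: vacant places for large items, and the items
assigned to it. -/
structure Bin where
  machine : ℕ
  vacant : List ℕ
  items : List Item

/-- Bins, and the large and the small items that still have to be placed. -/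
structure Partial where
  bins : List Bin
  large : List (ℕ × Item)
  small : List Item

/-- Leave on each machine the items kept by the matching; collect the others in the pools. -/
def placeKept (q T : ℕ) (large : List (ℕ × Item)) (small : List Item) :
    List (Vertex × Option Config) → Timed Partial
  | [] => do tick 1; pure ⟨[], large, small⟩
  | (v, none) :: l => do
      tick 1
      let r ← placeKept q T large small l
      let L ← appendT v.large r.large
      let S ← appendT v.small r.small
      pure ⟨r.bins, L, S⟩
  | (v, some C) :: l => do
      tick 1
      let r ← placeKept q T large small l
      let f ← keepLarge C v.large
      let s ← keepSmall q T C v.small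
      let L ← appendT f.rest r.large
      let S ← appendT s.2 r.small
      let K ← appendT f.kept s.1
      pure ⟨⟨v.machine, f.vacant, K⟩ :: r.bins, L, S⟩

/-- Fill the vacant places of one bin. -/
def fillBin : List ℕ → List (ℕ × Item) → Timed (List Item × List (ℕ × Item))
  | [], pool => do tick 1; pure ([], pool)
  | r :: l, pool => do
      tick 1
      let f ← takeFirst (fun y => eqN r y.1) pool
      match f with
      | some (y, pool1) => do
          let k ← fillBin l pool1
          pure (y.2 :: k.1, k.2)
      | none => fillBin l pool

/-- Fill the vacant places of all bins with large items from the pool. -/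
def fillBins : List Bin → List (ℕ × Item) → Timed (List Bin)
  | [], _ => do tick 1; pure []
  | B :: l, pool => do
      tick 1
      let f ← fillBin B.vacant pool
      let K ← appendT f.1 B.items
      let r ← fillBins l f.2
      pure (⟨B.machine, [], K⟩ :: r)

/-- Put `x` into the first bin in which the total (original) size is then at most `1 + ε₀`. -/
def firstFitItem (q T : ℕ) (x : Item) : List Bin → Timed (List Bin)
  | [] => do tick 1; pure []
  | B :: l => do
      tick 1
      let s ← sumT (fun y => pure y.time) B.items
      let s1 ← addN s x.time
      let a ← mulN q s1
      let q1 ← addN q 1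
      let c ← mulN q1 T
      let b ← leN a c
      if b then pure (⟨B.machine, B.vacant, x :: B.items⟩ :: l)
      else
        let r ← firstFitItem q T x l
        pure (B :: r)

/-- Relaxed First-Fit. -/
def firstFit (q T : ℕ) : List Item → List Bin → Timed (List Bin)
  | [], bins => do tick 1; pure bins
  | x :: l, bins => do
      tick 1
      let r ← firstFitItem q T x bins
      firstFit q T l r

/-- The schedule given by the bins. -/
def scheduleOf : List Bin → Timed (List (Item × ℕ))
  | [] => do tick 1; pure []
  | B :: l => do
      tick 1
      let r ← scheduleOf l
      let k ← mapT (fun x => do tick 1; pure (x, B.machine)) B.items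
      appendT k r

/-- The transition cost of a schedule. -/
def scheduleCost : List (Item × ℕ) → Timed ℕ :=
  sumT fun x => do
    let b ← isHome x.2 x.1
    if b then pure 0 else pure 1

/-- The data computed before the configurations are enumerated: the vertices of the bipartite graph,
one padding column for each removed machine, and the jobs that are new. -/
structure Setup where
  vertices : List Vertex
  padding : List (Option Config)
  newLarge : List (ℕ × Item)
  newSmall : List Item

/-- The solution for the configuration `C`, in three steps: a minimum cost perfect matching, the
placement of the large items, and First-Fit for the remaining small items. -/
def solutionFor (q T forbidden : ℕ) (D : Setup) (C : List Config) :
    Timed (List (Item × ℕ)) := do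
  let bins ← mapT (fun c => do tick 1; pure (some c)) C
  let cols ← appendT bins D.padding
  let M ← minCostMatching (edgeCost q T forbidden) forbidden D.vertices cols
  let P ← placeKept q T D.newLarge D.newSmall M
  let B ← fillBins P.bins P.large
  let F ← firstFit q T P.small B
  scheduleOf F

/-- Steps 5 and 6: the solution of minimum transition cost over all configurations, together with
its cost. -/
def bestSolution (q T forbidden : ℕ) (D : Setup) :
    List (List Config) → Timed (Option (ℕ × List (Item × ℕ)))
  | [] => do tick 1; pure none
  | C :: l => do
      tick 1
      let s ← solutionFor q T forbidden D C
      let c ← scheduleCost s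
      let r ← bestSolution q T forbidden D l
      match r with
      | none => pure (some (c, s))
      | some (d, t) => do
          let b ← leN c d
          if b then pure (some (c, s)) else pure (some (d, t))

def isNew (x : Item) : Timed Bool := do
  tick 1
  match x.home with
  | none => pure true
  | some _ => pure false

/-- The algorithm with error parameter `ε₀ = 1/q`. -/
def algorithmWith (q : ℕ) (R : Input) : Timed (List (ℕ × ℕ)) := do
  let items0 ← makeItems R.σ₀ R.new.jobs
  let items ← sortItems items0
  let n ← lengthT items
  let m ← lengthT R.new.machines
  let T ← approxMakespan q m items
  let split ← splitItems q T items
  let removed ← filterT (fun i => do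
    let b ← memT i R.new.machines
    if b then pure false else pure true) R.old.machines
  let V1 ← makeVertices true split.1 split.2 R.new.machines
  let V2 ← makeVertices false split.1 split.2 removed
  let V ← appendT V1 V2
  let padding ← mapT (fun _ => do tick 1; pure none) removed
  let newLarge ← filterT (fun y => isNew y.2) split.1
  let newSmall ← filterT isNew split.2
  let sizes ← sizesOf split.1
  let configs ← configurations q m sizes
  let forbidden ← addN n 1
  let best ← bestSolution q T forbidden ⟨V, padding, newLarge, newSmall⟩ configs
  match best with
  | none => pure []
  | some (_, s) => mapT (fun x => do tick 1; pure (x.1.id, x.2)) s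

/-- The algorithm `A_ID` for the error parameter `ε`, with `ε₀ = 1 / ⌈4/ε⌉ ≤ ε/4`. -/
noncomputable def AID (ε : ℝ) (R : Input) : Timed (List (ℕ × ℕ)) :=
  algorithmWith ⌈4 / ε⌉₊ R

end Reopt

/-!
Let `q = ⌈4/ε⌉`, let `T` be the makespan bound computed by the algorithm, and call a job kept if it
stays on its initial machine. The transition cost of an assignment is the number of jobs minus the
number of kept jobs, so the algorithm has to keep at least as many jobs as any optimal assignment.

*Transition cost.* Let `σ` be an optimal assignment. Its loads are at most `T`, so that its rounded
large jobs have total size at most `1` on each machine, and each of them has size at least `1/q`;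
hence the bins of `σ` are among the enumerated configurations, up to the order of the bins
(`exists_configuration_of_loads`). For this configuration, `σ` itself assigns the bins to the
machines. On every machine the greedy choice of large jobs and omitting the largest small jobs keep
at least as many jobs as `σ` does (`countP_home_le_keptCount`): the first by counting places of
each rounded size, the second by an exchange argument (`omitLargest_spec`). Edge cost plus number of
kept jobs is the number of places plus the number of small jobs of the machine, and the sum of this
over a matching without forbidden edges does not depend on the matching (`Proper.cost_add_kept`).
A minimum cost matching uses no forbidden edge, as matchings that avoid them cost at most the number
of jobs; so it keeps a maximum number of jobs (`placementFor_spec`). Filling up the bins can only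
increase this number.

*Matching.* Every owner in the auction holds a column at an offer within `1` of its minimum offer,
and columns never bid for have price `0` (`AuctionState`). The minimum offers and the prices are a
dual solution, which shows that the scaled cost of the matching is within the number of rows of the
minimum; as the scale is larger than that, the matching is optimal (`AuctionState.optimal`). While
a row is unmatched some column has price `0`, which bounds all prices; as each bid raises a price,
this also bounds the number of bids (`auction_spec`).

*Makespan.* Let a large job have processing time `p` and rounded size `r`, in multiples of `1/q²`.
Then `r ≥ q`, and thus `q³ p ≤ (q + 1) T r` (`roundingBound_of_large`). So bins that are full with
respect to rounded sizes have load at most `(1 + 1/q) T` (`fillBins_spec`). First-Fit keeps this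
bound, and never fails to place a small job: the total processing time is at most `T` times the
number of machines, so some machine has load at most `T` (`firstFit_spec`). The same argument shows
that the minimum makespan is at most `(1 + 1/q) T'` for any `T'` that passes the test of the
approximation scheme, while any `T'` of at least the minimum makespan passes it; hence binary search
yields `T` between the minimum makespan and `1 + 1/q` times that (`approxMakespan_spec`). Finally
`(1 + 1/q)² ≤ 1 + ε`.

*Running time.* The number of configurations of one bin depends only on `q`, so that the number of
multisets of `m` of them, for `m` machines, is polynomial in `m` (`multisets_length_le`). In the
auction, costs and prices are bounded by a polynomial in the numbers of jobs and machines, and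
processing times enter all other programs only through their numbers of digits. The step count of
every program is bounded by an explicit expression in `q` and a number `s` that bounds all lengths
and digit counts (`algorithmWith_time`), and for fixed `q` this is a polynomial in `s`
(`isPolynomial_algorithmBound`).
-/

namespace Reopt

section

/-! ### Values and step counts of composed programs -/

section Basic

variable {α β : Type}

@[simp] theorem val_bind (x : Timed α) (f : α → Timed β) : (x >>= f).val = (f x.val).val := rfl

@[simp] theorem time_bind (x : Timed α) (f : α → Timed β) :
    (x >>= f).time = x.time + (f x.val).time := rfl

@[simp] theorem val_pure (a : α) : (pure a : Timed α).val = a := rfl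

@[simp] theorem time_pure (a : α) : (pure a : Timed α).time = 0 := rfl

@[simp] theorem time_tick (n : ℕ) : (tick n).time = n := rfl

@[simp] theorem val_addN (a b : ℕ) : (addN a b).val = a + b := rfl

@[simp] theorem val_subN (a b : ℕ) : (subN a b).val = a - b := rfl

@[simp] theorem val_mulN (a b : ℕ) : (mulN a b).val = a * b := rfl

@[simp] theorem val_divN (a b : ℕ) : (divN a b).val = a / b := rfl

@[simp] theorem val_leN (a b : ℕ) : (leN a b).val = decide (a ≤ b) := rfl

@[simp] theorem val_ltN (a b : ℕ) : (ltN a b).val = decide (a < b) := rfl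

@[simp] theorem val_eqN (a b : ℕ) : (eqN a b).val = decide (a = b) := rfl

@[simp] theorem val_bitsN (a : ℕ) : (bitsN a).val = a.size := rfl

@[simp] theorem time_addN (a b : ℕ) : (addN a b).time = a.size + b.size + 1 := rfl

@[simp] theorem time_subN (a b : ℕ) : (subN a b).time = a.size + b.size + 1 := rfl

@[simp] theorem time_mulN (a b : ℕ) : (mulN a b).time = (a.size + 1) * (b.size + 1) := rfl

@[simp] theorem time_divN (a b : ℕ) : (divN a b).time = (a.size + 1) * (b.size + 1) := rfl

@[simp] theorem time_leN (a b : ℕ) : (leN a b).time = a.size + b.size + 1 := rfl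

@[simp] theorem time_ltN (a b : ℕ) : (ltN a b).time = a.size + b.size + 1 := rfl

@[simp] theorem time_eqN (a b : ℕ) : (eqN a b).time = a.size + b.size + 1 := rfl

@[simp] theorem time_bitsN (a : ℕ) : (bitsN a).time = (a.size + 1) * (a.size + 1) := rfl

theorem val_ite (b : Prop) [Decidable b] (x y : Timed α) :
    (if b then x else y).val = if b then x.val else y.val := by
  split <;> rfl

/-! ### Values of the list programs -/

@[simp] theorem lengthT_val (l : List α) : (lengthT l).val = l.length := by
  induction l with
  | nil => rfl
  | cons a l ih => simp [lengthT, ih]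

@[simp] theorem appendT_val (k l : List α) : (appendT k l).val = k ++ l := by
  induction k with
  | nil => rfl
  | cons a k ih => simp [appendT, ih]

@[simp] theorem concatT_val (l : List (List α)) : (concatT l).val = l.flatten := by
  induction l with
  | nil => rfl
  | cons a k ih => simp [concatT, ih]

@[simp] theorem mapT_val (f : α → Timed β) (l : List α) :
    (mapT f l).val = l.map fun a => (f a).val := by
  induction l with
  | nil => rfl
  | cons a k ih => simp [mapT, ih]

@[simp] theorem filterT_val (p : α → Timed Bool) (l : List α) :
    (filterT p l).val = l.filter fun a => (p a).val := by
  induction l with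
  | nil => rfl
  | cons a k ih => simp [filterT, ih, val_ite, List.filter_cons]

@[simp] theorem sumT_val (f : α → Timed ℕ) (l : List α) :
    (sumT f l).val = (l.map fun a => (f a).val).sum := by
  induction l with
  | nil => rfl
  | cons a k ih => simp [sumT, ih]

@[simp] theorem memT_val (a : ℕ) (l : List ℕ) : (memT a l).val = decide (a ∈ l) := by
  induction l with
  | nil => rfl
  | cons b k ih => by_cases h : a = b <;> simp [memT, ih, h]

@[simp] theorem lookupT_val (a : ℕ) (l : List (ℕ × ℕ)) : (lookupT a l).val = l.lookup a := by
  induction l with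
  | nil => rfl
  | cons b k ih =>
    obtain ⟨x, y⟩ := b
    by_cases h : a = x
    · simp [lookupT, h]
    · simp [lookupT, ih, h, List.lookup_cons, beq_eq_false_iff_ne.2 h]

theorem takeFirst_none {p : α → Timed Bool} {l : List α} (h : (takeFirst p l).val = none) :
    ∀ a ∈ l, (p a).val = false := by
  induction l with
  | nil => simp
  | cons a l ih =>
    by_cases hp : (p a).val = true
    · simp [takeFirst, hp] at h
    · cases hr : (takeFirst p l).val with
      | none => simpa [hp] using ih hr
      | some c => simp [takeFirst, hp, hr] at h

theorem takeFirst_some {p : α → Timed Bool} {l : List α} {c : α} {k : List α}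
    (h : (takeFirst p l).val = some (c, k)) : (p c).val = true ∧ l.Perm (c :: k) := by
  induction l generalizing c k with
  | nil => simp [takeFirst] at h
  | cons a l ih =>
    by_cases hp : (p a).val = true
    · simp only [takeFirst, val_bind, hp, if_true, val_pure, Option.some.injEq,
        Prod.mk.injEq] at h
      obtain ⟨rfl, rfl⟩ := h
      exact ⟨hp, List.Perm.refl _⟩
    · cases hr : (takeFirst p l).val with
      | none => simp [takeFirst, hp, hr] at h
      | some d =>
        obtain ⟨d, k'⟩ := d
        simp only [takeFirst, val_bind, hp] at h
        simp only [Bool.false_eq_true, if_false, val_bind, hr, val_pure, Option.some.injEq,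
          Prod.mk.injEq] at h
        obtain ⟨rfl, rfl⟩ := h
        exact ⟨(ih hr).1, ((ih hr).2.cons a).trans (List.Perm.swap _ _ _)⟩

@[simp] theorem sameContent_val (k l : List ℕ) : (sameContent k l).val = true ↔ k.Perm l := by
  induction k generalizing l with
  | nil => cases l <;> simp [sameContent]
  | cons a k ih =>
    cases hr : (takeFirst (eqN a) l).val with
    | none =>
      have h1 : a ∉ l := fun h => by simpa using takeFirst_none hr a h
      have h2 : ¬ (a :: k).Perm l := fun h => h1 (h.subset List.mem_cons_self)
      simp [sameContent, hr, h2]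
    | some d =>
      obtain ⟨d, k'⟩ := d
      obtain ⟨h1, h2⟩ := takeFirst_some hr
      obtain rfl : a = d := by simpa using h1
      rw [show (sameContent (a :: k) l).val = (sameContent k k').val by simp [sameContent, hr],
        ih, ← List.perm_cons a]
      exact ⟨fun h => h.trans h2.symm, fun h => h.trans h2⟩

@[simp] theorem interval_val (a n : ℕ) : (interval a n).val = List.range' a n := by
  induction n generalizing a with
  | zero => rfl
  | succ n ih => simp [interval, ih, List.range'_succ]

/-! ### Enumeration of multisets and of configurations -/

theorem multisets_val_succ (k : ℕ) (a : α) (l : List α) :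
    (multisets (k + 1) (a :: l)).val =
      (multisets k (a :: l)).val.map (fun s => a :: s) ++ (multisets (k + 1) l).val := by
  rw [multisets]
  simp

theorem multisets_val_zero (l : List α) : (multisets 0 l).val = [[]] := by
  rw [multisets]
  simp

theorem multisets_val_nil (k : ℕ) : (multisets (k + 1) ([] : List α)).val = [] := by
  rw [multisets]
  simp

theorem mem_multisets_sound {k : ℕ} {l s : List α} (h : s ∈ (multisets k l).val) :
    s.length = k ∧ ∀ x ∈ s, x ∈ l := by
  induction l generalizing k s with
  | nil =>
    cases k with
    | zero => simp_all [multisets_val_zero]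
    | succ k => simp [multisets_val_nil] at h
  | cons a l ihl =>
    induction k generalizing s with
    | zero => simp_all [multisets_val_zero]
    | succ k ihk =>
      rw [multisets_val_succ, List.mem_append, List.mem_map] at h
      rcases h with ⟨t, ht, rfl⟩ | h
      · have := ihk ht
        exact ⟨by simp [this.1], by simpa using this.2⟩
      · have := ihl h
        exact ⟨this.1, fun x hx => List.mem_cons_of_mem _ (this.2 x hx)⟩

theorem exists_mem_multisets {k : ℕ} {l s : List α} (hk : s.length = k) (hs : ∀ x ∈ s, x ∈ l) :
    ∃ t ∈ (multisets k l).val, t.Perm s := by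
  classical
  induction l generalizing k s with
  | nil =>
    obtain rfl : s = [] := List.eq_nil_iff_forall_not_mem.2 fun x hx => by simpa using hs x hx
    subst hk
    simp [multisets_val_zero]
  | cons a l ihl =>
    induction k generalizing s with
    | zero =>
      obtain rfl : s = [] := List.length_eq_zero_iff.1 hk
      simp [multisets_val_zero]
    | succ k ihk =>
      rw [multisets_val_succ]
      by_cases ha : a ∈ s
      · obtain ⟨t, ht, hp⟩ := ihk (s := s.erase a) (by rw [List.length_erase_of_mem ha]; omega)
          fun x hx => hs x (List.mem_of_mem_erase hx)
        exact ⟨a :: t, List.mem_append_left _ (List.mem_map_of_mem ht),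
          (hp.cons a).trans (List.perm_cons_erase ha).symm⟩
      · obtain ⟨t, ht, hp⟩ := ihl hk fun x hx => by
          rcases List.mem_cons.1 (hs x hx) with rfl | h
          · exact absurd hx ha
          · exact h
        exact ⟨t, List.mem_append_right _ ht, hp⟩

theorem mem_configsUpTo_sound {cap k : ℕ} {sizes C : List ℕ}
    (h : C ∈ (configsUpTo cap sizes k).val) :
    C.length ≤ k ∧ (∀ r ∈ C, r ∈ sizes) ∧ C.sum ≤ cap := by
  induction k with
  | zero => simp_all [configsUpTo]
  | succ k ih =>
    simp only [configsUpTo, val_bind, appendT_val, filterT_val, List.mem_append, List.mem_filter,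
      sumT_val, val_pure, List.map_id', val_leN, decide_eq_true_eq] at h
    rcases h with ⟨h1, h2⟩ | h
    · obtain ⟨h3, h4⟩ := mem_multisets_sound h1
      exact ⟨h3.le, h4, h2⟩
    · obtain ⟨h1, h2⟩ := ih h
      exact ⟨by omega, h2⟩

theorem exists_mem_configsUpTo {cap k : ℕ} {sizes C : List ℕ} (h1 : C.length ≤ k)
    (h2 : ∀ r ∈ C, r ∈ sizes) (h3 : C.sum ≤ cap) :
    ∃ D ∈ (configsUpTo cap sizes k).val, D.Perm C := by
  induction k with
  | zero =>
    obtain rfl : C = [] := List.length_eq_zero_iff.1 (by omega)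
    simp [configsUpTo]
  | succ k ih =>
    simp only [configsUpTo, val_bind, appendT_val, filterT_val, List.mem_append, List.mem_filter,
      sumT_val, val_pure, List.map_id', val_leN, decide_eq_true_eq]
    rcases Nat.lt_or_ge k C.length with h | h
    · obtain ⟨D, hD, hp⟩ := exists_mem_multisets (k := k + 1) (by omega) h2
      exact ⟨D, Or.inl ⟨hD, hp.sum_eq.trans_le h3⟩, hp⟩
    · obtain ⟨D, hD, hp⟩ := ih h
      exact ⟨D, Or.inr hD, hp⟩

theorem binConfigs_val (q : ℕ) :
    (binConfigs q).val = (configsUpTo (q * q) (List.range' q (q * q - q + 1)) q).val := by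
  simp [binConfigs]

theorem mem_binConfigs_sound {q : ℕ} {C : Config} (h : C ∈ (binConfigs q).val) :
    C.length ≤ q ∧ C.sum ≤ q * q := by
  rw [binConfigs_val] at h
  exact ⟨(mem_configsUpTo_sound h).1, (mem_configsUpTo_sound h).2.2⟩

/-- A configuration of total rounded size at most `1` has at most `q` places, as each of them has
size at least `1/q`. -/
theorem exists_mem_binConfigs {q : ℕ} (hq : 0 < q) {C : Config} (h1 : ∀ r ∈ C, q ≤ r)
    (h2 : C.sum ≤ q * q) : ∃ D ∈ (binConfigs q).val, D.Perm C := by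
  rw [binConfigs_val]
  refine exists_mem_configsUpTo ?_ (fun r hr => ?_) h2
  · have := List.card_nsmul_le_sum C q h1
    rw [smul_eq_mul] at this
    exact Nat.le_of_mul_le_mul_right (this.trans h2) hq
  · rw [List.mem_range'_1]
    have := List.single_le_sum (l := C) (by simp) r hr
    have := h1 r hr
    omega

theorem mem_configurations_iff {q m : ℕ} {sizes : List ℕ} {C : List Config} :
    C ∈ (configurations q m sizes).val ↔
      C ∈ (multisets m (binConfigs q).val).val ∧ C.flatten.Perm sizes := by
  simp [configurations]

theorem mem_configurations_sound {q m : ℕ} {sizes : List ℕ} {C : List Config}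
    (h : C ∈ (configurations q m sizes).val) :
    C.length = m ∧ (∀ D ∈ C, D.length ≤ q ∧ D.sum ≤ q * q) ∧ C.flatten.Perm sizes := by
  rw [mem_configurations_iff] at h
  obtain ⟨h1, h2⟩ := mem_multisets_sound h.1
  exact ⟨h1, fun D hD => mem_binConfigs_sound (h2 D hD), h.2⟩

/-- Permutations lift along maps. -/
theorem exists_perm_of_perm_map {f : α → β} {l : List α} {k : List β} (h : k.Perm (l.map f)) :
    ∃ l' : List α, l'.Perm l ∧ k = l'.map f := by
  generalize hm : l.map f = m at h
  induction h generalizing l with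
  | nil => exact ⟨l, .refl _, hm.symm⟩
  | cons x _ ih =>
    cases l with
    | nil => simp at hm
    | cons a l =>
      simp only [List.map_cons, List.cons.injEq] at hm
      obtain ⟨l', h1, rfl⟩ := ih hm.2
      exact ⟨a :: l', h1.cons a, by simp [hm.1]⟩
  | swap x y t =>
    match l, hm with
    | a :: b :: l, hm =>
      simp only [List.map_cons, List.cons.injEq] at hm
      exact ⟨b :: a :: l, .swap _ _ _, by simp [hm]⟩
  | trans _ _ ih1 ih2 =>
    obtain ⟨l1, h1, rfl⟩ := ih2 hm
    obtain ⟨l2, h2, rfl⟩ := ih1 rfl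
    exact ⟨l2, h2.trans h1, rfl⟩

/-- Every feasible assignment of sizes to `m` machines is enumerated, up to a renaming of the
machines and up to the order of the sizes on each machine. -/
theorem exists_mem_configurations {q : ℕ} (hq : 0 < q) {sizes : List ℕ} {M : List α}
    {C : α → Config} (h1 : ∀ i ∈ M, (∀ r ∈ C i, q ≤ r) ∧ (C i).sum ≤ q * q)
    (h2 : (M.flatMap C).Perm sizes) :
    ∃ (M' : List α) (D : α → Config), M'.Perm M ∧ (∀ i ∈ M, (D i).Perm (C i)) ∧
      M'.map D ∈ (configurations q M.length sizes).val := by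
  have h3 : ∀ i, ∃ D, i ∈ M → D ∈ (binConfigs q).val ∧ D.Perm (C i) := fun i => by
    by_cases hi : i ∈ M
    · obtain ⟨D, hD⟩ := exists_mem_binConfigs hq (h1 i hi).1 (h1 i hi).2
      exact ⟨D, fun _ => hD⟩
    · exact ⟨[], fun h => absurd h hi⟩
  choose D hD using h3
  obtain ⟨t, ht, hp⟩ := exists_mem_multisets (k := M.length) (s := M.map D)
    (l := (binConfigs q).val) (by simp) (by simpa using fun i hi => (hD i hi).1)
  obtain ⟨M', hM', rfl⟩ := exists_perm_of_perm_map hp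
  refine ⟨M', D, hM', fun i hi => (hD i hi).2, mem_configurations_iff.2 ⟨ht, ?_⟩⟩
  rw [← List.flatMap_def]
  refine (List.Perm.flatMap_right _ hM').trans (List.Perm.trans ?_ h2)
  exact List.Perm.flatMap_left _ fun i hi => (hD i hi).2

end Basic

end

section

section Auction

variable {α β : Type}

/-! ### Minimum cost perfect matchings by bidding -/

@[simp] theorem offer_val (cost : α → β → Timed ℕ) (scale : ℕ) (a : α) (s : Slot α β) :
    (offer cost scale a s).val = scale * (cost a s.col).val + s.price := rfl

theorem minOffer_spec (cost : α → β → Timed ℕ) (scale : ℕ) (a : α) (x : ℕ)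
    (l : List (Slot α β)) :
    (minOffer cost scale a x l).val ≤ x ∧
      (∀ s ∈ l, (minOffer cost scale a x l).val ≤ (offer cost scale a s).val) ∧
      ((minOffer cost scale a x l).val = x ∨
        ∃ s ∈ l, (offer cost scale a s).val = (minOffer cost scale a x l).val) := by
  induction l generalizing x with
  | nil => simp [minOffer]
  | cons s l ih =>
    by_cases h : x ≤ (offer cost scale a s).val
    · have e : (minOffer cost scale a x (s :: l)).val = (minOffer cost scale a x l).val := by
        rw [minOffer]; simp [-offer_val, h]
      rw [e]
      obtain ⟨h1, h2, h3⟩ := ih x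
      refine ⟨h1, ?_, ?_⟩
      · simpa [-offer_val, h1.trans h] using h2
      · rcases h3 with h3 | ⟨t, ht, h3⟩
        · exact Or.inl h3
        · exact Or.inr ⟨t, List.mem_cons_of_mem _ ht, h3⟩
    · have e : (minOffer cost scale a x (s :: l)).val =
          (minOffer cost scale a (offer cost scale a s).val l).val := by
        rw [minOffer]; simp [-offer_val, h]
      rw [e]
      obtain ⟨h1, h2, h3⟩ := ih (offer cost scale a s).val
      refine ⟨by omega, ?_, Or.inr ?_⟩
      · simpa [-offer_val, h1] using h2
      · rcases h3 with h3 | ⟨t, ht, h3⟩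
        · exact ⟨s, List.mem_cons_self, h3.symm⟩
        · exact ⟨t, List.mem_cons_of_mem _ ht, h3⟩

theorem takeSlot_spec (cost : α → β → Timed ℕ) (scale : ℕ) (a : α) (x : ℕ)
    {l : List (Slot α β)} (h : ∃ s ∈ l, (offer cost scale a s).val = x) :
    ∃ k s r, l = k ++ s :: r ∧ (offer cost scale a s).val = x ∧
      (takeSlot cost scale a x l).val = (k ++ ⟨s.col, s.price + 1, some a⟩ :: r, s.owner) := by
  induction l with
  | nil => simp at h
  | cons s l ih =>
    by_cases e : x = (offer cost scale a s).val
    · refine ⟨[], s, l, rfl, e.symm, ?_⟩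
      rw [takeSlot]; simp [-offer_val, e]
    · obtain ⟨t, ht, hx⟩ := h
      have ht' : t ∈ l := by
        rcases List.mem_cons.1 ht with rfl | h
        · exact absurd hx.symm e
        · exact h
      obtain ⟨k, u, r, h1, h2, h3⟩ := ih ⟨t, ht', hx⟩
      refine ⟨s :: k, u, r, by simp [h1], h2, ?_⟩
      rw [takeSlot]; simp [-offer_val, e, h3]

theorem matchedPairs_val (l : List (Slot α β)) :
    (matchedPairs l).val = l.filterMap fun s => s.owner.map fun a => (a, s.col) := by
  induction l with
  | nil => rfl
  | cons s l ih =>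
    cases h : s.owner <;> simp [matchedPairs, h, ih]

/-- The state of the auction. The rows are the unmatched ones and the owners of columns, a column
without an owner has never been bid for, and every owner holds a column at an offer exceeding its
minimum offer by at most one. -/
structure AuctionState (cost : α → β → Timed ℕ) (scale maxCost : ℕ) (rows queue : List α)
    (slots : List (Slot α β)) : Prop where
  perm : (queue ++ slots.filterMap Slot.owner).Perm rows
  len : rows.length = slots.length
  bound : ∀ a ∈ rows, ∀ s ∈ slots, (cost a s.col).val ≤ maxCost
  slack : ∀ s ∈ slots, ∀ a, s.owner = some a → ∀ t ∈ slots,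
    (offer cost scale a s).val ≤ (offer cost scale a t).val + 1
  free : ∀ s ∈ slots, s.owner = none → s.price = 0
  price : ∀ s ∈ slots, s.price ≤ scale * maxCost + 1

variable {cost : α → β → Timed ℕ} {scale maxCost : ℕ} {rows queue : List α}
  {slots : List (Slot α β)}

theorem AuctionState.exists_free (h : AuctionState cost scale maxCost rows queue slots)
    (hq : queue ≠ []) : ∃ s ∈ slots, s.owner = none := by
  by_contra! hc
  have h1 : (slots.filterMap Slot.owner).length = slots.length :=
    List.filterMap_length_eq_length.2 fun s hs => Option.isSome_iff_ne_none.2 (hc s hs)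
  have h2 := h.perm.length_eq
  rw [List.length_append, h1, h.len] at h2
  have := List.length_pos_iff.2 hq
  omega

/-- One bid. The row `a` bids for a column of minimum offer; as some column still has price `0`,
this keeps the prices bounded. -/
theorem AuctionState.bid {a : α} (h : AuctionState cost scale maxCost rows (a :: queue) slots)
    {k r : List (Slot α β)} {s : Slot α β} (hs : slots = k ++ s :: r)
    (hmin : ∀ t ∈ slots, (offer cost scale a s).val ≤ (offer cost scale a t).val) :
    AuctionState cost scale maxCost rows (s.owner.toList ++ queue)
      (k ++ ⟨s.col, s.price + 1, some a⟩ :: r) := by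
  have hmem : ∀ t ∈ k ++ (⟨s.col, s.price + 1, some a⟩ : Slot α β) :: r,
      t ∈ slots ∨ t = ⟨s.col, s.price + 1, some a⟩ := by
    intro t ht
    rw [hs]
    simp only [List.mem_append, List.mem_cons] at ht ⊢
    tauto
  have ha : a ∈ rows := h.perm.subset (by simp)
  have hss : s ∈ slots := by rw [hs]; simp
  -- every column of the new state has a counterpart of at most the same price in the old state
  have hge : ∀ b, ∀ t ∈ k ++ (⟨s.col, s.price + 1, some a⟩ : Slot α β) :: r,
      ∃ t' ∈ slots, (offer cost scale b t').val ≤ (offer cost scale b t).val := by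
    intro b t ht
    rcases hmem t ht with h' | rfl
    · exact ⟨t, h', le_rfl⟩
    · refine ⟨s, hss, ?_⟩
      simp only [offer_val]
      omega
  refine ⟨?_, ?_, ?_, ?_, ?_, ?_⟩
  · refine List.Perm.trans ?_ h.perm
    rw [hs]
    classical
    rw [List.perm_iff_count]
    intro b
    cases ho : s.owner <;> simp [List.filterMap_append, ho, List.count_cons] <;>
      omega
  · rw [h.len, hs]; simp
  · intro b hb t ht
    rcases hmem t ht with h' | rfl
    · exact h.bound b hb t h'
    · exact h.bound b hb s hss
  · intro t ht b hb u hu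
    obtain ⟨u', hu', hle⟩ := hge b u hu
    rcases hmem t ht with h' | rfl
    · exact (h.slack t h' b hb u' hu').trans (by omega)
    · obtain rfl : a = b := by simpa using hb
      have := hmin u' hu'
      simp only [offer_val] at this hle ⊢
      omega
  · intro t ht hn
    rcases hmem t ht with h' | rfl
    · exact h.free t h' hn
    · simp at hn
  · intro t ht
    rcases hmem t ht with h' | rfl
    · exact h.price t h'
    · obtain ⟨f, hf, hn⟩ := h.exists_free (by simp)
      have h1 := hmin f hf
      have h2 := h.free f hf hn
      have h3 := h.bound a ha f hf
      have h4 := Nat.mul_le_mul_left scale h3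
      simp only [offer_val, h2] at h1 ⊢
      omega

/-- One round of the auction. -/
theorem AuctionState.step {a : α} {s : Slot α β}
    (h : AuctionState cost scale maxCost rows (a :: queue) (s :: slots)) :
    ∃ (queue' : List α) (slots' : List (Slot α β)),
      AuctionState cost scale maxCost rows queue' slots' ∧
      (slots'.map Slot.price).sum = ((s :: slots).map Slot.price).sum + 1 ∧
      slots'.map Slot.col = (s :: slots).map Slot.col ∧
      ∀ n, (auction cost scale (n + 1) (a :: queue) (s :: slots)).val =
          (auction cost scale n queue' slots').val ∧
        (auction cost scale (n + 1) (a :: queue) (s :: slots)).time =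
          n.size + 1 + ((offer cost scale a s).time +
            ((minOffer cost scale a (offer cost scale a s).val slots).time +
            ((takeSlot cost scale a (minOffer cost scale a (offer cost scale a s).val slots).val
              (s :: slots)).time + (auction cost scale n queue' slots').time))) := by
  obtain ⟨m1, m2, m3⟩ := minOffer_spec cost scale a (offer cost scale a s).val slots
  set x := (minOffer cost scale a (offer cost scale a s).val slots).val with hx
  have hex : ∃ t ∈ s :: slots, (offer cost scale a t).val = x := by
    rcases m3 with m3 | ⟨t, ht, m3⟩
    · exact ⟨s, List.mem_cons_self, m3.symm⟩
    · exact ⟨t, List.mem_cons_of_mem _ ht, m3⟩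
  obtain ⟨k, t, r, h1, h2, h3⟩ := takeSlot_spec cost scale a x hex
  have h4 := h.bid h1 (fun u hu => by
    rw [h2]
    rcases List.mem_cons.1 hu with rfl | hu
    · exact m1
    · exact m2 u hu)
  refine ⟨_, _, h4, ?_, ?_, fun n => ⟨?_, ?_⟩⟩
  · rw [h1]
    simp only [List.map_append, List.map_cons, List.sum_append, List.sum_cons]
    omega
  · rw [h1]
    simp
  · rw [auction]
    simp only [val_bind, ← hx, h3]
    cases t.owner <;> rfl
  · rw [auction]
    simp only [time_bind, time_tick, ← hx, h3]
    cases t.owner <;> rfl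

/-- The auction ends with a perfect matching: each bid raises a price by one, so that otherwise all
prices would reach their upper bound, and then no column is without an owner. -/
theorem auction_spec {n : ℕ} (h : AuctionState cost scale maxCost rows queue slots)
    (hn : (slots.map Slot.price).sum + n = slots.length * (scale * maxCost + 1)) :
    AuctionState cost scale maxCost rows [] (auction cost scale n queue slots).val ∧
      (auction cost scale n queue slots).val.map Slot.col = slots.map Slot.col := by
  induction n generalizing queue slots with
  | zero =>
    suffices hq : queue = [] by
      subst hq
      exact ⟨by simpa [auction] using h, by simp [auction]⟩
    by_contra hq
    obtain ⟨s, hs, ho⟩ := h.exists_free hq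
    have h1 : (slots.map Slot.price).sum < (slots.map fun _ => scale * maxCost + 1).sum :=
      List.sum_lt_sum _ _ (fun t ht => h.price t ht) ⟨s, hs, by rw [h.free s hs ho]; omega⟩
    simp only [List.map_const', List.sum_replicate, smul_eq_mul] at h1
    omega
  | succ n ih =>
    match queue, slots, h, hn with
    | [], _, h, _ => exact ⟨by simpa [auction] using h, by simp [auction]⟩
    | a :: queue, [], h, _ =>
      have h1 := h.perm.length_eq
      have h2 := h.len
      simp only [List.filterMap_nil, List.append_nil, List.length_cons, List.length_nil] at h1 h2
      omega
    | a :: queue, s :: slots, h, hn =>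
      obtain ⟨queue', slots', h1, h2, h3, h4⟩ := h.step
      have h5 : slots'.length = (s :: slots).length := by simpa using congrArg List.length h3
      obtain ⟨h6, h7⟩ := ih h1 (by rw [h2, h5]; omega)
      rw [(h4 n).1]
      exact ⟨h6, h7.trans h3⟩

theorem exists_lift_pairs {γ : Type} {f : γ → β} {l : List γ} {M : List (α × β)}
    (h : (M.map Prod.snd).Perm (l.map f)) :
    ∃ P : List (α × γ), (P.map Prod.snd).Perm l ∧ (P.map fun x => (x.1, f x.2)) = M := by
  obtain ⟨l', h1, h2⟩ := exists_perm_of_perm_map h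
  have hl : M.length = l'.length := by simpa using congrArg List.length h2
  refine ⟨(M.map Prod.fst).zip l', ?_, ?_⟩
  · rw [List.map_snd_zip (by simp [hl])]
    exact h1
  · have : (fun x : α × γ => (x.1, f x.2)) = Prod.map id f := rfl
    rw [this, ← List.zip_map, List.map_id, ← h2, ← List.unzip_fst, ← List.unzip_snd,
      List.zip_unzip]

/-- Linear programming duality: a state of the auction without unmatched rows is a perfect matching
whose scaled cost exceeds the minimum by at most the number of rows. Costs are integers and the
scale exceeds the number of rows, so the matching is a minimum. -/
theorem AuctionState.optimal (h : AuctionState cost scale maxCost rows [] slots)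
    (hscale : rows.length < scale) :
    ((matchedPairs slots).val.map Prod.fst).Perm rows ∧
      (matchedPairs slots).val.map Prod.snd = slots.map Slot.col ∧
      ∀ M : List (α × β), (M.map Prod.fst).Perm rows → (M.map Prod.snd).Perm (slots.map Slot.col) →
        ((matchedPairs slots).val.map fun x => (cost x.1 x.2).val).sum ≤
          (M.map fun x => (cost x.1 x.2).val).sum := by
  have hall : ∀ s ∈ slots, s.owner.isSome := by
    apply List.filterMap_length_eq_length.1
    have := h.perm.length_eq
    rw [List.nil_append] at this
    rw [this, h.len]
  obtain ⟨P, hP1, hP2, hP3, hP4⟩ : ∃ P : List (α × Slot α β), P.map Prod.snd = slots ∧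
      P.map Prod.fst = slots.filterMap Slot.owner ∧
      (P.map fun x => (x.1, x.2.col)) = (matchedPairs slots).val ∧
      ∀ x ∈ P, x.2.owner = some x.1 := by
    rw [matchedPairs_val]
    clear h
    induction slots with
    | nil => exact ⟨[], by simp⟩
    | cons s l ih =>
      obtain ⟨P, h1, h2, h3, h4⟩ := ih fun t ht => hall t (List.mem_cons_of_mem _ ht)
      obtain ⟨a, ha⟩ := Option.isSome_iff_exists.1 (hall s List.mem_cons_self)
      exact ⟨(a, s) :: P, by simp [h1], by simp [h2, ha], by simp [← h3, ha], by
        simpa [ha] using h4⟩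
  -- the dual variables of the rows
  obtain ⟨u, hu1, hu2⟩ : ∃ u : α → ℕ, (∀ a, ∀ s ∈ slots, u a ≤ (offer cost scale a s).val) ∧
      ∀ x ∈ P, (offer cost scale x.1 x.2).val ≤ u x.1 + 1 := by
    refine ⟨fun a => sInf {n | ∃ s ∈ slots, (offer cost scale a s).val = n},
      fun a s hs => Nat.sInf_le ⟨s, hs, rfl⟩, fun x hx => ?_⟩
    have hx2 : x.2 ∈ slots := by rw [← hP1]; exact List.mem_map_of_mem hx
    obtain ⟨t, ht, e⟩ := Nat.sInf_mem
      (s := {n | ∃ s ∈ slots, (offer cost scale x.1 s).val = n}) ⟨_, x.2, hx2, rfl⟩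
    dsimp only
    rw [← e]
    exact h.slack x.2 hx2 x.1 (hP4 x hx) t ht
  have hsum : ∀ Q : List (α × Slot α β), (Q.map fun x => (offer cost scale x.1 x.2).val).sum =
      scale * ((Q.map fun x => (x.1, x.2.col)).map fun x => (cost x.1 x.2).val).sum +
        ((Q.map Prod.snd).map Slot.price).sum := by
    intro Q
    induction Q with
    | nil => simp
    | cons x Q ih =>
      simp only [offer_val] at ih
      simp only [List.map_cons, List.sum_cons, ih, offer_val]
      ring
  have hrows : (P.map Prod.fst).Perm rows := by rw [hP2]; simpa using h.perm
  refine ⟨?_, ?_, fun M hM1 hM2 => ?_⟩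
  · rw [← hP3, List.map_map]
    exact hrows
  · rw [← hP3, ← hP1, List.map_map, List.map_map]
    rfl
  · obtain ⟨Q, hQ1, rfl⟩ := exists_lift_pairs hM2
    have h1 : (P.map fun x => (offer cost scale x.1 x.2).val).sum ≤
        (P.map fun x => u x.1 + 1).sum := List.sum_le_sum hu2
    have h2 : (Q.map fun x => u x.1).sum ≤ (Q.map fun x => (offer cost scale x.1 x.2).val).sum :=
      List.sum_le_sum fun x hx => hu1 x.1 x.2 (hQ1.subset (List.mem_map_of_mem hx))
    have h3 : (P.map fun x => u x.1 + 1).sum = (rows.map u).sum + rows.length := by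
      rw [List.sum_map_add, ← (hrows.map u).sum_eq, List.map_map, ← hrows.length_eq]
      simp [Function.comp_def]
    have h4 : (Q.map fun x => u x.1).sum = (rows.map u).sum := by
      rw [← (hM1.map u).sum_eq]
      simp [List.map_map, Function.comp_def]
    rw [hsum, hP1, hP3] at h1
    rw [hsum, (hQ1.map _).sum_eq] at h2
    by_contra! hc
    have h5 := Nat.mul_le_mul_left scale (Nat.succ_le_of_lt hc)
    rw [Nat.mul_succ] at h5
    omega

theorem auctionState_init {cols : List β} (hlen : rows.length = cols.length)
    (hcost : ∀ a ∈ rows, ∀ b ∈ cols, (cost a b).val ≤ maxCost) :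
    AuctionState cost (rows.length + 1) maxCost rows rows
      (cols.map fun u => Slot.mk u 0 none) := by
  refine ⟨?_, by simp [hlen], by simpa using hcost, by simp, by simp, by simp⟩
  rw [List.filterMap_map]
  simp

theorem minCostMatching_spec {cols : List β} (hlen : rows.length = cols.length)
    (hcost : ∀ a ∈ rows, ∀ b ∈ cols, (cost a b).val ≤ maxCost) :
    ((minCostMatching cost maxCost rows cols).val.map Prod.fst).Perm rows ∧
      (minCostMatching cost maxCost rows cols).val.map Prod.snd = cols ∧
      ∀ M : List (α × β), (M.map Prod.fst).Perm rows → (M.map Prod.snd).Perm cols →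
        ((minCostMatching cost maxCost rows cols).val.map fun x => (cost x.1 x.2).val).sum ≤
          (M.map fun x => (cost x.1 x.2).val).sum := by
  have h0 := auctionState_init (maxCost := maxCost) hlen hcost
  obtain ⟨h1, h2⟩ := auction_spec (n := rows.length * ((rows.length + 1) * maxCost + 1)) h0
    (by simp [List.map_map, Function.comp_def, hlen])
  have h3 := h1.optimal (Nat.lt_succ_self _)
  rw [h2, List.map_map, show Slot.col ∘ (fun u : β => (Slot.mk u 0 none : Slot α β)) = id from rfl,
    List.map_id] at h3
  simpa [minCostMatching] using h3

end Auction

end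

section

/-! ### Large and small items -/

/-- The rounded size of an item, in multiples of `1/q²`. -/
def Item.rounded (q T : ℕ) (x : Item) : ℕ := x.time * q * q / T

theorem splitItems_val (q T : ℕ) (l : List Item) :
    (splitItems q T l).val =
      ((l.filter fun x => T < x.time * q).map (fun x => (x.rounded q T, x)),
        l.filter fun x => ¬ T < x.time * q) := by
  induction l with
  | nil => rfl
  | cons x l ih =>
    by_cases h : T < x.time * q <;>
      simp [splitItems, ih, h, Item.rounded, List.filter_cons]

theorem insertItem_perm (x : Item) (l : List Item) : (insertItem x l).val.Perm (x :: l) := by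
  induction l with
  | nil => exact .refl _
  | cons y l ih =>
    by_cases h : y.time ≤ x.time
    · simp [insertItem, h]
    · simpa [insertItem, h] using (ih.cons y).trans (.swap _ _ _)

theorem sortItems_perm (l : List Item) : (sortItems l).val.Perm l := by
  induction l with
  | nil => exact .refl _
  | cons x l ih => simpa [sortItems] using (insertItem_perm _ _).trans (ih.cons x)

theorem insertItem_sorted (x : Item) {l : List Item}
    (hl : l.Pairwise fun x y => y.time ≤ x.time) :
    (insertItem x l).val.Pairwise fun x y => y.time ≤ x.time := by
  induction l with
  | nil => simp [insertItem]
  | cons y l ih =>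
    rw [List.pairwise_cons] at hl
    by_cases h : y.time ≤ x.time
    · simp only [insertItem, val_bind, val_leN, h, decide_true, if_true, val_pure,
        List.pairwise_cons, List.mem_cons, forall_eq_or_imp, true_and]
      exact ⟨fun z hz => (hl.1 z hz).trans h, hl⟩
    · have e : (insertItem x (y :: l)).val = y :: (insertItem x l).val := by
        simp [insertItem, h]
      rw [e, List.pairwise_cons]
      refine ⟨fun z hz => ?_, ih hl.2⟩
      rcases List.mem_cons.1 ((insertItem_perm x l).subset hz) with rfl | hz
      · omega
      · exact hl.1 z hz

theorem sortItems_sorted (l : List Item) :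
    (sortItems l).val.Pairwise fun x y => y.time ≤ x.time := by
  induction l with
  | nil => simp [sortItems]
  | cons x l ih => simpa [sortItems] using insertItem_sorted x ih

/-! ### Items kept in place -/

/-- The number of kept items is the size of the intersection of the multisets of places and of
rounded sizes, which bounds it from above for every other choice. -/
theorem keepLarge_spec (C : Config) (L : List (ℕ × Item)) :
    ∃ K : List (ℕ × Item), (keepLarge C L).val.kept = K.map Prod.snd ∧
      (K ++ (keepLarge C L).val.rest).Perm L ∧
      (K.map Prod.fst ++ (keepLarge C L).val.vacant).Perm C ∧
      K.length = Multiset.card ((C : Multiset ℕ) ∩ (L.map Prod.fst : List ℕ)) := by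
  induction C generalizing L with
  | nil => exact ⟨[], by simp [keepLarge]⟩
  | cons r C ih =>
    cases hf : (takeFirst (fun y : ℕ × Item => eqN r y.1) L).val with
    | none =>
      obtain ⟨K, h1, h2, h3, h4⟩ := ih L
      have e : (keepLarge (r :: C) L).val =
          ⟨(keepLarge C L).val.kept, r :: (keepLarge C L).val.vacant, (keepLarge C L).val.rest⟩ := by
        simp [keepLarge, hf]
      have hr : r ∉ ((L.map Prod.fst : List ℕ) : Multiset ℕ) := by
        rw [Multiset.mem_coe, List.mem_map]
        rintro ⟨y, hy, rfl⟩
        simpa using takeFirst_none hf y hy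
      rw [e]
      refine ⟨K, h1, h2, List.perm_middle.trans (h3.cons r), ?_⟩
      rw [← Multiset.cons_coe, Multiset.cons_inter_of_neg _ hr, h4]
    | some d =>
      obtain ⟨y, L1⟩ := d
      obtain ⟨hy, hp⟩ := takeFirst_some hf
      obtain rfl : r = y.1 := by simpa using hy
      obtain ⟨K, h1, h2, h3, h4⟩ := ih L1
      have e : (keepLarge (y.1 :: C) L).val =
          ⟨y.2 :: (keepLarge C L1).val.kept, (keepLarge C L1).val.vacant,
            (keepLarge C L1).val.rest⟩ := by
        simp [keepLarge, hf]
      rw [e]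
      refine ⟨y :: K, by simp [h1], (h2.cons y).trans hp.symm, h3.cons _, ?_⟩
      have hL : ((L.map Prod.fst : List ℕ) : Multiset ℕ) =
          y.1 ::ₘ ((L1.map Prod.fst : List ℕ) : Multiset ℕ) :=
        Multiset.coe_eq_coe.2 (hp.map Prod.fst)
      rw [hL, ← Multiset.cons_coe, Multiset.cons_inter_of_pos _ (Multiset.mem_cons_self _ _),
        Multiset.erase_cons_head, Multiset.card_cons, List.length_cons, h4]

theorem keepLarge_optimal {C : Config} {L L' : List (ℕ × Item)} (h1 : L'.Subperm L)
    (h2 : (L'.map Prod.fst).Subperm C) : L'.length ≤ (keepLarge C L).val.kept.length := by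
  obtain ⟨K, hK, -, -, hc⟩ := keepLarge_spec C L
  rw [hK, List.length_map, hc, ← List.length_map Prod.fst, ← Multiset.coe_card]
  exact Multiset.card_le_card (Multiset.le_inter (Multiset.coe_le.2 h2)
    (Multiset.map_le_map (f := Prod.fst) (Multiset.coe_le.2 h1)))

theorem keepLarge_lengths (C : Config) (L : List (ℕ × Item)) :
    (keepLarge C L).val.vacant.length + (keepLarge C L).val.kept.length = C.length := by
  obtain ⟨K, hK, -, h, -⟩ := keepLarge_spec C L
  have := h.length_eq
  rw [List.length_append, List.length_map] at this
  rw [hK, List.length_map]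
  omega

/-- A proper sublist can be extended by one more element of the list. -/
theorem exists_sublist_succ {S l : List Item} {b : ℕ} (h : S.Sublist l) (hlt : S.length < l.length)
    (hb : ∀ y ∈ l, y.time ≤ b) :
    ∃ S' : List Item, S'.Sublist l ∧ S'.length = S.length + 1 ∧
      (S'.map Item.time).sum ≤ b + (S.map Item.time).sum := by
  induction h with
  | slnil => simp at hlt
  | @cons S l a h ih =>
    exact ⟨a :: S, h.cons_cons a, by simp, by
      simpa using hb a List.mem_cons_self⟩
  | @cons_cons S l a h ih =>
    obtain ⟨S', h1, h2, h3⟩ := ih (by simpa using hlt) fun y hy => hb y (List.mem_cons_of_mem _ hy)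
    refine ⟨a :: S', h1.cons_cons a, by simp [h2], ?_⟩
    simp only [List.map_cons, List.sum_cons]
    omega

/-- Omitting the largest items keeps a maximum number of items: in any other choice of items that
contains the largest one, it can be exchanged for an item not chosen. -/
theorem omitLargest_spec {w cap d total : ℕ} {S : List Item}
    (hS : S.Pairwise fun x y => y.time ≤ x.time) (hd : d ≤ cap)
    (ht : total = w * (S.map Item.time).sum + d) :
    (omitLargest w cap total S).val.2 ++ (omitLargest w cap total S).val.1 = S ∧
      w * ((omitLargest w cap total S).val.1.map Item.time).sum + d ≤ cap ∧
      ∀ S' : List Item, S'.Sublist S → w * (S'.map Item.time).sum + d ≤ cap →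
        S'.length ≤ (omitLargest w cap total S).val.1.length := by
  induction S generalizing total with
  | nil =>
    refine ⟨by simp [omitLargest], by simpa [omitLargest] using hd, ?_⟩
    intro S' h
    simp [List.sublist_nil.1 h]
  | cons x l ih =>
    by_cases hc : total ≤ cap
    · have e : (omitLargest w cap total (x :: l)).val = (x :: l, []) := by
        simp [omitLargest, hc]
      rw [e]
      exact ⟨rfl, ht ▸ hc, fun S' h _ => h.length_le⟩
    · have e : (omitLargest w cap total (x :: l)).val =
          ((omitLargest w cap (total - w * x.time) l).val.1,
            x :: (omitLargest w cap (total - w * x.time) l).val.2) := by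
        simp [omitLargest, hc]
      rw [List.pairwise_cons] at hS
      obtain ⟨h1, h2, h3⟩ := ih (total := total - w * x.time) hS.2 (by
        rw [ht, List.map_cons, List.sum_cons, mul_add]
        omega)
      rw [e]
      refine ⟨by simp [h1], h2, fun S' hs hsum => ?_⟩
      cases hs with
      | cons _ hs => exact h3 S' hs hsum
      | @cons_cons S' _ _ hs =>
        have hlt : S'.length < l.length := by
          refine lt_of_le_of_ne hs.length_le fun he => hc ?_
          rw [ht, ← hs.eq_of_length he]
          exact hsum
        obtain ⟨S'', g1, g2, g3⟩ := exists_sublist_succ hs hlt hS.1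
        rw [List.length_cons, ← g2]
        refine h3 S'' g1 (le_trans ?_ hsum)
        rw [List.map_cons, List.sum_cons]
        exact Nat.add_le_add_right (Nat.mul_le_mul_left w g3) d

theorem keepSmall_spec {q T : ℕ} {C : Config} {S : List Item}
    (hS : S.Pairwise fun x y => y.time ≤ x.time) (hC : C.sum ≤ q * q) :
    (keepSmall q T C S).val.2 ++ (keepSmall q T C S).val.1 = S ∧
      q * q * ((keepSmall q T C S).val.1.map Item.time).sum + C.sum * T ≤ q * q * T ∧
      ∀ S' : List Item, S'.Sublist S → q * q * (S'.map Item.time).sum + C.sum * T ≤ q * q * T →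
        S'.length ≤ (keepSmall q T C S).val.1.length := by
  have := omitLargest_spec (w := q * q) (cap := q * q * T) hS (Nat.mul_le_mul_right T hC) rfl
  simpa [keepSmall] using this

/-! ### Filling vacant places and relaxed First-Fit -/

/-- The total processing time of the items in a bin. -/
def Bin.load (B : Bin) : ℕ := (B.items.map Item.time).sum

/-- The number of items in a bin that are on their initial machine. -/
def Bin.homeCount (B : Bin) : ℕ := B.items.countP fun x => x.home = some B.machine

/-- All items in the given bins. -/
def allItems (bins : List Bin) : Multiset Item :=
  (bins.map fun B => (B.items : Multiset Item)).sum

/-- All vacant places of the given bins. -/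
def allVacant (bins : List Bin) : Multiset ℕ :=
  (bins.map fun B => (B.vacant : Multiset ℕ)).sum

/-- The number of items that are on their initial machine. -/
def homeTotal (bins : List Bin) : ℕ := (bins.map Bin.homeCount).sum

@[simp] theorem allItems_nil : allItems [] = 0 := rfl

@[simp] theorem allItems_cons (B : Bin) (l : List Bin) :
    allItems (B :: l) = (B.items : Multiset Item) + allItems l := by
  simp [allItems]

@[simp] theorem allVacant_nil : allVacant [] = 0 := rfl

@[simp] theorem allVacant_cons (B : Bin) (l : List Bin) :
    allVacant (B :: l) = (B.vacant : Multiset ℕ) + allVacant l := by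
  simp [allVacant]

@[simp] theorem homeTotal_nil : homeTotal [] = 0 := rfl

@[simp] theorem homeTotal_cons (B : Bin) (l : List Bin) :
    homeTotal (B :: l) = B.homeCount + homeTotal l := by
  simp [homeTotal]

theorem sum_load_eq (bins : List Bin) :
    (bins.map Bin.load).sum = ((allItems bins).map Item.time).sum := by
  induction bins with
  | nil => rfl
  | cons B l ih => simp [ih, Bin.load]

/-- The processing time of a large item exceeds its rounded size by a factor of at most `1 + 1/q`. -/
def RoundingBound (q T : ℕ) (y : ℕ × Item) : Prop :=
  q * q * q * y.2.time ≤ (q + 1) * T * y.1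

/-- The rounded size of a large item is at least `1/q`: rounding is to multiples of `1/q²`. -/
theorem le_rounded {q T : ℕ} (hT : 0 < T) {x : Item} (hx : T < x.time * q) :
    q ≤ x.rounded q T := by
  rw [Item.rounded, Nat.le_div_iff_mul_le hT, Nat.mul_comm]
  exact Nat.mul_le_mul_right q hx.le

theorem roundingBound_of_large {q T : ℕ} (hT : 0 < T) {x : Item} (hx : T < x.time * q) :
    RoundingBound q T (x.rounded q T, x) := by
  have h1 := le_rounded hT hx
  have h2 : x.time * q * q < T * (x.rounded q T + 1) := Nat.lt_mul_div_succ _ hT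
  change q * q * q * x.time ≤ (q + 1) * T * x.rounded q T
  generalize x.rounded q T = r at *
  calc q * q * q * x.time = q * (x.time * q * q) := by ring
    _ ≤ q * (T * (r + 1)) := Nat.mul_le_mul_left _ h2.le
    _ = T * (q * r + q) := by ring
    _ ≤ T * (q * r + r) := by gcongr
    _ = (q + 1) * T * r := by ring

/-- The items in a bin, together with items filling its vacant places, have total size at most
`1 + 1/q`. -/
def Bin.Fits (q T : ℕ) (B : Bin) : Prop :=
  q * q * q * B.load + (q + 1) * T * B.vacant.sum ≤ q * q * ((q + 1) * T)

/-- The items in a bin have total size at most `1 + 1/q`. -/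
def Bin.Fine (q T : ℕ) (B : Bin) : Prop := q * B.load ≤ (q + 1) * T

theorem fillBin_spec {l : List ℕ} {pool : List (ℕ × Item)}
    (h : (l : Multiset ℕ) ≤ (pool.map Prod.fst : List ℕ)) :
    ∃ F : List (ℕ × Item), (fillBin l pool).val.1 = F.map Prod.snd ∧
      (F ++ (fillBin l pool).val.2).Perm pool ∧ F.map Prod.fst = l := by
  induction l generalizing pool with
  | nil => exact ⟨[], by simp [fillBin]⟩
  | cons r l ih =>
    have hr : r ∈ ((pool.map Prod.fst : List ℕ) : Multiset ℕ) :=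
      Multiset.mem_of_le h (by simp)
    cases hf : (takeFirst (fun y : ℕ × Item => eqN r y.1) pool).val with
    | none =>
      rw [Multiset.mem_coe, List.mem_map] at hr
      obtain ⟨y, hy, rfl⟩ := hr
      simpa using takeFirst_none hf y hy
    | some d =>
      obtain ⟨y, pool1⟩ := d
      obtain ⟨hy, hp⟩ := takeFirst_some hf
      obtain rfl : r = y.1 := by simpa using hy
      have e : (fillBin (y.1 :: l) pool).val =
          (y.2 :: (fillBin l pool1).val.1, (fillBin l pool1).val.2) := by
        simp [fillBin, hf]
      obtain ⟨F, h1, h2, h3⟩ := ih (pool := pool1) (by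
        rw [Multiset.coe_eq_coe.2 (hp.map Prod.fst), List.map_cons, ← Multiset.cons_coe,
          ← Multiset.cons_coe, Multiset.cons_le_cons_iff] at h
        exact h)
      rw [e]
      exact ⟨y :: F, by simp [h1], (h2.cons y).trans hp.symm, by simp [h3]⟩

theorem sum_time_le_of_roundingBound {q T : ℕ} {F : List (ℕ × Item)}
    (h : ∀ y ∈ F, RoundingBound q T y) :
    q * q * q * ((F.map Prod.snd).map Item.time).sum ≤ (q + 1) * T * (F.map Prod.fst).sum := by
  induction F with
  | nil => simp
  | cons y F ih =>
    have h1 := ih fun z hz => h z (List.mem_cons_of_mem _ hz)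
    have h2 := h y List.mem_cons_self
    unfold RoundingBound at h2
    simp only [List.map_cons, List.sum_cons, mul_add]
    exact Nat.add_le_add h2 h1

theorem fillBins_spec {q T : ℕ} (hq : 0 < q) {bins : List Bin} {pool : List (ℕ × Item)}
    (hpool : ((pool.map Prod.fst : List ℕ) : Multiset ℕ) = allVacant bins)
    (hbound : ∀ y ∈ pool, RoundingBound q T y) (hfit : ∀ B ∈ bins, B.Fits q T) :
    (fillBins bins pool).val.map Bin.machine = bins.map Bin.machine ∧
      allItems (fillBins bins pool).val = allItems bins + (pool.map Prod.snd : List Item) ∧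
      (∀ B ∈ (fillBins bins pool).val, B.Fine q T) ∧
      homeTotal bins ≤ homeTotal (fillBins bins pool).val := by
  induction bins generalizing pool with
  | nil =>
    have : pool = [] := by simpa using hpool
    subst this
    simp [fillBins]
  | cons B l ih =>
    rw [allVacant_cons] at hpool
    obtain ⟨F, h1, h2, h3⟩ := fillBin_spec (l := B.vacant) (pool := pool) (by
      rw [hpool]; exact Multiset.le_add_right _ _)
    have e : (fillBins (B :: l) pool).val = ⟨B.machine, [], (fillBin B.vacant pool).val.1 ++ B.items⟩ ::
        (fillBins l (fillBin B.vacant pool).val.2).val := by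
      simp [fillBins]
    obtain ⟨g1, g2, g3, g4⟩ := ih (pool := (fillBin B.vacant pool).val.2) (by
        have := Multiset.coe_eq_coe.2 (h2.map Prod.fst)
        rw [hpool, List.map_append, h3, ← Multiset.coe_add] at this
        exact add_left_cancel this)
      (fun y hy => hbound y (h2.subset (List.mem_append_right _ hy)))
      (fun B hB => hfit B (List.mem_cons_of_mem _ hB))
    rw [e, h1]
    refine ⟨by simp [g1], ?_, ?_, ?_⟩
    · have := Multiset.coe_eq_coe.2 (h2.map Prod.snd)
      rw [List.map_append, ← Multiset.coe_add] at this
      rw [allItems_cons, allItems_cons, g2, ← this, ← Multiset.coe_add]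
      abel
    · rw [List.forall_mem_cons]
      refine ⟨?_, g3⟩
      have h4 := hfit B List.mem_cons_self
      have h5 := sum_time_le_of_roundingBound (q := q) (T := T) (F := F) fun y hy =>
        hbound y (h2.subset (List.mem_append_left _ hy))
      rw [h3] at h5
      unfold Bin.Fits at h4
      unfold Bin.Fine
      refine Nat.le_of_mul_le_mul_left (le_trans ?_ h4) (Nat.mul_pos hq hq)
      simp only [Bin.load, List.map_append, List.sum_append] at h4 ⊢
      calc _ = q * q * q * (B.items.map Item.time).sum +
            q * q * q * ((F.map Prod.snd).map Item.time).sum := by ring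
        _ ≤ _ := Nat.add_le_add_left h5 _
    · rw [homeTotal_cons, homeTotal_cons]
      refine Nat.add_le_add ?_ g4
      simp [Bin.homeCount, List.countP_append]

theorem firstFitItem_spec {q T : ℕ} {x : Item} {bins : List Bin}
    (h : ∃ B ∈ bins, q * (B.load + x.time) ≤ (q + 1) * T) (hfine : ∀ B ∈ bins, B.Fine q T) :
    (firstFitItem q T x bins).val.map Bin.machine = bins.map Bin.machine ∧
      allItems (firstFitItem q T x bins).val = x ::ₘ allItems bins ∧
      (∀ B ∈ (firstFitItem q T x bins).val, B.Fine q T) ∧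
      homeTotal bins ≤ homeTotal (firstFitItem q T x bins).val := by
  induction bins with
  | nil => simp at h
  | cons B l ih =>
    by_cases hc : q * (B.load + x.time) ≤ (q + 1) * T
    · have e : (firstFitItem q T x (B :: l)).val = ⟨B.machine, B.vacant, x :: B.items⟩ :: l := by
        rw [Bin.load] at hc
        simp [firstFitItem, hc]
      rw [e]
      refine ⟨by simp, ?_, ?_, ?_⟩
      · rw [allItems_cons, allItems_cons, ← Multiset.cons_coe, Multiset.cons_add]
      · rw [List.forall_mem_cons]
        refine ⟨?_, fun C hC => hfine C (List.mem_cons_of_mem _ hC)⟩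
        simpa [Bin.Fine, Bin.load, add_comm] using hc
      · simp only [homeTotal_cons, Bin.homeCount, List.countP_cons]
        omega
    · have e : (firstFitItem q T x (B :: l)).val = B :: (firstFitItem q T x l).val := by
        rw [Bin.load] at hc
        simp [firstFitItem, hc]
      obtain ⟨g1, g2, g3, g4⟩ := ih (by
        obtain ⟨B', h1, h2⟩ := h
        rcases List.mem_cons.1 h1 with rfl | h1
        · exact absurd h2 hc
        · exact ⟨B', h1, h2⟩) fun C hC => hfine C (List.mem_cons_of_mem _ hC)
      rw [e]
      refine ⟨by simp [g1], ?_, ?_, ?_⟩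
      · rw [allItems_cons, allItems_cons, g2, Multiset.add_cons]
      · rw [List.forall_mem_cons]
        exact ⟨hfine B List.mem_cons_self, g3⟩
      · simpa using g4

/-- Relaxed First-Fit places all small items: as long as the total processing time is at most `T`
times the number of bins, some bin has load at most `T` and can take another small item. -/
theorem firstFit_spec {q T : ℕ} {S : List Item} {bins : List Bin} (hbins : bins ≠ [])
    (hS : ∀ x ∈ S, x.time * q ≤ T) (hfine : ∀ B ∈ bins, B.Fine q T)
    (htotal : ((allItems bins).map Item.time).sum + (S.map Item.time).sum ≤ bins.length * T) :
    (firstFit q T S bins).val.map Bin.machine = bins.map Bin.machine ∧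
      allItems (firstFit q T S bins).val = allItems bins + (S : Multiset Item) ∧
      (∀ B ∈ (firstFit q T S bins).val, B.Fine q T) ∧
      homeTotal bins ≤ homeTotal (firstFit q T S bins).val := by
  induction S generalizing bins with
  | nil => simpa [firstFit] using hfine
  | cons x S ih =>
    obtain ⟨B, hB, hle⟩ : ∃ B ∈ bins, B.load ≤ T := by
      by_contra! hc
      have h1 := List.sum_lt_sum_of_ne_nil (l := bins) hbins (fun _ => T) Bin.load hc
      rw [sum_load_eq] at h1
      simp only [List.map_const', List.sum_replicate, smul_eq_mul] at h1
      omega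
    have hx := hS x List.mem_cons_self
    obtain ⟨h1, h2, h3, h4⟩ := firstFitItem_spec (x := x) ⟨B, hB, by
      calc q * (B.load + x.time) = q * B.load + x.time * q := by ring
        _ ≤ q * T + T := Nat.add_le_add (Nat.mul_le_mul_left q hle) hx
        _ = (q + 1) * T := by ring⟩ hfine
    have hlen : (firstFitItem q T x bins).val.length = bins.length := by
      simpa using congrArg List.length h1
    obtain ⟨g1, g2, g3, g4⟩ := ih (bins := (firstFitItem q T x bins).val)
      (fun h => by
        rw [h, List.length_nil] at hlen
        exact hbins (List.length_eq_zero_iff.1 hlen.symm))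
      (fun y hy => hS y (List.mem_cons_of_mem _ hy)) h3 (by
        rw [h2, hlen, Multiset.map_cons, Multiset.sum_cons]
        rw [List.map_cons, List.sum_cons] at htotal
        omega)
    have e : (firstFit q T (x :: S) bins).val =
        (firstFit q T S (firstFitItem q T x bins).val).val := by
      simp [firstFit]
    rw [e]
    refine ⟨g1.trans h1, ?_, g3, h4.trans g4⟩
    rw [g2, h2, ← Multiset.cons_coe, Multiset.cons_add, Multiset.add_cons]

/-- Vacant places are filled by large items and small items are added by First-Fit. -/
theorem firstFit_fillBins_spec {q T : ℕ} (hq : 0 < q) {bins : List Bin} {pool : List (ℕ × Item)}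
    {S : List Item} (hbins : bins ≠ [])
    (hpool : ((pool.map Prod.fst : List ℕ) : Multiset ℕ) = allVacant bins)
    (hbound : ∀ y ∈ pool, RoundingBound q T y) (hfit : ∀ B ∈ bins, B.Fits q T)
    (hS : ∀ x ∈ S, x.time * q ≤ T)
    (htotal : ((allItems bins + (pool.map Prod.snd : List Item) + (S : Multiset Item)).map
      Item.time).sum ≤ bins.length * T) :
    (firstFit q T S (fillBins bins pool).val).val.map Bin.machine = bins.map Bin.machine ∧
      allItems (firstFit q T S (fillBins bins pool).val).val =
        allItems bins + (pool.map Prod.snd : List Item) + (S : Multiset Item) ∧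
      (∀ B ∈ (firstFit q T S (fillBins bins pool).val).val, B.Fine q T) ∧
      homeTotal bins ≤ homeTotal (firstFit q T S (fillBins bins pool).val).val := by
  obtain ⟨h1, h2, h3, h4⟩ := fillBins_spec hq hpool hbound hfit
  have hlen : (fillBins bins pool).val.length = bins.length := by
    simpa using congrArg List.length h1
  obtain ⟨g1, g2, g3, g4⟩ := firstFit_spec (bins := (fillBins bins pool).val) (S := S)
    (fun h => by
      rw [h, List.length_nil] at hlen
      exact hbins (List.length_eq_zero_iff.1 hlen.symm)) hS h3 (by
      rw [hlen, h2]
      simpa [Multiset.map_add, Multiset.sum_add] using htotal)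
  exact ⟨g1.trans h1, by rw [g2, h2], g3, h4.trans g4⟩

end

section

/-! ### Assignments and schedules -/

/-- The item of a job, with its machine in the initial assignment. -/
def mkItem (σ₀ : List (ℕ × ℕ)) (j : Job) : Item := ⟨j.id, j.time, σ₀.lookup j.id⟩

theorem makeItems_val (σ₀ : List (ℕ × ℕ)) (l : List Job) :
    (makeItems σ₀ l).val = l.map (mkItem σ₀) := by
  simp [makeItems, mkItem]

theorem mem_of_lookup_eq_some {l : List (ℕ × ℕ)} {a b : ℕ} (h : l.lookup a = some b) :
    (a, b) ∈ l := by
  obtain ⟨k, r, rfl, -⟩ := List.lookup_eq_some_iff.1 h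
  simp

theorem lookup_eq_some_of_mem {l : List (ℕ × ℕ)} {a b : ℕ} (hn : (l.map Prod.fst).Nodup)
    (h : (a, b) ∈ l) : l.lookup a = some b := by
  obtain ⟨k, r, rfl⟩ := List.append_of_mem h
  refine List.lookup_eq_some_iff.2 ⟨k, r, rfl, fun p hp => ?_⟩
  rw [List.map_append, List.nodup_append] at hn
  have := hn.2.2 p.1 (List.mem_map_of_mem hp) a (by simp)
  simpa using fun e => this e.symm

/-- Splitting a list by the values of `f`. -/
theorem flatMap_filter_perm {α : Type} {M : List ℕ} (hM : M.Nodup) {L : List α}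
    {f : α → Option ℕ} (hf : ∀ x ∈ L, ∃ i ∈ M, f x = some i) :
    (M.flatMap fun i => L.filter fun x => f x = some i).Perm L := by
  classical
  induction M generalizing L with
  | nil =>
    obtain rfl : L = [] := List.eq_nil_iff_forall_not_mem.2 fun x hx => by simpa using hf x hx
    simp
  | cons i M ih =>
    rw [List.nodup_cons] at hM
    have h1 := ih (L := L.filter fun x => ¬ f x = some i) hM.2 (fun x hx => by
      rw [List.mem_filter] at hx
      obtain ⟨j, hj, hx2⟩ := hf x hx.1
      rcases List.mem_cons.1 hj with rfl | hj
      · simp [hx2] at hx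
      · exact ⟨j, hj, hx2⟩)
    rw [List.flatMap_cons]
    refine List.Perm.trans ?_ (List.filter_append_perm (fun x => decide (f x = some i)) L)
    refine List.Perm.append_left _ (List.Perm.trans (List.Perm.of_eq ?_) (h1.trans
      (List.Perm.of_eq ?_)))
    · rw [List.flatMap_def, List.flatMap_def]
      congr 1
      refine List.map_congr_left fun j hj => ?_
      rw [List.filter_filter]
      refine List.filter_congr fun x _ => ?_
      by_cases e : f x = some j
      · have : j ≠ i := fun h => hM.1 (h ▸ hj)
        simp [e, this]
      · simp [e]
    · exact List.filter_congr fun x _ => by simp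

variable {I : Instance} {σ₀ σ : List (ℕ × ℕ)} {items : List Item}

theorem load_eq (hitems : items.Perm (I.jobs.map (mkItem σ₀))) (σ : List (ℕ × ℕ)) (i : ℕ) :
    load I σ i = ((items.filter fun x => σ.lookup x.id = some i).map Item.time).sum := by
  rw [((hitems.filter _).map _).sum_eq, List.filter_map, List.map_map]
  rfl

theorem IsAssignment.exists_lookup (h : IsAssignment I σ)
    (hitems : items.Perm (I.jobs.map (mkItem σ₀))) {x : Item} (hx : x ∈ items) :
    ∃ i ∈ I.machines, σ.lookup x.id = some i := by
  obtain ⟨j, hj, rfl⟩ := List.mem_map.1 (hitems.subset hx)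
  have h1 : j.id ∈ σ.map Prod.fst := h.1.symm.subset (List.mem_map_of_mem hj)
  cases e : σ.lookup j.id with
  | none =>
    obtain ⟨p, hp, hp2⟩ := List.mem_map.1 h1
    have := List.lookup_eq_none_iff.1 e p hp
    simp [hp2] at this
  | some i => exact ⟨i, h.2 _ (mem_of_lookup_eq_some e), e⟩

theorem load_le_makespan {i : ℕ} (hi : i ∈ I.machines) : load I σ i ≤ makespan I σ :=
  Finset.le_sup (f := load I σ) (List.mem_toFinset.2 hi)

theorem exists_isAssignment (h : I.machines ≠ []) : ∃ σ, IsAssignment I σ := by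
  obtain ⟨i, hi⟩ := List.exists_mem_of_ne_nil _ h
  refine ⟨I.jobs.map fun j => (j.id, i), ?_, ?_⟩
  · simp [List.map_map, Function.comp_def]
  · simp [hi]

theorem exists_optimal (h : I.machines ≠ []) :
    ∃ σ, IsAssignment I σ ∧ makespan I σ = optMakespan I := by
  obtain ⟨σ, hσ⟩ := exists_isAssignment h
  exact Nat.sInf_mem (s := {C | ∃ σ, IsAssignment I σ ∧ makespan I σ = C}) ⟨_, σ, hσ, rfl⟩

theorem optMakespan_le (h : IsAssignment I σ) : optMakespan I ≤ makespan I σ :=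
  Nat.sInf_le ⟨σ, h, rfl⟩

theorem items_id_nodup (hI : I.Valid) (hitems : items.Perm (I.jobs.map (mkItem σ₀))) :
    (items.map Item.id).Nodup := by
  rw [(hitems.map Item.id).nodup_iff, List.map_map]
  exact hI.2.1

theorem scheduleOf_val (F : List Bin) :
    (scheduleOf F).val = F.flatMap fun B => B.items.map fun x => (x, B.machine) := by
  induction F with
  | nil => rfl
  | cons B F ih => simp [scheduleOf, ih]

/-- The assignment given by a schedule. -/
def assignmentOf (F : List Bin) : List (ℕ × ℕ) :=
  (scheduleOf F).val.map fun x => (x.1.id, x.2)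

theorem mem_assignmentOf {F : List Bin} {y : ℕ × ℕ} :
    y ∈ assignmentOf F ↔ ∃ B ∈ F, ∃ x ∈ B.items, (x.id, B.machine) = y := by
  simp only [assignmentOf, scheduleOf_val, List.mem_map, List.mem_flatMap, Prod.exists]
  constructor
  · rintro ⟨_, _, ⟨B, hB, x, hx, e⟩, rfl⟩
    obtain ⟨rfl, rfl⟩ := Prod.mk.inj e
    exact ⟨B, hB, _, hx, rfl⟩
  · rintro ⟨B, hB, x, hx, rfl⟩
    exact ⟨x, B.machine, ⟨B, hB, x, hx, rfl⟩, rfl⟩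

theorem schedule_items (F : List Bin) :
    (((scheduleOf F).val.map Prod.fst : List Item) : Multiset Item) = allItems F := by
  rw [scheduleOf_val]
  induction F with
  | nil => rfl
  | cons B F ih =>
    rw [List.flatMap_cons, List.map_append, ← Multiset.coe_add, ih, allItems_cons, List.map_map]
    simp [Function.comp_def]

theorem schedule_items_perm {F : List Bin} (hall : allItems F = (items : Multiset Item)) :
    ((scheduleOf F).val.map Prod.fst).Perm items :=
  Multiset.coe_eq_coe.1 ((schedule_items F).trans hall)

theorem assignmentOf_fst_perm {F : List Bin} (hall : allItems F = (items : Multiset Item)) :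
    ((assignmentOf F).map Prod.fst).Perm (items.map Item.id) := by
  refine List.Perm.trans (List.Perm.of_eq ?_) ((schedule_items_perm hall).map Item.id)
  rw [assignmentOf, List.map_map, List.map_map]
  rfl

theorem isAssignment_assignmentOf {F : List Bin} (hitems : items.Perm (I.jobs.map (mkItem σ₀)))
    (hm : (F.map Bin.machine).Perm I.machines) (hall : allItems F = (items : Multiset Item)) :
    IsAssignment I (assignmentOf F) := by
  refine ⟨(assignmentOf_fst_perm hall).trans ?_, fun y hy => ?_⟩
  · refine (hitems.map Item.id).trans (List.Perm.of_eq ?_)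
    rw [List.map_map]
    rfl
  · obtain ⟨B, hB, x, -, rfl⟩ := mem_assignmentOf.1 hy
    exact hm.subset (List.mem_map_of_mem hB)

theorem lookup_assignmentOf {F : List Bin} (hI : I.Valid)
    (hitems : items.Perm (I.jobs.map (mkItem σ₀))) (hall : allItems F = (items : Multiset Item))
    {B : Bin} (hB : B ∈ F) {x : Item} (hx : x ∈ B.items) :
    (assignmentOf F).lookup x.id = some B.machine := by
  refine lookup_eq_some_of_mem ?_ (mem_assignmentOf.2 ⟨B, hB, x, hx, rfl⟩)
  rw [(assignmentOf_fst_perm hall).nodup_iff]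
  exact items_id_nodup hI hitems

theorem filter_allItems {F : List Bin} {f : Item → Option ℕ} (hn : (F.map Bin.machine).Nodup)
    (hf : ∀ B ∈ F, ∀ x ∈ B.items, f x = some B.machine) {B : Bin} (hB : B ∈ F) :
    (allItems F).filter (fun x => f x = some B.machine) = (B.items : Multiset Item) := by
  have hne : ∀ {F : List Bin}, (∀ B ∈ F, ∀ x ∈ B.items, f x = some B.machine) → ∀ {i : ℕ},
      i ∉ F.map Bin.machine → (allItems F).filter (fun x => f x = some i) = 0 := by
    intro F hf i hi
    induction F with
    | nil => simp
    | cons C F ih =>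
      rw [allItems_cons, Multiset.filter_add, ih (fun B hB => hf B (List.mem_cons_of_mem _ hB))
        (fun h => hi (List.mem_cons_of_mem _ h)), add_zero, Multiset.filter_eq_nil]
      intro x hx e
      rw [hf C List.mem_cons_self x hx, Option.some.injEq] at e
      exact hi (by simp [← e])
  induction F with
  | nil => simp at hB
  | cons C F ih =>
    rw [List.map_cons, List.nodup_cons] at hn
    have hf' := fun B hB => hf B (List.mem_cons_of_mem C hB)
    rw [allItems_cons, Multiset.filter_add]
    rcases List.mem_cons.1 hB with rfl | hB
    · rw [hne hf' hn.1, add_zero, Multiset.filter_eq_self]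
      exact hf B List.mem_cons_self
    · rw [ih hn.2 hf' hB, Multiset.filter_eq_nil.2, zero_add]
      intro x hx e
      rw [hf C List.mem_cons_self x hx, Option.some.injEq] at e
      exact hn.1 (e ▸ List.mem_map_of_mem hB)

theorem makespan_assignmentOf_le {F : List Bin} (hI : I.Valid)
    (hitems : items.Perm (I.jobs.map (mkItem σ₀))) (hm : (F.map Bin.machine).Perm I.machines)
    (hall : allItems F = (items : Multiset Item)) {b : ℕ} (hb : ∀ B ∈ F, B.load ≤ b) :
    makespan I (assignmentOf F) ≤ b := by
  refine Finset.sup_le fun i hi => ?_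
  obtain ⟨B, hB, rfl⟩ := List.mem_map.1 (hm.symm.subset (List.mem_toFinset.1 hi))
  have h1 := filter_allItems (f := fun x => (assignmentOf F).lookup x.id) (hm.nodup_iff.2 hI.1)
    (fun B hB x hx => lookup_assignmentOf hI hitems hall hB hx) hB
  rw [hall, Multiset.filter_coe, Multiset.coe_eq_coe] at h1
  rw [load_eq hitems, (h1.map Item.time).sum_eq]
  exact hb B hB

/-! ### Rounded large items of an assignment -/

/-- The large items. -/
def largeItems (q T : ℕ) (l : List Item) : List Item := l.filter fun x => T < x.time * q

/-- The small items. -/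
def smallItems (q T : ℕ) (l : List Item) : List Item := l.filter fun x => ¬ T < x.time * q

/-- The large items with their rounded sizes. -/
def largePairs (q T : ℕ) (l : List Item) : List (ℕ × Item) :=
  (largeItems q T l).map fun x => (x.rounded q T, x)

theorem splitItems_eq (q T : ℕ) (l : List Item) :
    (splitItems q T l).val = (largePairs q T l, smallItems q T l) :=
  splitItems_val q T l

theorem sizesOf_val (l : List (ℕ × Item)) : (sizesOf l).val = l.map Prod.fst := by
  simp [sizesOf]

theorem large_append_small (q T : ℕ) (l : List Item) :
    (largeItems q T l ++ smallItems q T l).Perm l := by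
  refine List.Perm.trans (List.Perm.of_eq ?_)
    (List.filter_append_perm (fun x : Item => decide (T < x.time * q)) l)
  rw [largeItems, smallItems]
  congr 1
  exact List.filter_congr fun x _ => by rw [decide_not]

theorem largePairs_fst (q T : ℕ) (l : List Item) :
    (largePairs q T l).map Prod.fst = (largeItems q T l).map (Item.rounded q T) := by
  rw [largePairs, List.map_map]
  rfl

theorem largePairs_snd (q T : ℕ) (l : List Item) :
    (largePairs q T l).map Prod.snd = largeItems q T l := by
  rw [largePairs, List.map_map]
  simp [Function.comp_def]

theorem sum_rounded_mul_le (q T : ℕ) (l : List Item) :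
    (l.map (Item.rounded q T)).sum * T ≤ q * q * (l.map Item.time).sum := by
  induction l with
  | nil => simp
  | cons x l ih =>
    simp only [List.map_cons, List.sum_cons, add_mul, mul_add]
    refine Nat.add_le_add ((Nat.div_mul_le_self _ _).trans (le_of_eq ?_)) ih
    ring

/-- The total size of rounded large and of small items is at most `1` on a machine of load at
most `T`. -/
theorem rounded_add_small_le {q T : ℕ} {l : List Item} (h : (l.map Item.time).sum ≤ T) :
    q * q * ((smallItems q T l).map Item.time).sum +
      ((largeItems q T l).map (Item.rounded q T)).sum * T ≤ q * q * T := by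
  have h1 := sum_rounded_mul_le q T (largeItems q T l)
  have h2 := ((large_append_small q T l).map Item.time).sum_eq
  rw [List.map_append, List.sum_append] at h2
  have h3 := Nat.mul_le_mul_left (q * q) (h2.trans_le h)
  rw [mul_add] at h3
  omega

theorem pos_of_mem_largeItems {q T : ℕ} {l : List Item} (h : (l.map Item.time).sum ≤ T) {x : Item}
    (hx : x ∈ largeItems q T l) : 0 < T := by
  rw [largeItems, List.mem_filter, decide_eq_true_eq] at hx
  have h1 := List.single_le_sum (l := l.map Item.time) (by simp) _ (List.mem_map_of_mem hx.1)
  rcases Nat.eq_zero_or_pos T with rfl | hT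
  · obtain ⟨-, hx⟩ := hx
    obtain e : x.time = 0 := by omega
    simp [e] at hx
  · exact hT

/-- The configurations of an assignment of load at most `T` are enumerated. -/
theorem exists_configuration_of_loads {q T : ℕ} (hq : 0 < q) {M : List ℕ} (hM : M.Nodup)
    {f : Item → Option ℕ} (hf : ∀ x ∈ items, ∃ i ∈ M, f x = some i)
    (hload : ∀ i ∈ M, ((items.filter fun x => f x = some i).map Item.time).sum ≤ T) :
    ∃ (M' : List ℕ) (D : ℕ → Config), M'.Perm M ∧
      (∀ i ∈ M, (D i).Perm
        ((largeItems q T (items.filter fun x => f x = some i)).map (Item.rounded q T))) ∧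
      M'.map D ∈ (configurations q M.length ((largePairs q T items).map Prod.fst)).val := by
  refine exists_mem_configurations hq
    (C := fun i => (largeItems q T (items.filter fun x => f x = some i)).map (Item.rounded q T))
    (fun i hi => ⟨?_, ?_⟩) ?_
  · intro r hr
    obtain ⟨x, hx, rfl⟩ := List.mem_map.1 hr
    have hT := pos_of_mem_largeItems (hload i hi) hx
    rw [largeItems, List.mem_filter, decide_eq_true_eq] at hx
    exact le_rounded hT hx.2
  · rcases List.eq_nil_or_concat (largeItems q T (items.filter fun x => f x = some i)) with
      h | ⟨_, x, h⟩
    · simp [h]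
    · have hT := pos_of_mem_largeItems (x := x) (hload i hi) (by rw [h]; simp)
      have := rounded_add_small_le (q := q) (hload i hi)
      exact Nat.le_of_mul_le_mul_right (by omega) hT
  · rw [largePairs_fst]
    have h1 := flatMap_filter_perm hM (L := largeItems q T items) (f := f)
      fun x hx => hf x (List.mem_of_mem_filter hx)
    refine List.Perm.trans (List.Perm.of_eq ?_) (h1.map (Item.rounded q T))
    rw [List.map_flatMap]
    simp only [largeItems, List.filter_filter, Bool.and_comm]

/-! ### The approximation scheme for the minimum makespan -/

theorem fits_val_iff {q m total T : ℕ} :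
    (fits q m total items T).val = true ↔
      total ≤ m * T ∧ (configurations q m ((largePairs q T items).map Prod.fst)).val ≠ [] := by
  by_cases h : total ≤ m * T
  · cases hc : (configurations q m ((largePairs q T items).map Prod.fst)).val <;>
      simp [fits, h, splitItems_eq, sizesOf_val, hc]
  · simp [fits, h]

theorem total_le {T : ℕ} {M : List ℕ} (hM : M.Nodup) {f : Item → Option ℕ}
    (hf : ∀ x ∈ items, ∃ i ∈ M, f x = some i)
    (hload : ∀ i ∈ M, ((items.filter fun x => f x = some i).map Item.time).sum ≤ T) :
    (items.map Item.time).sum ≤ M.length * T := by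
  rw [← ((flatMap_filter_perm hM hf).map Item.time).sum_eq, List.map_flatMap, List.flatMap_def,
    List.sum_flatten, List.map_map]
  refine (List.sum_le_card_nsmul _ T fun n hn => ?_).trans_eq (by simp)
  obtain ⟨i, hi, rfl⟩ := List.mem_map.1 hn
  exact hload i hi

theorem total_le_mul_makespan (hI : I.Valid) (hitems : items.Perm (I.jobs.map (mkItem σ₀)))
    (hσ : IsAssignment I σ) : (items.map Item.time).sum ≤ I.machines.length * makespan I σ :=
  total_le hI.1 (f := fun x => σ.lookup x.id) (fun _ hx => hσ.exists_lookup hitems hx)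
    fun i hi => by
      rw [← load_eq hitems]
      exact load_le_makespan hi

theorem fits_of_optMakespan_le {q T : ℕ} (hq : 0 < q) (hI : I.Valid) (hne : I.machines ≠ [])
    (hitems : items.Perm (I.jobs.map (mkItem σ₀))) (hT : optMakespan I ≤ T) :
    (fits q I.machines.length (items.map Item.time).sum items T).val = true := by
  obtain ⟨σ, hσ, ho⟩ := exists_optimal hne
  have hf : ∀ x ∈ items, ∃ i ∈ I.machines, σ.lookup x.id = some i :=
    fun _ hx => hσ.exists_lookup hitems hx
  have hload : ∀ i ∈ I.machines,
      ((items.filter fun x => σ.lookup x.id = some i).map Item.time).sum ≤ T := fun i hi => by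
    rw [← load_eq hitems]
    exact (load_le_makespan hi).trans (ho.trans_le hT)
  obtain ⟨M', D, -, -, h⟩ := exists_configuration_of_loads hq hI.1 hf hload
  exact fits_val_iff.2 ⟨total_le hI.1 hf hload, List.ne_nil_of_mem h⟩

theorem roundingBound_of_mem {q T m : ℕ} (htotal : (items.map Item.time).sum ≤ m * T)
    {y : ℕ × Item} (hy : y ∈ largePairs q T items) : RoundingBound q T y := by
  obtain ⟨x, hx, rfl⟩ := List.mem_map.1 hy
  rw [largeItems, List.mem_filter, decide_eq_true_eq] at hx
  refine roundingBound_of_large ?_ hx.2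
  rcases Nat.eq_zero_or_pos T with rfl | hT
  · have h1 := List.single_le_sum (l := items.map Item.time) (by simp) _
      (List.mem_map_of_mem hx.1)
    obtain e : x.time = 0 := by omega
    simp [e] at hx
  · exact hT

theorem coe_flatten_vacant (bins : List Bin) :
    (((bins.map Bin.vacant).flatten : List ℕ) : Multiset ℕ) = allVacant bins := by
  induction bins with
  | nil => rfl
  | cons B l ih =>
    rw [List.map_cons, List.flatten_cons, ← Multiset.coe_add, ih, allVacant_cons]

/-- If the test succeeds for `T`, filling a feasible configuration yields an assignment of makespan
at most `(1 + 1/q) T`. -/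
theorem optMakespan_le_of_fits {q T : ℕ} (hq : 0 < q) (hI : I.Valid) (hne : I.machines ≠ [])
    (hitems : items.Perm (I.jobs.map (mkItem σ₀)))
    (h : (fits q I.machines.length (items.map Item.time).sum items T).val = true) :
    optMakespan I ≤ T + T / q := by
  obtain ⟨htotal, hc⟩ := fits_val_iff.1 h
  obtain ⟨C, hC⟩ := List.exists_mem_of_ne_nil _ hc
  obtain ⟨hlen, hcap, hperm⟩ := mem_configurations_sound hC
  let bins := (I.machines.zip C).map fun p => (⟨p.1, p.2, []⟩ : Bin)
  have hbm : bins.map Bin.machine = I.machines := by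
    rw [List.map_map]
    exact List.map_fst_zip hlen.ge
  have hbl : bins.length = I.machines.length := by
    simpa using congrArg List.length hbm
  have hbv : bins.map Bin.vacant = C := by
    rw [List.map_map]
    exact List.map_snd_zip hlen.le
  have hbi : ∀ B ∈ bins, B.items = [] := by
    intro B hB
    obtain ⟨p, -, rfl⟩ := List.mem_map.1 hB
    rfl
  have hbi' : allItems bins = 0 := by
    rw [allItems, List.map_congr_left (g := fun _ => 0) fun B hB => by rw [hbi B hB]; rfl]
    simp
  obtain ⟨g1, g2, g3, -⟩ := firstFit_fillBins_spec (q := q) (T := T) hq (bins := bins)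
    (pool := largePairs q T items) (S := smallItems q T items)
    (fun e => hne (by rw [← hbm, e]; rfl))
    (by
      rw [← Multiset.coe_eq_coe.2 hperm, ← hbv]
      exact coe_flatten_vacant bins)
    (fun y hy => roundingBound_of_mem htotal hy)
    (fun B hB => by
      unfold Bin.Fits
      have : B.vacant ∈ C := by rw [← hbv]; exact List.mem_map_of_mem hB
      have := Nat.mul_le_mul_left ((q + 1) * T) (hcap _ this).2
      rw [Bin.load, hbi B hB, mul_comm (q * q) ((q + 1) * T)]
      simpa [-mul_eq_mul_left_iff] using this)
    (fun x hx => by simpa using List.of_mem_filter hx)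
    (by
      rw [hbi', zero_add, hbl, largePairs_snd, Multiset.coe_add,
        Multiset.coe_eq_coe.2 (large_append_small q T items)]
      simpa using htotal)
  rw [hbi', zero_add, largePairs_snd, Multiset.coe_add,
    Multiset.coe_eq_coe.2 (large_append_small q T items)] at g2
  have hm := List.Perm.of_eq (g1.trans hbm)
  refine (optMakespan_le (isAssignment_assignmentOf hitems hm g2)).trans
    (makespan_assignmentOf_le hI hitems hm g2 fun B hB => ?_)
  have := g3 B hB
  unfold Bin.Fine at this
  rw [add_comm, ← Nat.add_mul_div_left _ _ hq, Nat.le_div_iff_mul_le hq]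
  linarith

/-- Invariant of binary search: the lower end is at most `c`, and the test succeeds at the upper
end. The test may fail again above a number at which it succeeds, as long as this is below `c`. -/
theorem search_spec {q m total c n lo hi : ℕ} (hc : ∀ T, c ≤ T → (fits q m total items T).val = true)
    (hlo : lo ≤ c) (hlh : lo ≤ hi) (hhi : (fits q m total items hi).val = true)
    (hn : hi - lo < 2 ^ n) :
    (search q m total items n lo hi).val ≤ c ∧ (search q m total items n lo hi).val ≤ hi ∧
      (fits q m total items (search q m total items n lo hi).val).val = true := by
  induction n generalizing lo hi with
  | zero =>
    obtain rfl : lo = hi := by omega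
    simpa [search] using ⟨hlo, hhi⟩
  | succ n ih =>
    rw [pow_succ] at hn
    by_cases h : lo < hi
    · by_cases hok : (fits q m total items ((lo + hi) / 2)).val = true
      · have e : (search q m total items (n + 1) lo hi).val =
            (search q m total items n lo ((lo + hi) / 2)).val := by
          simp [search, h, hok]
        rw [e]
        have := ih (lo := lo) (hi := (lo + hi) / 2) hlo (by omega) hok (by omega)
        exact ⟨this.1, this.2.1.trans (by omega), this.2.2⟩
      · have e : (search q m total items (n + 1) lo hi).val =
            (search q m total items n ((lo + hi) / 2 + 1) hi).val := by
          simp [search, h, hok]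
        rw [e]
        refine ih (lo := (lo + hi) / 2 + 1) (hi := hi) ?_ (by omega) hhi (by omega)
        by_contra! hlt
        exact hok (hc _ (by omega))
    · obtain rfl : lo = hi := by omega
      simpa [search] using ⟨hlo, hhi⟩

/-- The number found by binary search is between the minimum makespan `c` and `(1 + 1/q) c`. -/
theorem approxMakespan_spec {q : ℕ} (hq : 0 < q) (hI : I.Valid) (hne : I.machines ≠ [])
    (hitems : items.Perm (I.jobs.map (mkItem σ₀))) :
    optMakespan I ≤ (approxMakespan q I.machines.length items).val ∧
      q * (approxMakespan q I.machines.length items).val ≤ (q + 1) * optMakespan I ∧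
      (approxMakespan q I.machines.length items).val ≤ 2 * (items.map Item.time).sum := by
  set total := (items.map Item.time).sum with htot
  have hmax : optMakespan I ≤ total := by
    obtain ⟨σ, hσ, ho⟩ := exists_optimal hne
    rw [← ho]
    refine Finset.sup_le fun i _ => ?_
    rw [load_eq hitems]
    exact (List.filter_sublist.map Item.time).sum_le_sum (by simp)
  obtain ⟨h1, h2, h3⟩ := search_spec (q := q) (m := I.machines.length) (total := total)
    (items := items) (c := optMakespan I) (n := total.size) (lo := 0) (hi := total)
    (fun T hT => fits_of_optMakespan_le hq hI hne hitems hT) (Nat.zero_le _) (Nat.zero_le _)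
    (fits_of_optMakespan_le hq hI hne hitems hmax) (by simpa using Nat.lt_size_self total)
  have e : (approxMakespan q I.machines.length items).val =
      (search q I.machines.length total items total.size 0 total).val +
        (search q I.machines.length total items total.size 0 total).val / q := by
    simp [approxMakespan, htot]
  rw [e]
  set T := (search q I.machines.length total items total.size 0 total).val
  refine ⟨optMakespan_le_of_fits hq hI hne hitems h3, ?_, ?_⟩
  · have h4 := Nat.mul_div_le T q
    have h5 := Nat.mul_le_mul_left (q + 1) h1
    linarith
  · have := Nat.div_le_self T q
    omega

end

section

/-! ### The bipartite graph of machines and configurations -/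

theorem isHome_val (i : ℕ) (x : Item) : (isHome i x).val = decide (x.home = some i) := by
  cases h : x.home <;> simp [isHome, h]

theorem isNew_val (x : Item) : (isNew x).val = decide (x.home = none) := by
  cases h : x.home <;> simp [isNew, h]

/-- The vertex of the bipartite graph for machine `i`. -/
def vertexAt (q T : ℕ) (items : List Item) (present : Bool) (i : ℕ) : Vertex :=
  ⟨i, present, (largePairs q T items).filter fun y => y.2.home = some i,
    (smallItems q T items).filter fun x => x.home = some i⟩

theorem makeVertices_val (q T : ℕ) (items : List Item) (present : Bool) (l : List ℕ) :
    (makeVertices present (largePairs q T items) (smallItems q T items) l).val =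
      l.map (vertexAt q T items present) := by
  simp [makeVertices, vertexAt, isHome_val]

/-- The number of items kept in place on a machine that gets the configuration `C`. -/
def keptCount (q T : ℕ) (v : Vertex) (C : Config) : ℕ :=
  (keepLarge C v.large).val.kept.length + (keepSmall q T C v.small).val.1.length

@[simp] theorem edgeCost_none (q T forbidden : ℕ) (v : Vertex) :
    (edgeCost q T forbidden v none).val = 0 := rfl

theorem edgeCost_some (q T forbidden : ℕ) (v : Vertex) (C : Config) :
    (edgeCost q T forbidden v (some C)).val =
      if v.present then (keepLarge C v.large).val.vacant.length +
        (keepSmall q T C v.small).val.2.length else forbidden := by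
  cases h : v.present <;> simp [edgeCost, h]

/-- A vertex whose items are on their initial machine and for which small and large items have the
properties required of them. -/
structure Vertex.Good (q T : ℕ) (v : Vertex) : Prop where
  sorted : v.small.Pairwise fun x y => y.time ≤ x.time
  bound : ∀ y ∈ v.large, RoundingBound q T y
  small : ∀ x ∈ v.small, x.time * q ≤ T
  homeLarge : ∀ y ∈ v.large, y.2.home = some v.machine
  homeSmall : ∀ x ∈ v.small, x.home = some v.machine

/-- The sum of edge cost and number of kept items does not depend on the choice of kept items, so
that a minimum cost matching keeps a maximum number of items in place. -/
theorem edgeCost_add_keptCount {q T forbidden : ℕ} {v : Vertex} {C : Config} (hv : v.Good q T)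
    (hp : v.present = true) (hC : C.sum ≤ q * q) :
    (edgeCost q T forbidden v (some C)).val + keptCount q T v C = C.length + v.small.length := by
  have h1 := keepLarge_lengths C v.large
  have h2 := congrArg List.length (keepSmall_spec (T := T) hv.sorted hC).1
  rw [List.length_append] at h2
  rw [edgeCost_some, if_pos hp, keptCount]
  omega

/-- The multiset `Z` consists of the rounded sizes of the large items kept in place. It links the
sizes of the large items left over to the vacant places, so that the two agree once all places and
all large items together have the same sizes. -/
theorem placeKept_spec {q T : ℕ} {large : List (ℕ × Item)} {small : List Item}
    {M : List (Vertex × Option Config)} (hM : ∀ p ∈ M, p.1.Good q T)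
    (hC : ∀ p ∈ M, ∀ C, p.2 = some C → C.sum ≤ q * q)
    (hlarge : ∀ y ∈ large, RoundingBound q T y) (hsmall : ∀ x ∈ small, x.time * q ≤ T) :
    (placeKept q T large small M).val.bins.map Bin.machine =
        M.filterMap (fun p => p.2.map fun _ => p.1.machine) ∧
      allItems (placeKept q T large small M).val.bins +
          ((placeKept q T large small M).val.large.map Prod.snd : List Item) +
          ((placeKept q T large small M).val.small : Multiset Item) =
        (large.map Prod.snd : List Item) + (small : Multiset Item) +
          (M.map fun p => ((p.1.large.map Prod.snd : List Item) : Multiset Item) +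
            (p.1.small : Multiset Item)).sum ∧
      (∃ Z : Multiset ℕ, Z + ((placeKept q T large small M).val.large.map Prod.fst : List ℕ) =
          (large.map Prod.fst : List ℕ) +
            (M.map fun p => ((p.1.large.map Prod.fst : List ℕ) : Multiset ℕ)).sum ∧
          Z + allVacant (placeKept q T large small M).val.bins =
            (M.map fun p => p.2.elim 0 fun C => (C : Multiset ℕ)).sum) ∧
      (∀ B ∈ (placeKept q T large small M).val.bins, B.Fits q T) ∧
      (∀ y ∈ (placeKept q T large small M).val.large, RoundingBound q T y) ∧
      (∀ x ∈ (placeKept q T large small M).val.small, x.time * q ≤ T) ∧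
      (M.map fun p => p.2.elim 0 (keptCount q T p.1)).sum ≤
        homeTotal (placeKept q T large small M).val.bins := by
  induction M with
  | nil => exact ⟨rfl, by simp [placeKept], ⟨0, by simp [placeKept]⟩, by simp [placeKept],
      by simpa [placeKept] using hlarge, by simpa [placeKept] using hsmall, by simp⟩
  | cons p M ih =>
    obtain ⟨v, u⟩ := p
    obtain ⟨g1, g2, ⟨Z, g3, g4⟩, g5, g6, g7, g8⟩ := ih
      (fun p hp => hM p (List.mem_cons_of_mem _ hp)) (fun p hp => hC p (List.mem_cons_of_mem _ hp))
    have hv := hM (v, u) List.mem_cons_self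
    generalize hP : (placeKept q T large small M).val = P at *
    cases u with
    | none =>
      have e : (placeKept q T large small ((v, none) :: M)).val =
          ⟨P.bins, v.large ++ P.large, v.small ++ P.small⟩ := by
        simp [placeKept, hP]
      rw [e]
      refine ⟨by simp [g1], ?_, ⟨Z, ?_, ?_⟩, g5, ?_, ?_, by simpa using g8⟩
      · dsimp only
        rw [List.map_cons, List.sum_cons, List.map_append, ← Multiset.coe_add, ← Multiset.coe_add,
          add_left_comm _ (_ + _) (List.sum _), ← g2]
        abel
      · rw [List.map_cons, List.sum_cons, List.map_append, ← Multiset.coe_add, add_left_comm, g3]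
        abel
      · simpa using g4
      · intro y hy
        exact (List.mem_append.1 hy).elim (hv.bound y) (g6 y)
      · intro y hy
        exact (List.mem_append.1 hy).elim (hv.small y) (g7 y)
    | some C =>
      have hCs := hC (v, some C) List.mem_cons_self C rfl
      obtain ⟨K, k1, k2, k3, -⟩ := keepLarge_spec C v.large
      obtain ⟨s1, s2, -⟩ := keepSmall_spec (T := T) hv.sorted hCs
      have hkc : (keptCount q T v C) = K.length + (keepSmall q T C v.small).val.1.length := by
        rw [keptCount, k1, List.length_map]
      have e : (placeKept q T large small ((v, some C) :: M)).val =
          ⟨⟨v.machine, (keepLarge C v.large).val.vacant,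
              (keepLarge C v.large).val.kept ++ (keepSmall q T C v.small).val.1⟩ :: P.bins,
            (keepLarge C v.large).val.rest ++ P.large,
            (keepSmall q T C v.small).val.2 ++ P.small⟩ := by
        simp [placeKept, hP]
      rw [e, k1]
      have hKL : ∀ y ∈ K, y ∈ v.large := fun y hy => k2.subset (List.mem_append_left _ hy)
      have hSS : ∀ x ∈ (keepSmall q T C v.small).val.1, x ∈ v.small := fun x hx => by
        rw [← s1]; exact List.mem_append_right _ hx
      refine ⟨by simp [g1], ?_, ⟨Z + (K.map Prod.fst : List ℕ), ?_, ?_⟩, ?_, ?_, ?_, ?_⟩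
      · have h2 := Multiset.coe_eq_coe.2 (k2.map Prod.snd)
        rw [List.map_append, ← Multiset.coe_add] at h2
        have h3 : ((keepSmall q T C v.small).val.2 : Multiset Item) +
            ((keepSmall q T C v.small).val.1 : Multiset Item) = v.small := by
          rw [Multiset.coe_add, s1]
        dsimp only
        rw [allItems_cons, List.map_cons, List.sum_cons, List.map_append, ← Multiset.coe_add,
          ← Multiset.coe_add, ← Multiset.coe_add, ← h2, ← h3, add_left_comm _ (_ + _) (List.sum _),
          ← g2]
        abel
      · have h2 := Multiset.coe_eq_coe.2 (k2.map Prod.fst)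
        rw [List.map_append, ← Multiset.coe_add] at h2
        dsimp only
        rw [List.map_cons, List.sum_cons, List.map_append, ← Multiset.coe_add, ← h2,
          add_left_comm _ (_ + _) (List.sum _), ← g3]
        abel
      · have h2 := Multiset.coe_eq_coe.2 k3
        rw [← Multiset.coe_add] at h2
        dsimp only
        rw [List.map_cons, List.sum_cons, allVacant_cons, ← g4]
        dsimp only [Option.elim]
        rw [← h2]
        abel
      · rw [List.forall_mem_cons]
        refine ⟨?_, g5⟩
        have h1 := sum_time_le_of_roundingBound (q := q) (T := T) fun y hy => hv.bound y (hKL y hy)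
        have h2 := k3.sum_eq
        rw [List.sum_append] at h2
        simp only [Bin.Fits, Bin.load, List.map_append, List.sum_append]
        generalize ((keepSmall q T C v.small).val.1.map Item.time).sum = s at *
        generalize ((K.map Prod.snd).map Item.time).sum = l at *
        generalize (K.map Prod.fst).sum = c at *
        generalize (keepLarge C v.large).val.vacant.sum = w at *
        -- the kept small items use the capacity left by the rounded sizes of the configuration
        calc q * q * q * (l + s) + (q + 1) * T * w
            = q * q * q * l + (q * (q * q * s) + (q + 1) * T * w) := by ring
          _ ≤ (q + 1) * T * c + (q * (q * q * s) + (q + 1) * T * w) := Nat.add_le_add_right h1 _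
          _ = q * (q * q * s + (c + w) * T) + T * (c + w) := by ring
          _ = q * (q * q * s + C.sum * T) + T * C.sum := by rw [h2]
          _ ≤ q * (q * q * T) + T * (q * q) :=
            Nat.add_le_add (Nat.mul_le_mul_left _ s2) (Nat.mul_le_mul_left _ hCs)
          _ = q * q * ((q + 1) * T) := by ring
      · intro y hy
        exact (List.mem_append.1 hy).elim
          (fun h => hv.bound y (k2.subset (List.mem_append_right _ h))) (g6 y)
      · intro y hy
        exact (List.mem_append.1 hy).elim
          (fun h => hv.small y (by rw [← s1]; exact List.mem_append_left _ h)) (g7 y)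
      · rw [List.map_cons, List.sum_cons, homeTotal_cons]
        refine Nat.add_le_add (le_of_eq ?_) g8
        have h1 : ∀ x ∈ K.map Prod.snd ++ (keepSmall q T C v.small).val.1,
            x.home = some v.machine := by
          intro x hx
          rcases List.mem_append.1 hx with hx | hx
          · obtain ⟨y, hy, rfl⟩ := List.mem_map.1 hx
            exact hv.homeLarge y (hKL y hy)
          · exact hv.homeSmall x (hSS x hx)
        change keptCount q T v C = List.countP _ _
        rw [List.countP_eq_length.2 fun x hx => by simpa using h1 x hx, hkc, List.length_append,
          List.length_map]

/-! ### Matchings without forbidden edges -/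

/-- The vertices of all machines. -/
def allVertices (q T : ℕ) (items : List Item) (M removed : List ℕ) : List Vertex :=
  M.map (vertexAt q T items true) ++ removed.map (vertexAt q T items false)

/-- The columns of the bipartite graph. -/
def columns (removed : List ℕ) (C : List Config) : List (Option Config) :=
  C.map some ++ removed.map fun _ => none

variable {q T forbidden : ℕ} {items : List Item} {M removed : List ℕ} {C : List Config}

theorem vertexAt_good {m : ℕ} (htotal : (items.map Item.time).sum ≤ m * T)
    (hsort : items.Pairwise fun x y => y.time ≤ x.time) (b : Bool) (i : ℕ) :
    (vertexAt q T items b i).Good q T where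
  sorted := (hsort.filter _).filter _
  bound y hy := roundingBound_of_mem htotal (List.mem_of_mem_filter hy)
  small x hx := by simpa using List.of_mem_filter (List.mem_of_mem_filter hx)
  homeLarge y hy := (by simpa using List.of_mem_filter hy : y.2.home = some i)
  homeSmall x hx := (by simpa using List.of_mem_filter hx : x.home = some i)

theorem good_of_mem_allVertices {m : ℕ} (htotal : (items.map Item.time).sum ≤ m * T)
    (hsort : items.Pairwise fun x y => y.time ≤ x.time) {v : Vertex}
    (hv : v ∈ allVertices q T items M removed) : v.Good q T := by
  rcases List.mem_append.1 hv with hv | hv <;> obtain ⟨i, -, rfl⟩ := List.mem_map.1 hv <;>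
    exact vertexAt_good htotal hsort _ i

theorem filter_present_allVertices :
    (allVertices q T items M removed).filter Vertex.present = M.map (vertexAt q T items true) := by
  rw [allVertices, List.filter_append, List.filter_eq_self.2, List.filter_eq_nil_iff.2,
    List.append_nil]
  · intro v hv
    obtain ⟨i, -, rfl⟩ := List.mem_map.1 hv
    simp [vertexAt]
  · intro v hv
    obtain ⟨i, -, rfl⟩ := List.mem_map.1 hv
    rfl

/-- In a list of pairs of vertices and columns, the machines of the new instance are paired with
configurations, and the removed ones with padding columns. -/
def Proper (N : List (Vertex × Option Config)) : Prop :=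
  ∀ p ∈ N, p.2.isSome = p.1.present

theorem sum_eq_of_filter {α : Type} (l : List α) (p : α → Bool) (f : α → ℕ) :
    (l.map fun a => if p a then f a else 0).sum = ((l.filter p).map f).sum := by
  induction l with
  | nil => rfl
  | cons a l ih => by_cases h : p a <;> simp [h, ih]

/-- In a proper perfect matching, the edges cost the number of large items plus the number of small
items on machines of the new instance, minus the number of items kept in place. -/
theorem Proper.cost_add_kept {N : List (Vertex × Option Config)} (hN : Proper N)
    (h1 : (N.map Prod.fst).Perm (allVertices q T items M removed))
    (h2 : (N.map Prod.snd).Perm (columns removed C)) (hgood : ∀ v ∈ allVertices q T items M removed,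
      v.Good q T) (hC : ∀ D ∈ C, D.sum ≤ q * q) :
    (N.map fun p => (edgeCost q T forbidden p.1 p.2).val).sum +
        (N.map fun p => p.2.elim 0 (keptCount q T p.1)).sum =
      (C.map List.length).sum + (M.map fun i => (vertexAt q T items true i).small.length).sum := by
  have e1 : (C.map List.length).sum = (N.map fun p => p.2.elim 0 List.length).sum := by
    have := (h2.map fun u => u.elim 0 List.length).sum_eq
    rw [List.map_map] at this
    simp only [Function.comp_def] at this
    rw [this, columns, List.map_append, List.sum_append, List.map_map, List.map_map]
    simp [Function.comp_def]
  have e2 : (M.map fun i => (vertexAt q T items true i).small.length).sum =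
      (N.map fun p => if p.1.present then p.1.small.length else 0).sum := by
    have := (h1.map fun v => if v.present then v.small.length else 0).sum_eq
    rw [List.map_map] at this
    simp only [Function.comp_def] at this
    rw [this, sum_eq_of_filter, filter_present_allVertices, List.map_map]
    rfl
  rw [e1, e2, ← List.sum_map_add, ← List.sum_map_add]
  congr 1
  refine List.map_congr_left fun p hp => ?_
  have h3 := hN p hp
  have h4 := hgood p.1 (h1.subset (List.mem_map_of_mem hp))
  have h5 := h2.subset (List.mem_map_of_mem hp)
  obtain ⟨v, u⟩ := p
  cases u with
  | none =>
    have : v.present = false := by simpa using h3.symm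
    simp [this]
  | some D =>
    have h6 : v.present = true := by simpa using h3.symm
    have h7 : D ∈ C := by simpa [columns] using h5
    simpa [h6] using edgeCost_add_keptCount h4 h6 (hC D h7)

/-- The matching that pairs machines of the new instance with configurations in the given way. -/
def matchingOf (q T : ℕ) (items : List Item) (removed : List ℕ) (N : List (ℕ × Config)) :
    List (Vertex × Option Config) :=
  (N.map fun p => (vertexAt q T items true p.1, some p.2)) ++
    removed.map fun i => (vertexAt q T items false i, none)

theorem matchingOf_proper (N : List (ℕ × Config)) : Proper (matchingOf q T items removed N) := by
  intro p hp
  rcases List.mem_append.1 hp with hp | hp <;> obtain ⟨i, -, rfl⟩ := List.mem_map.1 hp <;> rfl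

theorem matchingOf_fst {N : List (ℕ × Config)} (h : (N.map Prod.fst).Perm M) :
    ((matchingOf q T items removed N).map Prod.fst).Perm (allVertices q T items M removed) := by
  rw [matchingOf, allVertices, List.map_append, List.map_map, List.map_map]
  refine List.Perm.append (List.Perm.trans (List.Perm.of_eq ?_) (h.map _)) (List.Perm.of_eq rfl)
  rw [List.map_map]
  rfl

theorem matchingOf_snd {N : List (ℕ × Config)} (h : (N.map Prod.snd).Perm C) :
    ((matchingOf q T items removed N).map Prod.snd).Perm (columns removed C) := by
  rw [matchingOf, columns, List.map_append, List.map_map, List.map_map]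
  refine List.Perm.append (List.Perm.trans (List.Perm.of_eq ?_) (h.map some)) (List.Perm.of_eq rfl)
  rw [List.map_map]
  rfl

theorem sum_small_le (hM : M.Nodup) :
    (M.map fun i => (vertexAt q T items true i).small.length).sum ≤
      (smallItems q T items).length := by
  induction M generalizing items with
  | nil => simp
  | cons i M ih =>
    rw [List.nodup_cons] at hM
    have h1 := ih (items := items.filter fun x => ¬ x.home = some i) hM.2
    have h2 : ∀ j ∈ M, (vertexAt q T (items.filter fun x => ¬ x.home = some i) true j).small =
        (vertexAt q T items true j).small := by
      intro j hj
      have hne : j ≠ i := fun e => hM.1 (e ▸ hj)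
      simp only [vertexAt, smallItems, List.filter_filter]
      refine List.filter_congr fun x _ => ?_
      by_cases e : x.home = some j <;> simp [e, hne]
    rw [List.map_congr_left fun j hj => by rw [h2 j hj]] at h1
    rw [List.map_cons, List.sum_cons]
    have h3 := (List.filter_append_perm (fun x : Item => decide (x.home = some i))
      (smallItems q T items)).length_eq
    rw [List.length_append] at h3
    have h4 : (smallItems q T (items.filter fun x => ¬ x.home = some i)).length =
        ((smallItems q T items).filter fun x => !decide (x.home = some i)).length := by
      simp only [smallItems, List.filter_filter]
      congr 1
      refine List.filter_congr fun x _ => ?_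
      rw [Bool.and_comm, decide_not]
    change ((smallItems q T items).filter fun x => decide (x.home = some i)).length + _ ≤ _
    omega

theorem large_add_small_length (q T : ℕ) (items : List Item) :
    (largePairs q T items).length + (smallItems q T items).length = items.length := by
  have := (large_append_small q T items).length_eq
  rwa [List.length_append, ← largePairs_snd, List.length_map] at this

theorem countP_eq_imp {α : Type} {l : List α} {p r : α → Bool} (h : ∀ a ∈ l, p a → r a)
    (hc : l.countP p = l.countP r) : ∀ a ∈ l, p a = r a := by
  induction l with
  | nil => simp
  | cons a l ih =>
    have h1 : l.countP p ≤ l.countP r :=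
      List.countP_mono_left fun b hb => h b (List.mem_cons_of_mem _ hb)
    have h2 := h a List.mem_cons_self
    rw [List.countP_cons, List.countP_cons] at hc
    rw [List.forall_mem_cons]
    have h3 : p a = r a := by
      cases hp : p a <;> cases hr : r a <;> simp_all
    refine ⟨h3, ih (fun b hb => h b (List.mem_cons_of_mem _ hb)) ?_⟩
    rw [h3] at hc
    omega

theorem edgeCost_le {m : ℕ} (htotal : (items.map Item.time).sum ≤ m * T)
    (hsort : items.Pairwise fun x y => y.time ≤ x.time)
    (hC : ∀ D ∈ C, D.sum ≤ q * q) (hperm : C.flatten.Perm ((largePairs q T items).map Prod.fst))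
    {v : Vertex} (hv : v ∈ allVertices q T items M removed) {u : Option Config}
    (hu : u ∈ columns removed C) :
    (edgeCost q T (items.length + 1) v u).val ≤ items.length + 1 := by
  cases u with
  | none => simp
  | some D =>
    cases hp : v.present with
    | false => simp [edgeCost_some, hp]
    | true =>
      have hD : D ∈ C := by simpa [columns] using hu
      have h1 := edgeCost_add_keptCount (forbidden := items.length + 1)
        (good_of_mem_allVertices htotal hsort hv) hp (hC D hD)
      have h2 : D.length ≤ (largePairs q T items).length := by
        have := (List.sublist_flatten_of_mem hD).length_le
        rwa [hperm.length_eq, List.length_map] at this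
      have h3 : v.small.length ≤ (smallItems q T items).length := by
        rcases List.mem_append.1 hv with hv | hv <;> obtain ⟨i, -, rfl⟩ := List.mem_map.1 hv <;>
          exact List.length_filter_le _ _
      have h4 := large_add_small_length q T items
      omega

/-- A minimum cost perfect matching uses no forbidden edges, as some matching costs at most the
number of items. -/
theorem proper_of_cost_le {N : List (Vertex × Option Config)}
    (h1 : (N.map Prod.fst).Perm (allVertices q T items M removed))
    (h2 : (N.map Prod.snd).Perm (columns removed C)) (hlen : C.length = M.length)
    (hcost : (N.map fun p => (edgeCost q T (items.length + 1) p.1 p.2).val).sum ≤ items.length) :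
    Proper N := by
  refine countP_eq_imp (fun p hp hs => ?_) ?_
  · by_contra hpr
    have h3 := List.single_le_sum
      (l := N.map fun p => (edgeCost q T (items.length + 1) p.1 p.2).val) (by simp) _
      (List.mem_map_of_mem hp)
    obtain ⟨D, hD⟩ := Option.isSome_iff_exists.1 hs
    simp only [hD, edgeCost_some, hpr] at h3
    simp only [if_false] at h3
    omega
  · have h3 := h2.countP_eq Option.isSome
    have h4 := h1.countP_eq Vertex.present
    rw [List.countP_map] at h3 h4
    have h5 : (columns removed C).countP Option.isSome = C.length := by
      rw [columns, List.countP_append, List.countP_map, List.countP_map]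
      simp [Function.comp_def]
    have h6 : (allVertices q T items M removed).countP Vertex.present = M.length := by
      rw [List.countP_eq_length_filter, filter_present_allVertices, List.length_map]
    simp only [Function.comp_def] at h3 h4
    rw [h3, h4, h5, h6, hlen]

/-! ### The solution for one configuration -/

/-- Splitting a list by the values of `f`, with a separate part for the value `none`. -/
theorem sum_filter_home {α : Type} (L : List α) (f : α → Option ℕ) {l : List ℕ} (hl : l.Nodup)
    (hf : ∀ x ∈ L, ∀ i, f x = some i → i ∈ l) :
    ((L.filter fun x => f x = none : List α) : Multiset α) +
      (l.map fun i => ((L.filter fun x => f x = some i : List α) : Multiset α)).sum = L := by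
  have h1 := flatMap_filter_perm hl (L := L.filter fun x => ¬ f x = none) (f := f) (fun x hx => by
    rw [List.mem_filter] at hx
    obtain ⟨i, hi⟩ := Option.ne_none_iff_exists'.1 (by simpa using hx.2)
    exact ⟨i, hf x hx.1 i hi, hi⟩)
  have h2 : (l.map fun i => ((L.filter fun x => f x = some i : List α) : Multiset α)).sum =
      ((l.flatMap fun i => L.filter fun x => f x = some i : List α) : Multiset α) := by
    clear h1 hf hl
    induction l with
    | nil => rfl
    | cons i l ih =>
      rw [List.map_cons, List.sum_cons, List.flatMap_cons, ← Multiset.coe_add, ih]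
  have h3 : (l.flatMap fun i => L.filter fun x => f x = some i) =
      l.flatMap fun i => (L.filter fun x => ¬ f x = none).filter fun x => f x = some i := by
    rw [List.flatMap_def, List.flatMap_def]
    congr 1
    refine List.map_congr_left fun i _ => ?_
    rw [List.filter_filter]
    refine List.filter_congr fun x _ => ?_
    by_cases e : f x = some i <;> simp [e]
  rw [h2, h3, Multiset.coe_eq_coe.2 h1, Multiset.coe_add, Multiset.coe_eq_coe]
  refine List.Perm.trans (List.Perm.of_eq ?_)
    (List.filter_append_perm (fun x => decide (f x = none)) L)
  congr 1
  exact List.filter_congr fun x _ => by rw [decide_not]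

theorem sum_vertices {β : Type} [AddCommMonoid β] (g : Vertex → β)
    (hg : ∀ i, g (vertexAt q T items true i) = g (vertexAt q T items false i)) :
    ((allVertices q T items M removed).map g).sum =
      ((M ++ removed).map fun i => g (vertexAt q T items true i)).sum := by
  rw [allVertices, List.map_append, List.map_append, List.map_map, List.map_map]
  simp [Function.comp_def, hg]

theorem sum_large_vertices (hMR : (M ++ removed).Nodup)
    (hhome : ∀ x ∈ items, ∀ i, x.home = some i → i ∈ M ++ removed) :
    (((largePairs q T items).filter fun y => y.2.home = none : List (ℕ × Item)) :
        Multiset (ℕ × Item)) +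
      ((allVertices q T items M removed).map fun v => (v.large : Multiset (ℕ × Item))).sum =
        largePairs q T items := by
  rw [sum_vertices _ fun i => rfl]
  refine sum_filter_home (largePairs q T items) (fun y => y.2.home) hMR fun y hy i hi => ?_
  obtain ⟨x, hx, rfl⟩ := List.mem_map.1 hy
  exact hhome x (List.mem_of_mem_filter hx) i hi

theorem sum_small_vertices (hMR : (M ++ removed).Nodup)
    (hhome : ∀ x ∈ items, ∀ i, x.home = some i → i ∈ M ++ removed) :
    (((smallItems q T items).filter fun x => x.home = none : List Item) : Multiset Item) +
      ((allVertices q T items M removed).map fun v => (v.small : Multiset Item)).sum =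
        smallItems q T items := by
  rw [sum_vertices _ fun i => rfl]
  exact sum_filter_home (smallItems q T items) (fun x => x.home) hMR fun x hx i hi =>
    hhome x (List.mem_of_mem_filter hx) i hi

theorem map_sum_coe {α β γ : Type} (f : α → β) (l : List γ) (g : γ → List α) :
    ((l.map fun c => (g c : Multiset α)).sum).map f =
      (l.map fun c => (((g c).map f : List β) : Multiset β)).sum := by
  induction l with
  | nil => rfl
  | cons c l ih => simp [ih]

/-- The data of the bipartite graph computed by the algorithm. -/
def setupOf (q T : ℕ) (items : List Item) (M removed : List ℕ) : Setup :=
  ⟨allVertices q T items M removed, removed.map fun _ => none,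
    (largePairs q T items).filter fun y => y.2.home = none,
    (smallItems q T items).filter fun x => x.home = none⟩

/-- The matching computed for a configuration. -/
def matchingFor (q T : ℕ) (items : List Item) (M removed : List ℕ) (C : List Config) :
    List (Vertex × Option Config) :=
  (minCostMatching (edgeCost q T (items.length + 1)) (items.length + 1)
    (allVertices q T items M removed) (columns removed C)).val

/-- The items placed and the items left after the matching for a configuration. -/
def placementFor (q T : ℕ) (items : List Item) (M removed : List ℕ) (C : List Config) : Partial :=
  (placeKept q T ((largePairs q T items).filter fun y => y.2.home = none)
    ((smallItems q T items).filter fun x => x.home = none)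
    (matchingFor q T items M removed C)).val

/-- After the matching for a configuration, every machine of the new instance has a bin with vacant
places for exactly the large items left, and at least as many items are in place as for any way of
assigning the bins of the configuration to machines. -/
theorem placementFor_spec
    (htotal : (items.map Item.time).sum ≤ M.length * T)
    (hsort : items.Pairwise fun x y => y.time ≤ x.time) (hMR : (M ++ removed).Nodup)
    (hhome : ∀ x ∈ items, ∀ i, x.home = some i → i ∈ M ++ removed)
    (hC : C ∈ (configurations q M.length ((largePairs q T items).map Prod.fst)).val) :
    ((placementFor q T items M removed C).bins.map Bin.machine).Perm M ∧
      allItems (placementFor q T items M removed C).bins +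
          ((placementFor q T items M removed C).large.map Prod.snd : List Item) +
          ((placementFor q T items M removed C).small : Multiset Item) = (items : Multiset Item) ∧
      (((placementFor q T items M removed C).large.map Prod.fst : List ℕ) : Multiset ℕ) =
        allVacant (placementFor q T items M removed C).bins ∧
      (∀ B ∈ (placementFor q T items M removed C).bins, B.Fits q T) ∧
      (∀ y ∈ (placementFor q T items M removed C).large, RoundingBound q T y) ∧
      (∀ x ∈ (placementFor q T items M removed C).small, x.time * q ≤ T) ∧
      ∀ N : List (ℕ × Config), (N.map Prod.fst).Perm M → (N.map Prod.snd).Perm C →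
        (N.map fun p => keptCount q T (vertexAt q T items true p.1) p.2).sum ≤
          homeTotal (placementFor q T items M removed C).bins := by
  obtain ⟨hlen, hcap, hperm⟩ := mem_configurations_sound hC
  have hCs : ∀ D ∈ C, D.sum ≤ q * q := fun D hD => (hcap D hD).2
  have hgood : ∀ v ∈ allVertices q T items M removed, v.Good q T :=
    fun v hv => good_of_mem_allVertices htotal hsort hv
  obtain ⟨m1, m2, m3⟩ := minCostMatching_spec (cost := edgeCost q T (items.length + 1))
    (maxCost := items.length + 1) (rows := allVertices q T items M removed)
    (cols := columns removed C) (by simp [allVertices, columns, hlen])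
    (fun v hv u hu => edgeCost_le htotal hsort hCs hperm hv hu)
  change ((matchingFor q T items M removed C).map _).Perm _ at m1
  change (matchingFor q T items M removed C).map _ = _ at m2
  change ∀ _, _ → _ → ((matchingFor q T items M removed C).map _).sum ≤ _ at m3
  unfold placementFor
  generalize matchingFor q T items M removed C = N at *
  have m2' := List.Perm.of_eq m2
  have hsizes : (C.map List.length).sum = (largePairs q T items).length := by
    rw [← List.length_flatten, hperm.length_eq, List.length_map]
  have hother : ∀ N' : List (ℕ × Config), (N'.map Prod.fst).Perm M → (N'.map Prod.snd).Perm C →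
      (N.map fun p => (edgeCost q T (items.length + 1) p.1 p.2).val).sum +
        ((matchingOf q T items removed N').map fun p => p.2.elim 0 (keptCount q T p.1)).sum ≤
      (C.map List.length).sum +
        (M.map fun i => (vertexAt q T items true i).small.length).sum := by
    intro N' h1 h2
    have h3 := m3 _ (matchingOf_fst (q := q) (T := T) (items := items) (removed := removed) h1)
      (matchingOf_snd h2)
    have h4 := (matchingOf_proper (q := q) (T := T) (items := items) (removed := removed)
      N').cost_add_kept (forbidden := items.length + 1) (matchingOf_fst h1) (matchingOf_snd h2)
      hgood hCs
    omega
  have hproper : Proper N := by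
    refine proper_of_cost_le m1 m2' hlen ?_
    have h1 := hother (M.zip C) (List.Perm.of_eq (List.map_fst_zip hlen.ge))
      (List.Perm.of_eq (List.map_snd_zip hlen.le))
    have h2 := sum_small_le (q := q) (T := T) (items := items) (List.nodup_append.1 hMR).1
    have h3 := large_add_small_length q T items
    omega
  have hnmem : ∀ p ∈ N, p.1 ∈ allVertices q T items M removed :=
    fun p hp => m1.subset (List.mem_map_of_mem hp)
  have hn2 : ∀ p ∈ N, ∀ D, p.2 = some D → D.sum ≤ q * q := by
    intro p hp D hD
    have := m2'.subset (List.mem_map_of_mem hp)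
    exact hCs D (by simpa [columns, hD] using this)
  obtain ⟨g1, g2, ⟨Z, g3, g4⟩, g5, g6, g7, g8⟩ := placeKept_spec (q := q) (T := T)
    (large := (largePairs q T items).filter fun y => y.2.home = none)
    (small := (smallItems q T items).filter fun x => x.home = none)
    (fun p hp => hgood _ (hnmem p hp)) hn2
    (fun y hy => roundingBound_of_mem htotal (List.mem_of_mem_filter hy))
    (fun x hx => by simpa using List.of_mem_filter (List.mem_of_mem_filter hx))
  set P := (placeKept q T ((largePairs q T items).filter fun y => y.2.home = none)
    ((smallItems q T items).filter fun x => x.home = none) N).val with hP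
  have hmach : (P.bins.map Bin.machine).Perm M := by
    have h1 : N.filterMap (fun p => p.2.map fun _ => p.1.machine) =
        ((N.map Prod.fst).filter Vertex.present).map Vertex.machine := by
      clear * - hproper
      induction N with
      | nil => rfl
      | cons p N ih =>
        have h1 := hproper p List.mem_cons_self
        have h2 := ih fun p hp => hproper p (List.mem_cons_of_mem _ hp)
        cases hp : p.2 <;> simp [hp] at h1 <;> simp [hp, ← h1, h2]
    rw [g1, h1]
    refine ((m1.filter _).map _).trans (List.Perm.of_eq ?_)
    rw [filter_present_allVertices, List.map_map]
    simp [Function.comp_def, vertexAt]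
  have hlarge := sum_large_vertices (q := q) (T := T) hMR hhome
  have hsmall := sum_small_vertices (q := q) (T := T) hMR hhome
  have hall : allItems P.bins + (P.large.map Prod.snd : List Item) + (P.small : Multiset Item) =
      (items : Multiset Item) := by
    have e1 : (N.map fun p => ((p.1.large.map Prod.snd : List Item) : Multiset Item) +
          (p.1.small : Multiset Item)).sum =
        ((allVertices q T items M removed).map fun v =>
          ((v.large.map Prod.snd : List Item) : Multiset Item)).sum +
        ((allVertices q T items M removed).map fun v => (v.small : Multiset Item)).sum := by
      rw [← List.sum_map_add, ← (m1.map _).sum_eq, List.map_map]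
      rfl
    have e2 := congrArg (Multiset.map Prod.snd) hlarge
    rw [Multiset.map_add, map_sum_coe, Multiset.map_coe, Multiset.map_coe, largePairs_snd] at e2
    rw [g2, e1, ← Multiset.coe_eq_coe.2 (large_append_small q T items), ← Multiset.coe_add, ← e2,
      ← hsmall]
    abel
  have hvac : ((P.large.map Prod.fst : List ℕ) : Multiset ℕ) = allVacant P.bins := by
    have e1 : (N.map fun p => ((p.1.large.map Prod.fst : List ℕ) : Multiset ℕ)).sum =
        ((allVertices q T items M removed).map fun v =>
          ((v.large.map Prod.fst : List ℕ) : Multiset ℕ)).sum := by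
      rw [← (m1.map _).sum_eq, List.map_map]
      rfl
    have e2 := congrArg (Multiset.map Prod.fst) hlarge
    rw [Multiset.map_add, map_sum_coe, Multiset.map_coe, Multiset.map_coe] at e2
    have e3 : (N.map fun p => p.2.elim 0 fun C => (C : Multiset ℕ)).sum =
        (C.flatten : Multiset ℕ) := by
      have h1 := (m2'.map fun u => u.elim 0 fun C => (C : Multiset ℕ)).sum_eq
      rw [List.map_map] at h1
      refine h1.trans ?_
      rw [columns, List.map_append, List.sum_append, List.map_map, List.map_map]
      clear * -
      induction C with
      | nil => simp [Function.comp_def]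
      | cons D C ih =>
        rw [List.map_cons, List.sum_cons, List.flatten_cons, ← Multiset.coe_add, ← ih, add_assoc]
        rfl
    rw [e1, e2] at g3
    rw [e3, Multiset.coe_eq_coe.2 hperm, ← g3] at g4
    exact (add_left_cancel g4).symm
  refine ⟨hmach, hall, hvac, g5, g6, g7, fun N' h1 h2 => ?_⟩
  have h3 := hother N' h1 h2
  have h4 := hproper.cost_add_kept (forbidden := items.length + 1) m1 m2' hgood hCs
  have h5 : ((matchingOf q T items removed N').map fun p => p.2.elim 0 (keptCount q T p.1)).sum =
      (N'.map fun p => keptCount q T (vertexAt q T items true p.1) p.2).sum := by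
    rw [matchingOf, List.map_append, List.sum_append, List.map_map, List.map_map]
    simp [Function.comp_def]
  rw [← h5]
  exact (by omega : _ ≤ _).trans g8

theorem solutionFor_val : (solutionFor q T (items.length + 1) (setupOf q T items M removed) C).val =
    (scheduleOf (firstFit q T (placementFor q T items M removed C).small
      (fillBins (placementFor q T items M removed C).bins
        (placementFor q T items M removed C).large).val).val).val := by
  simp only [solutionFor, setupOf, val_bind, mapT_val, appendT_val, val_pure]
  rfl

/-- The solution for a configuration is a schedule of all items on the machines of the new instance
in which every load is at most `(1 + 1/q) T`, and it leaves at least as many items in place as any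
way of assigning the bins of the configuration to machines. -/
theorem solutionFor_spec (hq : 0 < q) (hne : M ≠ [])
    (htotal : (items.map Item.time).sum ≤ M.length * T)
    (hsort : items.Pairwise fun x y => y.time ≤ x.time) (hMR : (M ++ removed).Nodup)
    (hhome : ∀ x ∈ items, ∀ i, x.home = some i → i ∈ M ++ removed)
    (hC : C ∈ (configurations q M.length ((largePairs q T items).map Prod.fst)).val) :
    ∃ F : List Bin, (solutionFor q T (items.length + 1) (setupOf q T items M removed) C).val =
        (scheduleOf F).val ∧ (F.map Bin.machine).Perm M ∧ allItems F = (items : Multiset Item) ∧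
      (∀ B ∈ F, B.Fine q T) ∧
      ∀ N : List (ℕ × Config), (N.map Prod.fst).Perm M → (N.map Prod.snd).Perm C →
        (N.map fun p => keptCount q T (vertexAt q T items true p.1) p.2).sum ≤ homeTotal F := by
  obtain ⟨hmach, hall, hvac, g5, g6, g7, g8⟩ := placementFor_spec htotal hsort hMR hhome hC
  generalize hP : placementFor q T items M removed C = P at *
  have hPlen : P.bins.length = M.length := by simpa using hmach.length_eq
  obtain ⟨f1, f2, f3, f4⟩ := firstFit_fillBins_spec hq (T := T) (bins := P.bins) (pool := P.large)
    (S := P.small) (fun e => by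
      rw [e, List.length_nil] at hPlen
      exact hne (List.length_eq_zero_iff.1 hPlen.symm)) hvac g6 g5 g7 (by
      rw [hall, hPlen]
      simpa using htotal)
  refine ⟨_, ?_, (List.Perm.of_eq f1).trans hmach, f2.trans hall, f3,
    fun N' h1 h2 => (g8 N' h1 h2).trans f4⟩
  rw [solutionFor_val, hP]

end

section

/-! ### Transition costs -/

/-- The transition cost of a schedule is the number of its items that are not in place. -/
theorem scheduleCost_add_homeTotal (F : List Bin) :
    (scheduleCost (scheduleOf F).val).val + homeTotal F = Multiset.card (allItems F) := by
  have h1 : ∀ s : List (Item × ℕ), (scheduleCost s).val =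
      s.countP fun x => ¬ x.1.home = some x.2 := by
    intro s
    rw [scheduleCost, sumT_val]
    induction s with
    | nil => rfl
    | cons x s ih =>
      rw [List.map_cons, List.sum_cons, ih, List.countP_cons]
      by_cases h : x.1.home = some x.2 <;> simp [isHome_val, h, add_comm]
  rw [h1, scheduleOf_val]
  induction F with
  | nil => rfl
  | cons B F ih =>
    rw [List.flatMap_cons, List.countP_append, allItems_cons, Multiset.card_add, homeTotal_cons,
      ← ih, List.countP_map, Multiset.coe_card, Bin.homeCount]
    have := List.length_eq_countP_add_countP (fun x : Item => decide (x.home = some B.machine))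
      (l := B.items)
    simp only [Function.comp_def]
    simp only [decide_eq_true_eq, decide_not] at this ⊢
    omega

variable {R : Input} {σ : List (ℕ × ℕ)} {items : List Item}

/-- The transition cost counts the items that are not on their initial machine. -/
theorem transitionCost_add_countP (hR : R.Valid) (hσ : IsAssignment R.new σ)
    (hitems : items.Perm (R.new.jobs.map (mkItem R.σ₀))) :
    transitionCost R σ + items.countP (fun x => x.home = σ.lookup x.id) = items.length := by
  rw [hitems.countP_eq, hitems.length_eq, transitionCost]
  have h : ∀ j ∈ R.new.jobs, jobCost R σ j.id =
      if (mkItem R.σ₀ j).home = σ.lookup j.id then 0 else 1 := by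
    intro j hj
    obtain ⟨i, -, hi⟩ := hσ.exists_lookup (σ₀ := R.σ₀) (List.Perm.refl _) (List.mem_map_of_mem hj)
    change σ.lookup j.id = some i at hi
    change _ = if R.σ₀.lookup j.id = σ.lookup j.id then 0 else 1
    by_cases e : R.σ₀.lookup j.id = σ.lookup j.id
    · have h1 := mem_of_lookup_eq_some (e.trans hi)
      have h2 : j.id ∈ R.old.jobs.map Job.id :=
        hR.2.2.2.1.subset (List.mem_map_of_mem (f := Prod.fst) h1)
      rw [jobCost, if_neg (by simp [h2, e]), if_pos e]
    · rw [jobCost, if_pos (Or.inr e), if_neg e]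
  rw [List.map_congr_left h, List.countP_map, List.length_map]
  clear h hitems hσ
  induction R.new.jobs with
  | nil => rfl
  | cons j l ih =>
    rw [List.map_cons, List.sum_cons, List.countP_cons, List.length_cons, ← ih]
    by_cases e : (mkItem R.σ₀ j).home = σ.lookup j.id
    · have e' : (mkItem R.σ₀ j).home = σ.lookup (mkItem R.σ₀ j).id := e
      rw [if_pos e, if_pos (by simpa using e')]
      omega
    · have e' : ¬ (mkItem R.σ₀ j).home = σ.lookup (mkItem R.σ₀ j).id := e
      rw [if_neg e, if_neg (by simpa using e')]
      omega

theorem countP_home_assignmentOf {F : List Bin} (hI : R.new.Valid)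
    (hitems : items.Perm (R.new.jobs.map (mkItem R.σ₀)))
    (hall : allItems F = (items : Multiset Item)) :
    items.countP (fun x => x.home = (assignmentOf F).lookup x.id) = homeTotal F := by
  rw [← Multiset.coe_countP, ← hall]
  have h : ∀ B ∈ F, ∀ x ∈ B.items, (assignmentOf F).lookup x.id = some B.machine :=
    fun B hB x hx => lookup_assignmentOf hI hitems hall hB hx
  generalize (assignmentOf F) = τ at h
  clear hall hitems
  induction F with
  | nil => simp
  | cons B F ih =>
    rw [allItems_cons, Multiset.countP_add, ih fun B hB => h B (List.mem_cons_of_mem _ hB),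
      homeTotal_cons, Multiset.coe_countP, Bin.homeCount]
    congr 1
    refine List.countP_congr fun x hx => ?_
    rw [h B List.mem_cons_self x hx]

/-- The number of items kept in place by an assignment on a machine of load at most `T` does not
exceed the number kept by the algorithm for the configuration of this machine. -/
theorem countP_home_le_keptCount {q T : ℕ} {i : ℕ} {D : Config} {f : Item → Option ℕ}
    (hsort : items.Pairwise fun x y => y.time ≤ x.time)
    (hload : ((items.filter fun x => f x = some i).map Item.time).sum ≤ T)
    (hD : D.Perm ((largeItems q T (items.filter fun x => f x = some i)).map (Item.rounded q T)))
    (hcap : D.sum ≤ q * q) :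
    (items.filter fun x => f x = some i).countP (fun x => x.home = some i) ≤
      keptCount q T (vertexAt q T items true i) D := by
  set A := items.filter fun x => f x = some i with hA
  set H := A.filter fun x => x.home = some i with hH
  have hHA : H.Sublist A := List.filter_sublist
  have hHi : H.Sublist (items.filter fun x => x.home = some i) := List.filter_sublist.filter _
  rw [List.countP_eq_length_filter, ← hH, ← (large_append_small q T H).length_eq,
    List.length_append, keptCount]
  refine Nat.add_le_add ?_ ?_
  · rw [← largePairs_snd, List.length_map]
    refine keepLarge_optimal ?_ ?_
    · have : (vertexAt q T items true i).large =
          largePairs q T (items.filter fun x => x.home = some i) := by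
        simp only [vertexAt, largePairs, largeItems, List.filter_map, List.filter_filter]
        congr 1
        refine List.filter_congr fun x _ => ?_
        simp [Bool.and_comm]
      rw [this]
      exact ((hHi.filter _).map _).subperm
    · rw [largePairs_fst]
      exact (((hHA.filter _).map _).subperm).trans hD.symm.subperm
  · obtain ⟨-, -, h⟩ := keepSmall_spec (T := T) (S := (vertexAt q T items true i).small)
      ((hsort.filter _).filter _) hcap
    refine h (smallItems q T H) ?_ ?_
    · have : (vertexAt q T items true i).small =
          smallItems q T (items.filter fun x => x.home = some i) := by
        simp only [vertexAt, smallItems, List.filter_filter]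
        refine List.filter_congr fun x _ => ?_
        simp [Bool.and_comm]
      rw [this]
      exact hHi.filter _
    · refine le_trans ?_ (rounded_add_small_le (q := q) hload)
      rw [hD.sum_eq]
      exact Nat.add_le_add_right (Nat.mul_le_mul_left _
        (((hHA.filter _).map _).sum_le_sum (by simp))) _

theorem countP_eq_sum_filter {M : List ℕ} (hM : M.Nodup) {f : Item → Option ℕ}
    (hf : ∀ x ∈ items, ∃ i ∈ M, f x = some i) :
    items.countP (fun x => x.home = f x) =
      (M.map fun i => (items.filter fun x => f x = some i).countP
        fun x => x.home = some i).sum := by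
  rw [← (flatMap_filter_perm hM hf).countP_eq, List.countP_flatMap]
  congr 1
  refine List.map_congr_left fun i _ => ?_
  refine List.countP_congr fun x hx => ?_
  rw [List.mem_filter] at hx
  simp only [decide_eq_true_eq] at hx ⊢
  rw [hx.2]

theorem bestSolution_spec {q T forbidden : ℕ} {D : Setup} {L : List (List Config)} (hL : L ≠ []) :
    ∃ C ∈ L, (bestSolution q T forbidden D L).val =
        some ((scheduleCost (solutionFor q T forbidden D C).val).val,
          (solutionFor q T forbidden D C).val) ∧
      ∀ C' ∈ L, (scheduleCost (solutionFor q T forbidden D C).val).val ≤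
        (scheduleCost (solutionFor q T forbidden D C').val).val := by
  induction L with
  | nil => exact absurd rfl hL
  | cons C L ih =>
    by_cases hne : L = []
    · subst hne
      exact ⟨C, by simp, by simp [bestSolution], by simp⟩
    · obtain ⟨E, hE, h1, h2⟩ := ih hne
      by_cases hle : (scheduleCost (solutionFor q T forbidden D C).val).val ≤
          (scheduleCost (solutionFor q T forbidden D E).val).val
      · refine ⟨C, by simp, by simp [bestSolution, h1, hle], fun C' hC' => ?_⟩
        rcases List.mem_cons.1 hC' with rfl | hC'
        · exact le_rfl
        · exact hle.trans (h2 C' hC')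
      · refine ⟨E, by simp [hE], by simp [bestSolution, h1, hle], fun C' hC' => ?_⟩
        rcases List.mem_cons.1 hC' with rfl | hC'
        · omega
        · exact h2 C' hC'

/-! ### The approximation guarantee -/

/-- The sorted items of an input. -/
def inputItems (R : Input) : List Item := (sortItems (R.new.jobs.map (mkItem R.σ₀))).val

/-- The machines that were removed. -/
def removedMachines (R : Input) : List ℕ :=
  R.old.machines.filter fun i => i ∉ R.new.machines

/-- The makespan bound used by the algorithm. -/
def makespanBound (q : ℕ) (R : Input) : ℕ :=
  (approxMakespan q R.new.machines.length (inputItems R)).val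

theorem inputItems_perm (R : Input) : (inputItems R).Perm (R.new.jobs.map (mkItem R.σ₀)) :=
  sortItems_perm _

theorem filter_removed (R : Input) :
    (R.old.machines.filter fun i => (if (memT i R.new.machines).val = true then
      (pure false : Timed Bool) else pure true).val) = removedMachines R := by
  refine List.filter_congr fun i _ => ?_
  by_cases h : i ∈ R.new.machines <;> simp [h]

theorem algorithmWith_val (q : ℕ) (R : Input) :
    (algorithmWith q R).val =
      match (bestSolution q (makespanBound q R) ((inputItems R).length + 1)
        (setupOf q (makespanBound q R) (inputItems R) R.new.machines (removedMachines R))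
        (configurations q R.new.machines.length
          ((largePairs q (makespanBound q R) (inputItems R)).map Prod.fst)).val).val with
      | none => []
      | some (_, s) => s.map fun x : Item × ℕ => (x.1.id, x.2) := by
  have h1 : ∀ (x : Option (ℕ × List (Item × ℕ))), (match x with
      | none => (pure [] : Timed (List (ℕ × ℕ)))
      | some (_, s) => mapT (fun x : Item × ℕ => do tick 1; pure (x.1.id, x.2)) s).val =
      match x with
      | none => []
      | some (_, s) => s.map fun x : Item × ℕ => (x.1.id, x.2) := by
    rintro (_ | ⟨_, s⟩) <;> simp
  rw [← h1]
  simp only [algorithmWith, val_bind, makeItems_val, lengthT_val, splitItems_eq, mapT_val,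
    makeVertices_val, appendT_val, filter_removed, sizesOf_val, val_addN, filterT_val,
    isNew_val, val_pure]
  rfl

theorem home_mem (hR : R.Valid) {x : Item} (hx : x ∈ inputItems R) {i : ℕ}
    (hi : x.home = some i) : i ∈ R.new.machines ++ removedMachines R := by
  obtain ⟨j, -, rfl⟩ := List.mem_map.1 ((inputItems_perm R).subset hx)
  have h1 : i ∈ R.old.machines := hR.2.2.2.2 _ (mem_of_lookup_eq_some hi)
  rw [List.mem_append, removedMachines, List.mem_filter]
  by_cases h : i ∈ R.new.machines <;> simp [h, h1]

theorem machines_nodup (hR : R.Valid) : (R.new.machines ++ removedMachines R).Nodup := by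
  refine List.nodup_append.2 ⟨hR.2.1.1, hR.1.1.filter _, fun a ha b hb e => ?_⟩
  subst e
  rw [removedMachines, List.mem_filter] at hb
  simp [ha] at hb

/-- Some solution leaves as many items in place as a given optimal assignment: the configuration of
the optimal assignment is enumerated, and its own way of assigning the bins to the machines is a
perfect matching. -/
theorem exists_configuration_keeping {q : ℕ} (hq : 0 < q) (hR : R.Valid)
    (hσ : IsAssignment R.new σ) (hopt : makespan R.new σ = optMakespan R.new) :
    ∃ C ∈ (configurations q R.new.machines.length
        ((largePairs q (makespanBound q R) (inputItems R)).map Prod.fst)).val,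
      ∃ N : List (ℕ × Config), (N.map Prod.fst).Perm R.new.machines ∧ (N.map Prod.snd).Perm C ∧
        (inputItems R).countP (fun x => x.home = σ.lookup x.id) ≤
          (N.map fun p => keptCount q (makespanBound q R)
            (vertexAt q (makespanBound q R) (inputItems R) true p.1) p.2).sum := by
  have hitems := inputItems_perm R
  obtain ⟨hT, -, -⟩ := approxMakespan_spec hq hR.2.1 hR.2.2.1 hitems
  change _ ≤ makespanBound q R at hT
  have hM : R.new.machines.Nodup := hR.2.1.1
  have hf : ∀ x ∈ inputItems R, ∃ i ∈ R.new.machines, σ.lookup x.id = some i :=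
    fun _ hx => hσ.exists_lookup hitems hx
  have hload : ∀ i ∈ R.new.machines,
      (((inputItems R).filter fun x => σ.lookup x.id = some i).map Item.time).sum ≤
        makespanBound q R := fun i hi => by
    rw [← load_eq hitems]
    exact (load_le_makespan hi).trans (hopt.trans_le hT)
  obtain ⟨M', D, h1, h2, h3⟩ := exists_configuration_of_loads hq hM hf hload
  refine ⟨_, h3, M'.map fun i => (i, D i), ?_, ?_, ?_⟩
  · rw [List.map_map]
    simpa [Function.comp_def] using h1
  · rw [List.map_map]
    exact List.Perm.of_eq rfl
  · rw [countP_eq_sum_filter hM hf, List.map_map, ← (h1.map _).sum_eq]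
    refine List.sum_le_sum fun i hi => ?_
    have hi' := h1.subset hi
    exact countP_home_le_keptCount (sortItems_sorted _) (hload i hi') (h2 i hi')
      ((mem_configurations_sound h3).2.1 _ (List.mem_map_of_mem hi)).2

/-- The two factors `1 + 1/q` of the makespan come from the makespan bound and from First-Fit. -/
theorem algorithmWith_spec {q : ℕ} (hq : 0 < q) (hR : R.Valid) :
    IsAssignment R.new (algorithmWith q R).val ∧
      q * q * makespan R.new (algorithmWith q R).val ≤ (q + 1) * (q + 1) * optMakespan R.new ∧
      transitionCost R (algorithmWith q R).val ≤ minTransitionCost R := by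
  have hitems := inputItems_perm R
  have hne := hR.2.2.1
  obtain ⟨σ₁, hσ₁, ho₁⟩ := exists_optimal hne
  obtain ⟨hT1, hT2, -⟩ := approxMakespan_spec hq hR.2.1 hne hitems
  change _ ≤ makespanBound q R at hT1
  change q * makespanBound q R ≤ _ at hT2
  have htotal : ((inputItems R).map Item.time).sum ≤ R.new.machines.length * makespanBound q R :=
    (total_le_mul_makespan hR.2.1 hitems hσ₁).trans (Nat.mul_le_mul_left _ (ho₁.trans_le hT1))
  have hsol := fun C hC => solutionFor_spec (C := C) hq hne htotal (sortItems_sorted _)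
    (machines_nodup hR) (fun x hx i hi => home_mem hR hx hi) hC
  obtain ⟨C₁, hC₁, -⟩ := exists_configuration_keeping hq hR hσ₁ ho₁
  obtain ⟨C, hC, hbest, hmin⟩ := bestSolution_spec (q := q) (T := makespanBound q R)
    (forbidden := (inputItems R).length + 1)
    (D := setupOf q (makespanBound q R) (inputItems R) R.new.machines (removedMachines R))
    (List.ne_nil_of_mem hC₁)
  obtain ⟨F, hF, hm, hall, hfine, -⟩ := hsol C hC
  have hval : (algorithmWith q R).val = assignmentOf F := by
    rw [algorithmWith_val, hbest, hF]
    rfl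
  have hass := isAssignment_assignmentOf hitems hm hall
  rw [hval]
  refine ⟨hass, ?_, ?_⟩
  · have h1 := makespan_assignmentOf_le hR.2.1 hitems hm hall
      (b := (q + 1) * makespanBound q R / q) fun B hB => by
        rw [Nat.le_div_iff_mul_le hq, mul_comm]
        exact hfine B hB
    have h2 := (Nat.mul_le_mul_left q h1).trans (Nat.mul_div_le _ q)
    calc q * q * makespan R.new (assignmentOf F)
        = q * (q * makespan R.new (assignmentOf F)) := by ring
      _ ≤ q * ((q + 1) * makespanBound q R) := Nat.mul_le_mul_left _ h2
      _ = (q + 1) * (q * makespanBound q R) := by ring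
      _ ≤ (q + 1) * ((q + 1) * optMakespan R.new) := Nat.mul_le_mul_left _ hT2
      _ = (q + 1) * (q + 1) * optMakespan R.new := by ring
  · obtain ⟨σ, hσ, hopt, hc⟩ : minTransitionCost R ∈ {c | ∃ σ, IsAssignment R.new σ ∧
        makespan R.new σ = optMakespan R.new ∧ transitionCost R σ = c} :=
      Nat.sInf_mem ⟨_, σ₁, hσ₁, ho₁, rfl⟩
    obtain ⟨C₂, hC₂, N, hN1, hN2, hN3⟩ := exists_configuration_keeping hq hR hσ hopt
    obtain ⟨F₂, hF₂, -, hall₂, -, hkeep⟩ := hsol C₂ hC₂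
    have h1 := hkeep N hN1 hN2
    have h2 := hmin C₂ hC₂
    rw [hF, hF₂] at h2
    have h3 := scheduleCost_add_homeTotal F
    have h4 := scheduleCost_add_homeTotal F₂
    rw [hall, Multiset.coe_card] at h3
    rw [hall₂, Multiset.coe_card] at h4
    have h5 := transitionCost_add_countP hR hass hitems
    rw [countP_home_assignmentOf hR.2.1 hitems hall] at h5
    have h6 := transitionCost_add_countP hR hσ hitems
    omega

theorem isReapproximation_algorithm {ε : ℝ} (hε : 0 < ε) :
    IsReapproximation 1 (1 + ε) fun R => (AID ε R).val := by
  intro R hR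
  have hq : 0 < ⌈4 / ε⌉₊ := Nat.ceil_pos.2 (by positivity)
  obtain ⟨h1, h2, h3⟩ := algorithmWith_spec hq hR
  refine ⟨h1, ?_, by rw [one_mul]; exact_mod_cast h3⟩
  have hq4 : 4 ≤ ε * (⌈4 / ε⌉₊ : ℝ) := by
    rw [mul_comm, ← div_le_iff₀ hε]
    exact Nat.le_ceil _
  have hq1 : (1 : ℝ) ≤ (⌈4 / ε⌉₊ : ℝ) := by exact_mod_cast hq
  change ((makespan R.new (algorithmWith ⌈4 / ε⌉₊ R).val : ℕ) : ℝ) ≤ _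
  have h2' : (⌈4 / ε⌉₊ : ℝ) * ⌈4 / ε⌉₊ * (makespan R.new (algorithmWith ⌈4 / ε⌉₊ R).val : ℕ) ≤
      (⌈4 / ε⌉₊ + 1) * (⌈4 / ε⌉₊ + 1) * (optMakespan R.new : ℕ) := by exact_mod_cast h2
  generalize (⌈4 / ε⌉₊ : ℝ) = q at *
  have hopt : (0 : ℝ) ≤ (optMakespan R.new : ℕ) := Nat.cast_nonneg _
  have hqq : 0 < q * q := by positivity
  refine le_of_mul_le_mul_left (h2'.trans ?_) hqq
  rw [← mul_assoc]
  refine mul_le_mul_of_nonneg_right ?_ hopt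
  -- `2 q + 1 ≤ 4 q ≤ ε q²`
  nlinarith [mul_le_mul_of_nonneg_right hq4 (by linarith : (0 : ℝ) ≤ q)]

end

section

/-! ### Sizes of numbers -/

theorem size_add_le (a b : ℕ) : (a + b).size ≤ a.size + b.size := by
  rcases Nat.eq_zero_or_pos a with rfl | ha
  · simp
  rcases Nat.eq_zero_or_pos b with rfl | hb
  · simp
  rw [Nat.size_le, pow_add]
  have h1 := Nat.lt_size_self a
  have h2 := Nat.lt_size_self b
  have h3 := Nat.size_pos.2 ha
  have h4 := Nat.size_pos.2 hb
  have h5 : 2 ≤ 2 ^ a.size := Nat.le_self_pow h3.ne' 2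
  have h6 : 2 ≤ 2 ^ b.size := Nat.le_self_pow h4.ne' 2
  nlinarith

theorem size_mul_le (a b : ℕ) : (a * b).size ≤ a.size + b.size := by
  rw [Nat.size_le, pow_add]
  exact Nat.mul_lt_mul'' (Nat.lt_size_self a) (Nat.lt_size_self b)

theorem size_le_self (a : ℕ) : a.size ≤ a := by
  rw [Nat.size_le]
  exact Nat.lt_two_pow_self

theorem size_le_of_le {a b s : ℕ} (h : a ≤ b) (hb : b.size ≤ s) : a.size ≤ s :=
  (Nat.size_le_size h).trans hb

theorem size_one_le : Nat.size 1 ≤ 1 := by simp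

/-! ### Step counts of the list programs -/

section Lists

variable {α β : Type}

theorem lengthT_time (l : List α) : (lengthT l).time ≤ (l.length + 1) * (l.length + 3) := by
  induction l with
  | nil => simp [lengthT]
  | cons a l ih =>
    simp only [lengthT, time_bind, time_tick, lengthT_val, time_addN, List.length_cons]
    have h1 := size_le_self l.length
    have h2 := size_one_le
    nlinarith

theorem appendT_time (k l : List α) : (appendT k l).time = k.length + 1 := by
  induction k with
  | nil => rfl
  | cons a k ih => simp [appendT, ih]; ring

theorem concatT_time (l : List (List α)) :
    (concatT l).time = (l.map List.length).sum + 2 * l.length + 1 := by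
  induction l with
  | nil => rfl
  | cons k l ih => simp [concatT, ih, appendT_time]; ring

theorem mapT_time {f : α → Timed β} {l : List α} {b : ℕ} (h : ∀ a ∈ l, (f a).time ≤ b) :
    (mapT f l).time ≤ l.length * (b + 1) + 1 := by
  induction l with
  | nil => simp [mapT]
  | cons a l ih =>
    have h1 := ih fun c hc => h c (List.mem_cons_of_mem _ hc)
    have h2 := h a List.mem_cons_self
    simp only [mapT, time_bind, time_tick, time_pure, List.length_cons, Nat.add_mul]
    omega

theorem filterT_time {p : α → Timed Bool} {l : List α} {b : ℕ} (h : ∀ a ∈ l, (p a).time ≤ b) :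
    (filterT p l).time ≤ l.length * (b + 1) + 1 := by
  induction l with
  | nil => simp [filterT]
  | cons a l ih =>
    have h1 := ih fun c hc => h c (List.mem_cons_of_mem _ hc)
    have h2 := h a List.mem_cons_self
    simp only [filterT, time_bind, time_tick, List.length_cons, Nat.add_mul]
    split <;> simp only [time_pure] <;> omega

theorem sumT_time {f : α → Timed ℕ} {l : List α} {b s : ℕ} (h : ∀ a ∈ l, (f a).time ≤ b)
    (hs : (l.map fun a => (f a).val).sum.size ≤ s) :
    (sumT f l).time ≤ l.length * (b + 2 * s + 2) + 1 := by
  induction l with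
  | nil => simp [sumT]
  | cons a l ih =>
    rw [List.map_cons, List.sum_cons] at hs
    have h1 := ih (fun c hc => h c (List.mem_cons_of_mem _ hc))
      (size_le_of_le (Nat.le_add_left _ _) hs)
    have h2 := h a List.mem_cons_self
    have h3 := size_le_of_le (Nat.le_add_right _ _) hs
    have h4 := size_le_of_le (Nat.le_add_left _ _) hs
    simp only [sumT, time_bind, time_tick, time_addN, sumT_val, List.length_cons, Nat.add_mul]
    omega

theorem memT_time {a s : ℕ} {l : List ℕ} (ha : a.size ≤ s) (hl : ∀ b ∈ l, b.size ≤ s) :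
    (memT a l).time ≤ l.length * (2 * s + 2) + 1 := by
  induction l with
  | nil => simp [memT]
  | cons b l ih =>
    have h1 := ih fun c hc => hl c (List.mem_cons_of_mem _ hc)
    have h2 := hl b List.mem_cons_self
    simp only [memT, time_bind, time_tick, time_eqN, List.length_cons, Nat.add_mul]
    split
    · simp only [time_pure]
      omega
    · omega

theorem lookupT_time {a s : ℕ} {l : List (ℕ × ℕ)} (ha : a.size ≤ s)
    (hl : ∀ b ∈ l, b.1.size ≤ s) : (lookupT a l).time ≤ l.length * (2 * s + 2) + 1 := by
  induction l with
  | nil => simp [lookupT]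
  | cons b l ih =>
    have h1 := ih fun c hc => hl c (List.mem_cons_of_mem _ hc)
    have h2 := hl b List.mem_cons_self
    simp only [lookupT, time_bind, time_tick, time_eqN, List.length_cons, Nat.add_mul]
    split
    · simp only [time_pure]
      omega
    · omega

theorem takeFirst_time {p : α → Timed Bool} {l : List α} {b : ℕ} (h : ∀ a ∈ l, (p a).time ≤ b) :
    (takeFirst p l).time ≤ l.length * (b + 1) + 1 := by
  induction l with
  | nil => simp [takeFirst]
  | cons a l ih =>
    have h1 := ih fun c hc => h c (List.mem_cons_of_mem _ hc)
    have h2 := h a List.mem_cons_self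
    simp only [takeFirst, time_bind, time_tick, List.length_cons, Nat.add_mul]
    split
    · simp only [time_pure]; omega
    · simp only [time_bind]
      split <;> simp only [time_pure] <;> omega

theorem sameContent_time {k l : List ℕ} {s n : ℕ} (hk : ∀ a ∈ k, a.size ≤ s)
    (hl : ∀ a ∈ l, a.size ≤ s) (hn : l.length ≤ n) :
    (sameContent k l).time ≤ k.length * (n * (2 * s + 2) + 2) + 1 := by
  induction k generalizing l with
  | nil => cases l <;> simp [sameContent]
  | cons a k ih =>
    have h1 : (takeFirst (eqN a) l).time ≤ n * (2 * s + 2) + 1 := by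
      refine (takeFirst_time (b := 2 * s + 1) fun b hb => ?_).trans ?_
      · have := hk a List.mem_cons_self
        have := hl b hb
        rw [time_eqN]
        omega
      · exact Nat.add_le_add_right (Nat.mul_le_mul_right _ hn) _
    simp only [sameContent, time_bind, time_tick, List.length_cons, Nat.add_mul k.length 1]
    cases hr : (takeFirst (eqN a) l).val with
    | none => simp only [time_pure]; omega
    | some d =>
      obtain ⟨d, k'⟩ := d
      obtain ⟨-, h2⟩ := takeFirst_some hr
      have h3 := h2.length_eq
      rw [List.length_cons] at h3
      have h4 := ih (l := k') (fun b hb => hk b (List.mem_cons_of_mem _ hb))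
        (fun b hb => hl b (h2.symm.subset (List.mem_cons_of_mem _ hb))) (by omega)
      dsimp only
      omega

theorem multisets_length_le (k : ℕ) (l : List α) :
    (multisets k l).val.length ≤ (k + 1) ^ l.length := by
  induction l generalizing k with
  | nil => cases k <;> simp [multisets_val_zero, multisets_val_nil]
  | cons a l ihl =>
    induction k with
    | zero => simp [multisets_val_zero]
    | succ k ihk =>
      rw [multisets_val_succ, List.length_append, List.length_map]
      have h1 := ihl (k + 1)
      rw [List.length_cons] at ihk ⊢
      calc _ ≤ (k + 1) ^ (l.length + 1) + (k + 1 + 1) ^ l.length := Nat.add_le_add ihk h1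
        _ = (k + 1) ^ l.length * (k + 1) + (k + 1 + 1) ^ l.length := by rw [pow_succ]
        _ ≤ (k + 1 + 1) ^ l.length * (k + 1) + (k + 1 + 1) ^ l.length := by
          gcongr
          omega
        _ = (k + 1 + 1) ^ (l.length + 1) := by ring

/-- For a fixed number of elements, the multisets of size `k` are enumerated in time polynomial
in `k`. -/
theorem multisets_time (k : ℕ) (l : List α) :
    (multisets k l).time ≤ 6 * (k + 1) ^ (l.length + 1) := by
  induction l generalizing k with
  | nil => cases k <;> rw [multisets] <;> simp; omega
  | cons a l ihl =>
    induction k with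
    | zero => rw [multisets]; simp
    | succ k ihk =>
      have e : (multisets (k + 1) (a :: l)).time = k.size + 1 + ((multisets k (a :: l)).time +
          ((mapT (fun s => do tick 1; pure (a :: s)) (multisets k (a :: l)).val).time +
          ((multisets (k + 1) l).time + ((multisets k (a :: l)).val.length + 1)))) := by
        rw [multisets]
        simp [appendT_time]
      have h1 := mapT_time (f := fun s => do tick 1; pure (a :: s))
        (l := (multisets k (a :: l)).val) (b := 1) (fun _ _ => by simp)
      have h2 := multisets_length_le k (a :: l)
      have h3 := ihl (k + 1)
      have h4 := size_le_self k
      rw [e]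
      rw [List.length_cons] at ihk h2 ⊢
      have h5 : k + 1 ≤ (k + 1) ^ (l.length + 1) := Nat.le_self_pow (by omega) _
      have h6 : (k + 1) ^ l.length ≤ (k + 1 + 1) ^ l.length := Nat.pow_le_pow_left (by omega) _
      have h7 : (k + 1) ^ (l.length + 1 + 1) + (k + 1) ^ (l.length + 1) + (k + 1 + 1) ^ (l.length + 1)
          ≤ (k + 1 + 1) ^ (l.length + 1 + 1) := by
        calc _ = (k + 1) * (k + 2) * (k + 1) ^ l.length + (k + 1 + 1) ^ (l.length + 1) := by ring
          _ ≤ (k + 1) * (k + 2) * (k + 1 + 1) ^ l.length + (k + 1 + 1) ^ (l.length + 1) := by gcongr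
          _ = _ := by ring
      omega

/-! ### Step counts of the auction -/

variable {cost : α → β → Timed ℕ} {scale maxCost tc : ℕ} {rows queue : List α}
  {slots : List (Slot α β)}

/-- A bound for the step count of an offer. -/
def offerBound (scale maxCost tc : ℕ) : ℕ :=
  tc + (scale + 1) * (maxCost + 1) + (2 * (scale * maxCost + 1) + 1)

theorem AuctionState.offer_le (h : AuctionState cost scale maxCost rows queue slots) {a : α}
    (ha : a ∈ rows) {s : Slot α β} (hs : s ∈ slots) :
    (offer cost scale a s).val ≤ 2 * (scale * maxCost + 1) := by
  have h1 := Nat.mul_le_mul_left scale (h.bound a ha s hs)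
  have h2 := h.price s hs
  rw [offer_val]
  omega

theorem AuctionState.offer_time_le (h : AuctionState cost scale maxCost rows queue slots) {a : α}
    (ha : a ∈ rows) {s : Slot α β} (hs : s ∈ slots) (htc : (cost a s.col).time ≤ tc) :
    (offer cost scale a s).time ≤ offerBound scale maxCost tc := by
  have h0 := h.bound a ha s hs
  have h1 := Nat.mul_le_mul_left scale h0
  have h2 := h.price s hs
  have h3 := size_le_self (scale * (cost a s.col).val)
  have h4 := size_le_self s.price
  have h5 : (scale.size + 1) * ((cost a s.col).val.size + 1) ≤ (scale + 1) * (maxCost + 1) :=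
    Nat.mul_le_mul (Nat.add_le_add_right (size_le_self _) 1)
      (Nat.add_le_add_right ((size_le_self _).trans h0) 1)
  simp only [offer, time_bind, time_mulN, time_addN, val_mulN, offerBound]
  omega

theorem minOffer_time {a : α} {l : List (Slot α β)} {b c x : ℕ}
    (h : ∀ s ∈ l, (offer cost scale a s).time ≤ b) (hv : ∀ s ∈ l, (offer cost scale a s).val ≤ c)
    (hx : x ≤ c) :
    (minOffer cost scale a x l).time ≤ l.length * (b + 2 * c + 2) + 1 := by
  induction l generalizing x with
  | nil => simp [minOffer]
  | cons s l ih =>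
    have h1 := fun {x} => ih (x := x) (fun t ht => h t (List.mem_cons_of_mem _ ht))
      fun t ht => hv t (List.mem_cons_of_mem _ ht)
    have h2 := h s List.mem_cons_self
    have h3 := hv s List.mem_cons_self
    have h4 := size_le_self x
    have h5 := size_le_self (offer cost scale a s).val
    simp only [minOffer, time_bind, time_tick, time_leN, List.length_cons, Nat.add_mul]
    split
    · have := h1 hx
      omega
    · have := h1 h3
      omega

theorem takeSlot_time {a : α} {l : List (Slot α β)} {b c x : ℕ}
    (h : ∀ s ∈ l, (offer cost scale a s).time ≤ b) (hv : ∀ s ∈ l, (offer cost scale a s).val ≤ c)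
    (hx : x ≤ c) :
    (takeSlot cost scale a x l).time ≤ l.length * (b + 3 * c + 4) + 1 := by
  induction l with
  | nil => simp [takeSlot]
  | cons s l ih =>
    have h1 := ih (fun t ht => h t (List.mem_cons_of_mem _ ht))
      fun t ht => hv t (List.mem_cons_of_mem _ ht)
    have h2 := h s List.mem_cons_self
    have h3 := hv s List.mem_cons_self
    have h4 := size_le_self x
    have h5 := size_le_self (offer cost scale a s).val
    have h6 := size_le_self s.price
    have h7 := size_one_le
    have h8 : s.price ≤ c := by
      rw [offer_val] at h3
      omega
    simp only [takeSlot, time_bind, time_tick, time_eqN, List.length_cons, Nat.add_mul] at h1 ⊢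
    split
    · simp only [time_bind, time_addN, time_pure]
      omega
    · simp only [time_bind, time_pure]
      omega

/-- A bound for the step count of a bid. -/
def bidBound (scale maxCost tc n : ℕ) : ℕ :=
  offerBound scale maxCost tc +
    (n * (offerBound scale maxCost tc + 2 * (2 * (scale * maxCost + 1)) + 2) + 1) +
    (n * (offerBound scale maxCost tc + 3 * (2 * (scale * maxCost + 1)) + 4) + 1)

/-- The prices stay bounded, so every bid takes a bounded number of steps. The bound `k` on the
number of bids is separate from the counter `n`, which decreases. -/
theorem auction_time {n k : ℕ} (h : AuctionState cost scale maxCost rows queue slots)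
    (htc : ∀ a ∈ rows, ∀ s ∈ slots, (cost a s.col).time ≤ tc) (hn : n ≤ k) :
    (auction cost scale n queue slots).time ≤
      n * (k + 1 + bidBound scale maxCost tc slots.length) + 1 := by
  induction n generalizing queue slots with
  | zero => simp [auction]
  | succ n ih =>
    match queue, slots, h, htc with
    | [], _, h, _ => simp [auction]
    | a :: queue, [], h, _ => simp [auction]
    | a :: queue, s :: slots, h, htc =>
      obtain ⟨queue', slots', h1, -, h3, h4⟩ := h.step
      have h5 : slots'.length = (s :: slots).length := by simpa using congrArg List.length h3
      have h6 := ih h1 (fun b hb t ht => by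
        have : t.col ∈ (s :: slots).map Slot.col := by
          rw [← h3]; exact List.mem_map_of_mem ht
        obtain ⟨t', ht', e⟩ := List.mem_map.1 this
        rw [← e]
        exact htc b hb t' ht') (by omega)
      have ha : a ∈ rows := h.perm.subset (by simp)
      have hb := fun t ht => h.offer_time_le ha ht (htc a ha t ht)
      have hc := fun t ht => h.offer_le ha (s := t) ht
      have hb' := fun t ht => hb t (List.mem_cons_of_mem s ht)
      have hc' := fun t ht => hc t (List.mem_cons_of_mem s ht)
      have g1 := hb s List.mem_cons_self
      have g2 := minOffer_time hb' hc' (hc s List.mem_cons_self)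
      have g3 := takeSlot_time hb hc (((minOffer_spec cost scale a _ slots).1).trans
        (hc s List.mem_cons_self))
      have g4 := size_le_self n
      have g5 : slots.length * (offerBound scale maxCost tc + 2 * (2 * (scale * maxCost + 1)) + 2) ≤
          (s :: slots).length *
            (offerBound scale maxCost tc + 2 * (2 * (scale * maxCost + 1)) + 2) :=
        Nat.mul_le_mul_right _ (by simp)
      rw [(h4 n).2]
      rw [h5] at h6
      rw [Nat.add_mul n 1]
      unfold bidBound at h6 ⊢
      omega

/-- A bound for the step count of a minimum cost perfect matching with `n` rows. -/
def matchingBound (maxCost tc n : ℕ) : ℕ :=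
  (n * (1 + 1) + 1) + ((n + 1) * (n + 3) + ((n + 2) + ((n + 1 + 1) * (maxCost + 1) +
    (((n + 1) * maxCost + 2) + ((n + 1) * ((n + 1) * maxCost + 1 + 1) +
      (n * ((n + 1) * maxCost + 1) * (n * ((n + 1) * maxCost + 1) + 1 +
        bidBound (n + 1) maxCost tc n) + 1 + (n + 1)))))))

theorem minCostMatching_time {cols : List β} (hlen : rows.length = cols.length)
    (hcost : ∀ a ∈ rows, ∀ b ∈ cols, (cost a b).val ≤ maxCost)
    (htc : ∀ a ∈ rows, ∀ b ∈ cols, (cost a b).time ≤ tc) :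
    (minCostMatching cost maxCost rows cols).time ≤ matchingBound maxCost tc rows.length := by
  have h0 := auctionState_init (maxCost := maxCost) hlen hcost
  have h1 := auction_time (tc := tc) (n := rows.length * ((rows.length + 1) * maxCost + 1)) h0
    (by simpa using htc) le_rfl
  have h2 := mapT_time (f := fun u : β => do tick 1; pure (Slot.mk u 0 (none : Option α)))
    (l := cols) (b := 1) (fun _ _ => by simp)
  have h3 : ∀ l : List (Slot α β), (matchedPairs l).time = l.length + 1 := by
    intro l
    induction l with
    | nil => rfl
    | cons s l ih => cases ho : s.owner <;> simp [matchedPairs, ho, ih] <;> ring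
  obtain ⟨-, h4⟩ := auction_spec (n := rows.length * ((rows.length + 1) * maxCost + 1)) h0
    (by simp [List.map_map, Function.comp_def, hlen])
  have h5 := congrArg List.length h4
  rw [List.length_map, List.length_map, List.length_map, ← hlen] at h5
  have h6 := lengthT_time rows
  have h7 := size_le_self rows.length
  have h8 := size_one_le
  have h9 := size_le_self ((rows.length + 1) * maxCost)
  have g1 : ((rows.length + 1).size + 1) * (maxCost.size + 1) ≤
      (rows.length + 1 + 1) * (maxCost + 1) :=
    Nat.mul_le_mul (Nat.add_le_add_right (size_le_self _) 1)
      (Nat.add_le_add_right (size_le_self _) 1)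
  have g2 : (rows.length.size + 1) * (((rows.length + 1) * maxCost + 1).size + 1) ≤
      (rows.length + 1) * ((rows.length + 1) * maxCost + 1 + 1) :=
    Nat.mul_le_mul (Nat.add_le_add_right (size_le_self _) 1)
      (Nat.add_le_add_right (size_le_self _) 1)
  rw [List.length_map, ← hlen] at h1
  rw [← hlen] at h2
  simp only [minCostMatching, time_bind, lengthT_val, mapT_val, val_bind, val_pure, time_addN,
    time_mulN, val_addN, val_mulN, h3, h5, matchingBound]
  refine Nat.add_le_add h2 (Nat.add_le_add h6 (Nat.add_le_add (by omega) (Nat.add_le_add g1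
    (Nat.add_le_add (by omega) (Nat.add_le_add g2 (Nat.add_le_add h1 le_rfl))))))

end Lists

end

section

/-! ### Step counts of the approximation scheme -/

variable {s q T m : ℕ} {items : List Item} {M removed : List ℕ} {C : List Config}

theorem makeItems_time {σ₀ : List (ℕ × ℕ)} {l : List Job} (hσ : ∀ b ∈ σ₀, b.1.size ≤ s)
    (hl : ∀ j ∈ l, j.id.size ≤ s) (h1 : σ₀.length ≤ s) (h2 : l.length ≤ s) :
    (makeItems σ₀ l).time ≤ s * (s * (2 * s + 2) + 1 + 1) + 1 := by
  refine (mapT_time (b := s * (2 * s + 2) + 1) fun j hj => ?_).trans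
    (Nat.add_le_add_right (Nat.mul_le_mul_right _ h2) 1)
  refine (lookupT_time (hl j hj) hσ).trans ?_
  exact Nat.add_le_add_right (Nat.mul_le_mul_right _ h1) 1

theorem insertItem_time {x : Item} {l : List Item} (hx : x.time.size ≤ s)
    (hl : ∀ y ∈ l, y.time.size ≤ s) :
    (insertItem x l).time ≤ l.length * (2 * s + 2) + 1 := by
  induction l with
  | nil => simp [insertItem]
  | cons y l ih =>
    have h1 := ih fun c hc => hl c (List.mem_cons_of_mem _ hc)
    have h2 := hl y List.mem_cons_self
    simp only [insertItem, time_bind, time_tick, time_leN, List.length_cons, Nat.add_mul]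
    split
    · simp only [time_pure]
      omega
    · simp only [time_bind, time_pure]
      omega

theorem sortItems_time {l : List Item} {n : ℕ} (hl : ∀ y ∈ l, y.time.size ≤ s)
    (hn : l.length ≤ n) :
    (sortItems l).time ≤ l.length * (n * (2 * s + 2) + 2) + 1 := by
  induction l with
  | nil => simp [sortItems]
  | cons x l ih =>
    rw [List.length_cons] at hn
    have h1 := ih (fun c hc => hl c (List.mem_cons_of_mem _ hc)) (by omega)
    have h2 := insertItem_time (hl x List.mem_cons_self) (l := (sortItems l).val) fun y hy =>
      hl y (List.mem_cons_of_mem _ ((sortItems_perm l).subset hy))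
    rw [(sortItems_perm l).length_eq] at h2
    have h3 : l.length * (2 * s + 2) ≤ n * (2 * s + 2) := Nat.mul_le_mul_right _ (by omega)
    simp only [sortItems, time_bind, time_tick, List.length_cons, Nat.add_mul l.length 1]
    omega

theorem mul_time_le {a b x y : ℕ} (ha : a.size ≤ x) (hb : b.size ≤ y) :
    (a.size + 1) * (b.size + 1) ≤ (x + 1) * (y + 1) :=
  Nat.mul_le_mul (Nat.add_le_add_right ha 1) (Nat.add_le_add_right hb 1)

/-- A bound for the step count of classifying one item. -/
def splitBound (s : ℕ) : ℕ :=
  1 + ((s + 1) * (s + 1) + ((s + 2 * s + 1) + ((2 * s + 1) * (s + 1) + (3 * s + 1) * (s + 1))))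

theorem splitItems_time {l : List Item} (hl : ∀ x ∈ l, x.time.size ≤ s) (hq : q.size ≤ s)
    (hT : T.size ≤ s) : (splitItems q T l).time ≤ l.length * splitBound s + 1 := by
  induction l with
  | nil => simp [splitItems]
  | cons x l ih =>
    have h1 := ih fun c hc => hl c (List.mem_cons_of_mem _ hc)
    have h2 := hl x List.mem_cons_self
    have h3 : (x.time * q).size ≤ 2 * s := (size_mul_le _ _).trans (by omega)
    have h4 : (x.time * q * q).size ≤ 3 * s := (size_mul_le _ _).trans (by omega)
    have h5 := mul_time_le h2 hq
    have h6 := mul_time_le h3 hq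
    have h7 := mul_time_le h4 hT
    simp only [splitItems, time_bind, time_tick, time_mulN, time_ltN, val_mulN, List.length_cons,
      Nat.add_mul l.length 1]
    unfold splitBound at h1 ⊢
    split
    · simp only [time_bind, time_mulN, time_divN, val_mulN, time_pure]
      omega
    · simp only [time_pure]
      omega

/-- The rounded size is `p q² / T`, and each of `p`, `q` and `q` has at most `s` digits. -/
theorem rounded_size_le {x : Item} (hx : x.time.size ≤ s) (hq : q.size ≤ s) :
    (x.rounded q T).size ≤ 3 * s :=
  size_le_of_le (Nat.div_le_self _ _)
    ((size_mul_le _ _).trans (by have := size_mul_le x.time q; omega))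

theorem sizesOf_time (l : List (ℕ × Item)) : (sizesOf l).time ≤ l.length * (1 + 1) + 1 :=
  mapT_time fun _ _ => by simp

theorem flatten_length_le {L : List (List ℕ)} {n : ℕ} (h : ∀ l ∈ L, l.length ≤ n) :
    (L.map List.length).sum ≤ L.length * n := by
  refine (List.sum_le_card_nsmul _ n fun x hx => ?_).trans_eq (by simp)
  obtain ⟨l, hl, rfl⟩ := List.mem_map.1 hx
  exact h l hl

/-- A bound for the step count of the enumeration of configurations. It is a polynomial in `s` as
the number of configurations of one bin depends only on `q`. -/
def configurationsBound (q s : ℕ) : ℕ :=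
  (binConfigs q).time + (6 * (s + 1) ^ ((binConfigs q).val.length + 1) +
    ((s + 1) ^ (binConfigs q).val.length * ((s * s + 2 * s + 1) +
      (s * s * (s * (2 * (3 * s) + 2) + 2) + 1) + 1) + 1))

theorem configurations_time {sizes : List ℕ} (hm : m ≤ s) (hq : q ≤ s) (hqq : q * q ≤ s)
    (h1 : sizes.length ≤ s) (h2 : ∀ r ∈ sizes, r.size ≤ 3 * s) :
    (configurations q m sizes).time ≤ configurationsBound q s := by
  have h3 := (multisets_time m (binConfigs q).val).trans (Nat.mul_le_mul_left 6
    (Nat.pow_le_pow_left (Nat.add_le_add_right hm 1) _))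
  have h4 := (multisets_length_le m (binConfigs q).val).trans
    (Nat.pow_le_pow_left (Nat.add_le_add_right hm 1) _)
  have h5 := filterT_time (p := fun C : List Config => do
      let s ← concatT C
      sameContent s sizes) (l := (multisets m (binConfigs q).val).val)
    (b := (s * s + 2 * s + 1) + (s * s * (s * (2 * (3 * s) + 2) + 2) + 1)) (fun C hC => by
      obtain ⟨g1, g2⟩ := mem_multisets_sound hC
      have g3 : (C.map List.length).sum ≤ s * s :=
        (flatten_length_le fun D hD => (mem_binConfigs_sound (g2 D hD)).1).trans
          (Nat.mul_le_mul (g1.trans_le hm) hq)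
      have g4 := sameContent_time (k := C.flatten) (l := sizes) (s := 3 * s) (n := s)
        (fun r hr => by
          obtain ⟨D, hD, hr⟩ := List.mem_flatten.1 hr
          have := List.single_le_sum (l := D) (by simp) r hr
          have := (mem_binConfigs_sound (g2 D hD)).2
          have := size_le_self r
          omega) h2 h1
      rw [List.length_flatten] at g4
      simp only [time_bind, concatT_val, concatT_time]
      refine Nat.add_le_add (by omega) (g4.trans ?_)
      exact Nat.add_le_add_right (Nat.mul_le_mul_right _ g3) 1)
  simp only [configurations, time_bind]
  refine Nat.add_le_add le_rfl (Nat.add_le_add h3 (h5.trans ?_))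
  exact Nat.add_le_add_right (Nat.mul_le_mul_right _ h4) 1

/-- All lengths and all sizes of numbers that the algorithm meets before rounding are at
most `s`. -/
structure ItemBounds (s q m : ℕ) (items : List Item) : Prop where
  eps : q ≤ s
  epsSq : q * q ≤ s
  machines : m ≤ s
  length : items.length ≤ s
  total : (items.map Item.time).sum.size ≤ s

theorem ItemBounds.time_size (h : ItemBounds s q m items) {x : Item} (hx : x ∈ items) :
    x.time.size ≤ s :=
  size_le_of_le (List.single_le_sum (l := items.map Item.time) (by simp) _
    (List.mem_map_of_mem hx)) h.total

theorem ItemBounds.eps_size (h : ItemBounds s q m items) : q.size ≤ s :=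
  (size_le_self q).trans h.eps

theorem largePairs_length_le (q T : ℕ) (items : List Item) :
    (largePairs q T items).length ≤ items.length := by
  have := large_add_small_length q T items
  omega

theorem smallItems_length_le (q T : ℕ) (items : List Item) :
    (smallItems q T items).length ≤ items.length := by
  have := large_add_small_length q T items
  omega

theorem ItemBounds.pair_size (h : ItemBounds s q m items) {y : ℕ × Item}
    (hy : y ∈ largePairs q T items) : y.1.size ≤ 3 * s := by
  obtain ⟨x, hx, rfl⟩ := List.mem_map.1 hy
  exact rounded_size_le (h.time_size (List.mem_of_mem_filter hx)) h.eps_size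

theorem ItemBounds.configurations_time (h : ItemBounds s q m items) :
    (configurations q m ((largePairs q T items).map Prod.fst)).time ≤ configurationsBound q s := by
  refine Reopt.configurations_time h.machines h.eps h.epsSq ?_ fun r hr => ?_
  · rw [List.length_map]
    exact (largePairs_length_le q T items).trans h.length
  · obtain ⟨y, hy, rfl⟩ := List.mem_map.1 hr
    exact h.pair_size hy

/-- A bound for the step count of the test of the approximation scheme. -/
def fitsBound (q s : ℕ) : ℕ :=
  (s + 1) * (s + 1) + ((s + 2 * s + 1) + ((s * splitBound s + 1) + ((s * (1 + 1) + 1) +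
    configurationsBound q s)))

theorem fits_time (h : ItemBounds s q m items) (hT : T.size ≤ s) :
    (fits q m (items.map Item.time).sum items T).time ≤ fitsBound q s := by
  have h1 := mul_time_le ((size_le_self m).trans h.machines) hT
  have h2 : (m * T).size ≤ 2 * s :=
    (size_mul_le _ _).trans (by have := size_le_self m; have := h.machines; omega)
  have h3 := h.total
  have h4 := (splitItems_time (l := items) (fun x hx => h.time_size hx) h.eps_size hT).trans
    (Nat.add_le_add_right (Nat.mul_le_mul_right _ h.length) 1)
  have h5 := (sizesOf_time (largePairs q T items)).trans (Nat.add_le_add_right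
    (Nat.mul_le_mul_right _ ((largePairs_length_le q T items).trans h.length)) 1)
  have h6 := h.configurations_time (T := T)
  simp only [fits, time_bind, time_mulN, time_leN, val_mulN, fitsBound]
  split
  · simp only [time_bind, splitItems_eq, sizesOf_val]
    split <;> simp only [time_pure] <;> omega
  · simp only [time_pure]
    omega

/-- A bound for the step count of one round of binary search. -/
def searchBound (q s : ℕ) : ℕ :=
  (s + 1) + ((s + s + 1) + ((s + s + 1) + ((2 * s + 1) * (2 + 1) + (fitsBound q s +
    (s + 1 + 1)))))

theorem search_time (h : ItemBounds s q m items) {n lo hi : ℕ} (hn : n ≤ s) (hlh : lo ≤ hi)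
    (hhi : hi.size ≤ s) :
    (search q m (items.map Item.time).sum items n lo hi).time ≤ n * searchBound q s + 1 := by
  induction n generalizing lo hi with
  | zero => simp [search]
  | succ n ih =>
    have h1 := size_le_self n
    have h2 := size_le_of_le hlh hhi
    have h3 : (lo + hi).size ≤ 2 * s := (size_add_le _ _).trans (by omega)
    have h4 : Nat.size 2 ≤ 2 := size_le_self 2
    have h5 := mul_time_le h3 h4
    have h6 : ((lo + hi) / 2).size ≤ s := size_le_of_le (b := hi) (by omega) hhi
    have h7 := fits_time h h6
    have h8 := size_one_le
    simp only [search, time_bind, time_tick, time_ltN, val_ltN, Nat.add_mul n 1,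
      decide_eq_true_eq]
    by_cases hlt : lo < hi
    · rw [if_pos hlt]
      have h9 := ih (by omega) (lo := lo) (hi := (lo + hi) / 2) (by omega) h6
      have h10 := ih (by omega) (lo := (lo + hi) / 2 + 1) (hi := hi) (by omega) hhi
      simp only [time_bind, time_addN, time_divN, val_addN, val_divN]
      unfold searchBound at h9 h10 ⊢
      split
      · omega
      · simp only [time_bind, time_addN, val_addN]
        omega
    · rw [if_neg hlt]
      simp only [time_pure]
      unfold searchBound
      omega

/-- A bound for the step count of the approximation scheme. -/
def approxBound (q s : ℕ) : ℕ :=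
  (s * (0 + 2 * s + 2) + 1) + ((s + 1) * (s + 1) + ((s * searchBound q s + 1) +
    ((s + 1) * (s + 1) + (s + s + 1))))

theorem search_le {n lo hi total : ℕ} (hlh : lo ≤ hi) :
    (search q m total items n lo hi).val ≤ hi := by
  induction n generalizing lo hi with
  | zero => simp [search]
  | succ n ih =>
    by_cases h : lo < hi
    · by_cases hok : (fits q m total items ((lo + hi) / 2)).val = true
      · have e : (search q m total items (n + 1) lo hi).val =
            (search q m total items n lo ((lo + hi) / 2)).val := by
          simp [search, h, hok]
        rw [e]
        exact (ih (by omega)).trans (by omega)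
      · have e : (search q m total items (n + 1) lo hi).val =
            (search q m total items n ((lo + hi) / 2 + 1) hi).val := by
          simp [search, h, hok]
        rw [e]
        exact ih (by omega)
    · simp [search, h]

theorem approxMakespan_time (h : ItemBounds s q m items) :
    (approxMakespan q m items).time ≤ approxBound q s := by
  have h1 := (sumT_time (f := fun x : Item => pure x.time) (l := items) (b := 0)
    (fun _ _ => by simp) h.total).trans (Nat.add_le_add_right (Nat.mul_le_mul_right _ h.length) 1)
  have h2 := mul_time_le h.total h.total
  have h3 := (search_time h (n := (items.map Item.time).sum.size) (lo := 0) h.total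
    (Nat.zero_le _) h.total).trans (Nat.add_le_add_right (Nat.mul_le_mul_right _ h.total) 1)
  have h4 := search_le (q := q) (m := m) (items := items) (n := (items.map Item.time).sum.size)
    (lo := 0) (hi := (items.map Item.time).sum) (total := (items.map Item.time).sum)
    (Nat.zero_le _)
  have h5 := size_le_of_le h4 h.total
  have h6 := mul_time_le h5 h.eps_size
  have h7 := size_le_of_le (Nat.div_le_self _ q) h5
  simp only [approxMakespan, time_bind, sumT_val, val_pure, time_bitsN, val_bitsN, time_divN,
    val_divN, time_addN, approxBound]
  refine Nat.add_le_add h1 (Nat.add_le_add h2 (Nat.add_le_add h3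
    (Nat.add_le_add h6 (Nat.add_le_add_right (Nat.add_le_add h5 h7) 1))))

/-! ### Step counts of the matching and of the placement of items -/

theorem isHome_time {i : ℕ} {x : Item} (hi : i.size ≤ s)
    (hx : ∀ h, x.home = some h → h.size ≤ s) : (isHome i x).time ≤ 2 * s + 2 := by
  simp only [isHome, time_bind, time_tick]
  cases e : x.home with
  | none => simp only [time_pure]; omega
  | some h =>
    have := hx h e
    simp only [time_eqN]
    omega

theorem makeVertices_time {present : Bool} {large : List (ℕ × Item)} {small : List Item}
    {l : List ℕ} (hl : ∀ i ∈ l, i.size ≤ s) (h1 : large.length ≤ s) (h2 : small.length ≤ s)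
    (h3 : l.length ≤ s) (hL : ∀ y ∈ large, ∀ h, y.2.home = some h → h.size ≤ s)
    (hS : ∀ x ∈ small, ∀ h, x.home = some h → h.size ≤ s) :
    (makeVertices present large small l).time ≤
      s * (s * (2 * s + 2 + 1) + 1 + (s * (2 * s + 2 + 1) + 1) + 1) + 1 := by
  refine (mapT_time fun i hi => ?_).trans (Nat.add_le_add_right (Nat.mul_le_mul_right _ h3) 1)
  simp only [time_bind, time_pure, Nat.add_zero]
  refine Nat.add_le_add ((filterT_time fun y hy => isHome_time (hl i hi) (hL y hy)).trans ?_)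
    ((filterT_time fun x hx => isHome_time (hl i hi) (hS x hx)).trans ?_)
  · exact Nat.add_le_add_right (Nat.mul_le_mul_right _ h1) 1
  · exact Nat.add_le_add_right (Nat.mul_le_mul_right _ h2) 1

theorem takeSize_time {r n : ℕ} {L : List (ℕ × Item)} (hr : r.size ≤ 3 * s)
    (hL : ∀ y ∈ L, y.1.size ≤ 3 * s) (hn : L.length ≤ n) :
    (takeFirst (fun y : ℕ × Item => eqN r y.1) L).time ≤ n * (6 * s + 1 + 1) + 1 := by
  refine (takeFirst_time (b := 6 * s + 1) fun y hy => ?_).trans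
    (Nat.add_le_add_right (Nat.mul_le_mul_right _ hn) 1)
  have := hL y hy
  rw [time_eqN]
  omega

theorem keepLarge_time {D : Config} {L : List (ℕ × Item)} {n : ℕ} (hD : ∀ r ∈ D, r.size ≤ 3 * s)
    (hL : ∀ y ∈ L, y.1.size ≤ 3 * s) (hn : L.length ≤ n) :
    (keepLarge D L).time ≤ D.length * (n * (6 * s + 1 + 1) + 2) + 1 := by
  induction D generalizing L with
  | nil => simp [keepLarge]
  | cons r D ih =>
    have h1 := takeSize_time (hD r List.mem_cons_self) hL hn
    have h2 := fun {L} => ih (L := L) fun c hc => hD c (List.mem_cons_of_mem _ hc)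
    simp only [keepLarge, time_bind, time_tick, List.length_cons, Nat.add_mul D.length 1]
    cases hf : (takeFirst (fun y : ℕ × Item => eqN r y.1) L).val with
    | none =>
      have h3 := h2 hL hn
      simp only [time_bind, time_pure]
      omega
    | some d =>
      obtain ⟨y, L1⟩ := d
      obtain ⟨-, hp⟩ := takeFirst_some hf
      have h4 := hp.length_eq
      rw [List.length_cons] at h4
      have h3 := h2 (L := L1) (fun y hy => hL y (hp.symm.subset (List.mem_cons_of_mem _ hy)))
        (by omega)
      simp only [time_bind, time_pure]
      omega

theorem omitLargest_time {w cap total : ℕ} {S : List Item} (hw : w.size ≤ s)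
    (hcap : cap.size ≤ 4 * s) (ht : total.size ≤ 4 * s) (hS : ∀ x ∈ S, x.time.size ≤ s) :
    (omitLargest w cap total S).time ≤
      S.length * (1 + (8 * s + 1) + (s + 1) * (s + 1) + (6 * s + 1)) + 1 := by
  induction S generalizing total with
  | nil => simp [omitLargest]
  | cons x l ih =>
    have h1 := ih (total := total - w * x.time) (size_le_of_le (Nat.sub_le _ _) ht)
      fun c hc => hS c (List.mem_cons_of_mem _ hc)
    have h2 := mul_time_le hw (hS x List.mem_cons_self)
    have h3 : (w * x.time).size ≤ 2 * s :=
      (size_mul_le _ _).trans (by have := hS x List.mem_cons_self; omega)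
    simp only [omitLargest, time_bind, time_tick, time_leN, List.length_cons,
      Nat.add_mul l.length 1]
    split
    · simp only [time_pure]
      omega
    · simp only [time_bind, time_mulN, val_mulN, time_subN, val_subN, time_pure]
      omega

/-- A bound for the step count of choosing the small items kept on a machine. -/
def keepSmallBound (s : ℕ) : ℕ :=
  (s + 1) * (s + 1) + ((s + 1) * (s + 1) + ((s * (0 + 2 * s + 2) + 1) + ((s + 1) * (s + 1) +
    ((s * (0 + 2 * s + 2) + 1) + ((s + 1) * (s + 1) + ((4 * s + 1) +
      (s * (1 + (8 * s + 1) + (s + 1) * (s + 1) + (6 * s + 1)) + 1)))))))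

theorem keepSmall_time (h : ItemBounds s q m items) (hT : T.size ≤ s) {D : Config}
    {S : List Item} (hD : D.length ≤ s) (hDs : D.sum ≤ q * q) (hS : S.Sublist items) :
    (keepSmall q T D S).time ≤ keepSmallBound s := by
  have hw : (q * q).size ≤ s := (size_le_self _).trans h.epsSq
  have hc : D.sum.size ≤ s := size_le_of_le hDs hw
  have hs : (S.map Item.time).sum.size ≤ s :=
    size_le_of_le ((hS.map Item.time).sum_le_sum (by simp)) h.total
  have hlen : S.length ≤ s := hS.length_le.trans h.length
  have h1 := mul_time_le h.eps_size h.eps_size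
  have h2 := mul_time_le hw hT
  have h3 := (sumT_time (f := fun x : Item => pure x.time) (l := S) (b := 0)
    (fun _ _ => by simp) hs).trans (Nat.add_le_add_right (Nat.mul_le_mul_right _ hlen) 1)
  have h4 := mul_time_le hw hs
  have h5 := (sumT_time (f := (pure : ℕ → Timed ℕ)) (l := D) (b := 0) (s := s)
    (fun _ _ => by simp) (by simpa using hc)).trans
    (Nat.add_le_add_right (Nat.mul_le_mul_right _ hD) 1)
  have h6 := mul_time_le hc hT
  have h7 : (q * q * T).size ≤ 2 * s := (size_mul_le _ _).trans (by omega)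
  have h8 : (q * q * (S.map Item.time).sum).size ≤ 2 * s := (size_mul_le _ _).trans (by omega)
  have h9 : (D.sum * T).size ≤ 2 * s := (size_mul_le _ _).trans (by omega)
  have h10 := (omitLargest_time (w := q * q) (cap := q * q * T)
    (total := q * q * (S.map Item.time).sum + D.sum * T) (S := S) hw (by omega)
    ((size_add_le _ _).trans (by omega)) fun x hx => h.time_size (hS.subset hx)).trans
    (Nat.add_le_add_right (Nat.mul_le_mul_right _ hlen) 1)
  simp only [keepSmall, time_bind, time_mulN, val_mulN, sumT_val, val_pure, time_addN, val_addN,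
    List.map_id', keepSmallBound]
  exact Nat.add_le_add h1 (Nat.add_le_add h2 (Nat.add_le_add h3 (Nat.add_le_add h4
    (Nat.add_le_add h5 (Nat.add_le_add h6 (Nat.add_le_add
      (Nat.add_le_add_right ((Nat.add_le_add h8 h9).trans (by omega)) 1) h10))))))

theorem config_size_le (h : ItemBounds s q m items) {D : Config} (hDs : D.sum ≤ q * q) :
    ∀ r ∈ D, r.size ≤ 3 * s := fun r hr => by
  have := List.single_le_sum (l := D) (by simp) r hr
  have := size_le_self r
  have := h.epsSq
  omega

/-- The items of a vertex are among the given items. -/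
theorem sublist_of_mem_allVertices {v : Vertex} (hv : v ∈ allVertices q T items M removed) :
    v.large.Sublist (largePairs q T items) ∧ v.small.Sublist items := by
  rcases List.mem_append.1 hv with hv | hv <;> obtain ⟨i, -, rfl⟩ := List.mem_map.1 hv <;>
    exact ⟨List.filter_sublist, List.filter_sublist.trans List.filter_sublist⟩

/-- A bound for the step count of choosing the large items kept on a machine. -/
def keepLargeBound (s : ℕ) : ℕ := s * (s * (6 * s + 1 + 1) + 2) + 1

theorem keepLarge_time_le (h : ItemBounds s q m items) {D : Config} (hD : D.length ≤ s)
    (hDs : D.sum ≤ q * q) {v : Vertex} (hv : v ∈ allVertices q T items M removed) :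
    (keepLarge D v.large).time ≤ keepLargeBound s := by
  have h1 := (sublist_of_mem_allVertices hv).1
  refine (keepLarge_time (config_size_le h hDs) (fun y hy => h.pair_size (h1.subset hy))
    (h1.length_le.trans ((largePairs_length_le q T items).trans h.length))).trans ?_
  exact Nat.add_le_add_right (Nat.mul_le_mul_right _ hD) 1

/-- A bound for the step count of computing the cost of an edge. -/
def edgeBound (s : ℕ) : ℕ :=
  1 + (keepLargeBound s + (keepSmallBound s + ((s + 1) * (s + 3) + ((s + 1) * (s + 3) +
    (s + s + 1)))))

theorem edgeCost_time (h : ItemBounds s q m items) (hT : T.size ≤ s)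
    (hsort : items.Pairwise fun x y => y.time ≤ x.time) {v : Vertex}
    (hv : v ∈ allVertices q T items M removed) {u : Option Config}
    (hu : ∀ D, u = some D → D.length ≤ q ∧ D.sum ≤ q * q) {forbidden : ℕ} :
    (edgeCost q T forbidden v u).time ≤ edgeBound s := by
  simp only [edgeCost, time_bind, time_tick, edgeBound]
  cases u with
  | none => simp only [time_pure]; omega
  | some D =>
    obtain ⟨h1, hDs⟩ := hu D rfl
    have hD := h1.trans h.eps
    obtain ⟨hvl, hvs⟩ := sublist_of_mem_allVertices hv
    dsimp only
    split
    · have h2 := keepLarge_time_le h hD hDs hv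
      have h3 := keepSmall_time h hT hD hDs hvs
      have h4 := lengthT_time (keepLarge D v.large).val.vacant
      have h5 := lengthT_time (keepSmall q T D v.small).val.2
      have h6 := keepLarge_lengths D v.large
      have hsv : v.small.Pairwise fun x y => y.time ≤ x.time := hsort.sublist hvs
      have h7 := congrArg List.length (keepSmall_spec (T := T) hsv hDs).1
      rw [List.length_append] at h7
      have h8 := hvs.length_le.trans h.length
      have h9 : (keepLarge D v.large).val.vacant.length ≤ s := by omega
      have h10 : (keepSmall q T D v.small).val.2.length ≤ s := by omega
      have h11 : ∀ n, n ≤ s → (n + 1) * (n + 3) ≤ (s + 1) * (s + 3) := fun n hn =>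
        Nat.mul_le_mul (by omega) (by omega)
      have h12 := size_le_self (keepLarge D v.large).val.vacant.length
      have h13 := size_le_self (keepSmall q T D v.small).val.2.length
      simp only [time_bind, lengthT_val, time_addN]
      exact Nat.add_le_add le_rfl (Nat.add_le_add h2 (Nat.add_le_add h3 (Nat.add_le_add
        (h4.trans (h11 _ h9)) (Nat.add_le_add (h5.trans (h11 _ h10)) (by omega)))))
    · simp only [time_pure]
      omega

/-- A bound for the step count of placing the items kept on one machine. -/
def placeBound (s : ℕ) : ℕ :=
  1 + (keepLargeBound s + (keepSmallBound s + ((s + 1) + ((s + 1) + (s + 1)))))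

theorem placeKept_time (h : ItemBounds s q m items) (hT : T.size ≤ s)
    (hsort : items.Pairwise fun x y => y.time ≤ x.time) {large : List (ℕ × Item)}
    {small : List Item} {N : List (Vertex × Option Config)}
    (hN : ∀ p ∈ N, p.1 ∈ allVertices q T items M removed ∧
      ∀ D, p.2 = some D → D.length ≤ q ∧ D.sum ≤ q * q) :
    (placeKept q T large small N).time ≤ N.length * placeBound s + 1 := by
  induction N with
  | nil => simp [placeKept]
  | cons p N ih =>
    have h1 := ih fun p hp => hN p (List.mem_cons_of_mem _ hp)
    obtain ⟨hv, hu⟩ := hN p List.mem_cons_self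
    obtain ⟨v, u⟩ := p
    obtain ⟨hvl, hvs⟩ := sublist_of_mem_allVertices hv
    have h2 := hvl.length_le.trans ((largePairs_length_le q T items).trans h.length)
    have h3 := hvs.length_le.trans h.length
    dsimp only at h2 h3 hu hv hvs
    rw [List.length_cons, Nat.add_mul N.length 1]
    cases u with
    | none =>
      simp only [placeKept, time_bind, time_tick, appendT_time, time_pure]
      unfold placeBound at h1 ⊢
      omega
    | some D =>
      obtain ⟨g1, hDs⟩ := hu D rfl
      have hD := g1.trans h.eps
      have h4 := keepLarge_time_le h hD hDs hv
      have h5 := keepSmall_time h hT hD hDs hvs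
      obtain ⟨K, k1, k2, -, -⟩ := keepLarge_spec D v.large
      have hsv : v.small.Pairwise fun x y => y.time ≤ x.time := hsort.sublist hvs
      have h7 := congrArg List.length (keepSmall_spec (T := T) hsv hDs).1
      have h8 := k2.length_eq
      have h9 := congrArg List.length k1
      rw [List.length_append] at h7 h8
      rw [List.length_map] at h9
      simp only [placeKept, time_bind, time_tick, appendT_time, time_pure]
      unfold placeBound at h1 ⊢
      omega

end

section

/-! ### Step counts of the construction of a solution -/

variable {s q T m forbidden : ℕ} {items : List Item} {M removed : List ℕ} {C : List Config}

theorem fillBin_rest (l : List ℕ) (pool : List (ℕ × Item)) :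
    (∀ y ∈ (fillBin l pool).val.2, y ∈ pool) ∧ (fillBin l pool).val.2.length ≤ pool.length ∧
      (fillBin l pool).val.1.length ≤ l.length := by
  induction l generalizing pool with
  | nil => simp [fillBin]
  | cons r l ih =>
    cases hf : (takeFirst (fun y : ℕ × Item => eqN r y.1) pool).val with
    | none =>
      have e : (fillBin (r :: l) pool).val = (fillBin l pool).val := by
        simp [fillBin, hf]
      obtain ⟨h1, h2, h3⟩ := ih pool
      rw [e]
      exact ⟨h1, h2, h3.trans (Nat.le_succ _)⟩
    | some d =>
      obtain ⟨y, pool1⟩ := d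
      obtain ⟨-, hp⟩ := takeFirst_some hf
      have e : (fillBin (r :: l) pool).val =
          (y.2 :: (fillBin l pool1).val.1, (fillBin l pool1).val.2) := by
        simp [fillBin, hf]
      obtain ⟨h1, h2, h3⟩ := ih pool1
      have h4 := hp.length_eq
      rw [List.length_cons] at h4
      rw [e]
      exact ⟨fun z hz => hp.symm.subset (List.mem_cons_of_mem _ (h1 z hz)), by
        dsimp only; omega, Nat.add_le_add_right h3 1⟩

theorem fillBin_time {l : List ℕ} {pool : List (ℕ × Item)} {n : ℕ} (hl : ∀ r ∈ l, r.size ≤ 3 * s)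
    (hL : ∀ y ∈ pool, y.1.size ≤ 3 * s) (hn : pool.length ≤ n) :
    (fillBin l pool).time ≤ l.length * (n * (6 * s + 1 + 1) + 2) + 1 := by
  induction l generalizing pool with
  | nil => simp [fillBin]
  | cons r l ih =>
    have h1 := takeSize_time (hl r List.mem_cons_self) hL hn
    have h2 := fun {pool} => ih (pool := pool) fun c hc => hl c (List.mem_cons_of_mem _ hc)
    simp only [fillBin, time_bind, time_tick, List.length_cons, Nat.add_mul l.length 1]
    cases hf : (takeFirst (fun y : ℕ × Item => eqN r y.1) pool).val with
    | none =>
      have h3 := h2 hL hn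
      dsimp only
      omega
    | some d =>
      obtain ⟨y, pool1⟩ := d
      obtain ⟨-, hp⟩ := takeFirst_some hf
      have h4 := hp.length_eq
      rw [List.length_cons] at h4
      have h3 := h2 (pool := pool1)
        (fun y hy => hL y (hp.symm.subset (List.mem_cons_of_mem _ hy))) (by omega)
      simp only [time_bind, time_pure]
      omega

/-- A bound for the step count of filling the vacant places of one bin. -/
def fillBound (s : ℕ) : ℕ := 1 + (keepLargeBound s + (s + 1))

theorem fillBins_time {bins : List Bin} {pool : List (ℕ × Item)}
    (hb : ∀ B ∈ bins, B.vacant.length ≤ s ∧ ∀ r ∈ B.vacant, r.size ≤ 3 * s)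
    (hL : ∀ y ∈ pool, y.1.size ≤ 3 * s) (hn : pool.length ≤ s) :
    (fillBins bins pool).time ≤ bins.length * fillBound s + 1 := by
  induction bins generalizing pool with
  | nil => simp [fillBins]
  | cons B l ih =>
    obtain ⟨g1, g2⟩ := hb B List.mem_cons_self
    obtain ⟨h1, h2, h3⟩ := fillBin_rest B.vacant pool
    have h4 := ih (pool := (fillBin B.vacant pool).val.2)
      (fun B hB => hb B (List.mem_cons_of_mem _ hB)) (fun y hy => hL y (h1 y hy)) (h2.trans hn)
    have h5 : (fillBin B.vacant pool).time ≤ keepLargeBound s :=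
      (fillBin_time g2 hL hn).trans (Nat.add_le_add_right (Nat.mul_le_mul_right _ g1) 1)
    simp only [fillBins, time_bind, time_tick, appendT_time, time_pure, List.length_cons,
      Nat.add_mul l.length 1]
    unfold fillBound at h4 ⊢
    omega

/-- A bound for the step count of testing one bin in First-Fit. -/
def testBound (s : ℕ) : ℕ :=
  1 + ((s * (0 + 2 * s + 2) + 1) + ((2 * s + 1) + ((s + 1) * (2 * s + 1) + ((s + 2) +
    ((s + 1 + 1) * (s + 1) + (5 * s + 2))))))

theorem firstFitItem_time (hq : q.size ≤ s) (hT : T.size ≤ s) {x : Item} (hx : x.time.size ≤ s)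
    {bins : List Bin} (hb : ∀ B ∈ bins, B.items.length ≤ s ∧ B.load.size ≤ s) :
    (firstFitItem q T x bins).time ≤ bins.length * testBound s + 1 := by
  induction bins with
  | nil => simp [firstFitItem]
  | cons B l ih =>
    have h1 := ih fun B hB => hb B (List.mem_cons_of_mem _ hB)
    obtain ⟨g1, g2⟩ := hb B List.mem_cons_self
    have h2 := (sumT_time (f := fun x : Item => pure x.time) (l := B.items) (b := 0)
      (fun _ _ => by simp) g2).trans (Nat.add_le_add_right (Nat.mul_le_mul_right _ g1) 1)
    have h3 : (B.load + x.time).size ≤ 2 * s := (size_add_le _ _).trans (by omega)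
    have h4 := mul_time_le hq h3
    have h5 := size_one_le
    have h6 : (q + 1).size ≤ s + 1 := (size_add_le _ _).trans (by omega)
    have h7 := mul_time_le h6 hT
    have h8 : (q * (B.load + x.time)).size ≤ 3 * s := (size_mul_le _ _).trans (by omega)
    have h9 : ((q + 1) * T).size ≤ 2 * s + 1 := (size_mul_le _ _).trans (by omega)
    have e : (List.map (fun x : Item => x.time) B.items).sum = B.load := rfl
    simp only [firstFitItem, time_bind, time_tick, sumT_val, val_pure, e, time_addN, val_addN,
      time_mulN, val_mulN, time_leN, List.length_cons, Nat.add_mul l.length 1]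
    unfold testBound at h1 ⊢
    split
    · simp only [time_pure]
      omega
    · simp only [time_bind, time_pure]
      omega

theorem items_le_allItems {bins : List Bin} {B : Bin} (hB : B ∈ bins) :
    (B.items : Multiset Item) ≤ allItems bins := by
  induction bins with
  | nil => simp at hB
  | cons B' l ih =>
    rw [allItems_cons]
    rcases List.mem_cons.1 hB with rfl | hB
    · exact Multiset.le_add_right _ _
    · exact (ih hB).trans (Multiset.le_add_left _ _)

theorem vacant_le_allVacant {bins : List Bin} {B : Bin} (hB : B ∈ bins) :
    (B.vacant : Multiset ℕ) ≤ allVacant bins := by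
  induction bins with
  | nil => simp at hB
  | cons B' l ih =>
    rw [allVacant_cons]
    rcases List.mem_cons.1 hB with rfl | hB
    · exact Multiset.le_add_right _ _
    · exact (ih hB).trans (Multiset.le_add_left _ _)

theorem sum_time_le_of_le {A B : Multiset Item} (h : A ≤ B) :
    (A.map Item.time).sum ≤ (B.map Item.time).sum := by
  obtain ⟨D, rfl⟩ := Multiset.le_iff_exists_add.1 h
  simp

theorem firstFitItem_allItems_le (x : Item) (bins : List Bin) :
    allItems (firstFitItem q T x bins).val ≤ x ::ₘ allItems bins ∧
      (firstFitItem q T x bins).val.length = bins.length := by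
  induction bins with
  | nil => simp [firstFitItem]
  | cons B l ih =>
    by_cases hc : q * (B.load + x.time) ≤ (q + 1) * T
    · have e : (firstFitItem q T x (B :: l)).val = ⟨B.machine, B.vacant, x :: B.items⟩ :: l := by
        rw [Bin.load] at hc
        simp [firstFitItem, hc]
      rw [e, allItems_cons, allItems_cons, ← Multiset.cons_coe, Multiset.cons_add]
      exact ⟨le_rfl, rfl⟩
    · have e : (firstFitItem q T x (B :: l)).val = B :: (firstFitItem q T x l).val := by
        rw [Bin.load] at hc
        simp [firstFitItem, hc]
      rw [e, allItems_cons, allItems_cons, ← Multiset.add_cons]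
      exact ⟨add_le_add_right ih.1 _, by simp [ih.2]⟩

theorem firstFit_time (h : ItemBounds s q m items) (hT : T.size ≤ s) {S : List Item}
    {bins : List Bin} (hlen : bins.length ≤ s)
    (hall : allItems bins + (S : Multiset Item) ≤ (items : Multiset Item)) :
    (firstFit q T S bins).time ≤ S.length * (s * testBound s + 2) + 1 := by
  induction S generalizing bins with
  | nil => simp [firstFit]
  | cons x S ih =>
    obtain ⟨g1, g2⟩ := firstFitItem_allItems_le (q := q) (T := T) x bins
    have h1 := ih (bins := (firstFitItem q T x bins).val) (g2.trans_le hlen) (by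
      refine le_trans (add_le_add_left g1 _) ?_
      rwa [Multiset.cons_add, ← Multiset.add_cons, Multiset.cons_coe])
    have hx : x ∈ items := Multiset.mem_coe.1 (Multiset.mem_of_le hall (by simp))
    have hB : ∀ B ∈ bins, B.items.length ≤ s ∧ B.load.size ≤ s := fun B hB => by
      have h2 := ((items_le_allItems hB).trans (Multiset.le_add_right _ _)).trans hall
      refine ⟨?_, size_le_of_le ?_ h.total⟩
      · have := Multiset.card_le_card h2
        rw [Multiset.coe_card, Multiset.coe_card] at this
        exact this.trans h.length
      · simpa [Bin.load] using sum_time_le_of_le h2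
    have h2 := (firstFitItem_time h.eps_size hT (h.time_size hx) hB).trans
      (Nat.add_le_add_right (Nat.mul_le_mul_right _ hlen) 1)
    simp only [firstFit, time_bind, time_tick, List.length_cons, Nat.add_mul S.length 1]
    omega

theorem scheduleOf_time {F : List Bin} (hF : ∀ B ∈ F, B.items.length ≤ s) :
    (scheduleOf F).time ≤ F.length * (3 * s + 3) + 1 := by
  induction F with
  | nil => simp [scheduleOf]
  | cons B l ih =>
    have h1 := ih fun B hB => hF B (List.mem_cons_of_mem _ hB)
    have h2 := hF B List.mem_cons_self
    have h3 := mapT_time (f := fun x : Item => do tick 1; pure (x, B.machine)) (l := B.items)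
      (b := 1) (fun _ _ => by simp)
    simp only [scheduleOf, time_bind, time_tick, appendT_time, mapT_val, List.length_map,
      List.length_cons, Nat.add_mul l.length 1]
    omega

/-- All numbers and lengths in the bipartite graph are at most `s`, and the data have the properties
under which the construction of a solution is known to succeed. -/
structure GraphBounds (s q T : ℕ) (items : List Item) (M removed : List ℕ) : Prop extends
    ItemBounds s q M.length items where
  bound_size : T.size ≤ s
  total_le : (items.map Item.time).sum ≤ M.length * T
  sorted : items.Pairwise fun x y => y.time ≤ x.time
  nodup : (M ++ removed).Nodup
  home : ∀ x ∈ items, ∀ i, x.home = some i → i ∈ M ++ removed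
  machine_size : ∀ i ∈ M ++ removed, i.size ≤ s
  machines_length : M.length + removed.length ≤ s

theorem GraphBounds.home_size (h : GraphBounds s q T items M removed) {x : Item}
    (hx : x ∈ items) : ∀ i, x.home = some i → i.size ≤ s :=
  fun i hi => h.machine_size i (h.home x hx i hi)

/-- A bound for the step count of evaluating the cost of a schedule. -/
def scheduleCostBound (s : ℕ) : ℕ := s * (2 * s + 2 + 2 * s + 2) + 1

theorem scheduleCost_le (h : GraphBounds s q T items M removed) {F : List Bin}
    (hall : allItems F = (items : Multiset Item)) :
    (scheduleCost (scheduleOf F).val).val ≤ s := by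
  have h1 := scheduleCost_add_homeTotal F
  rw [hall, Multiset.coe_card] at h1
  have h2 := h.length
  omega

theorem scheduleCost_time (h : GraphBounds s q T items M removed) {F : List Bin}
    (hm : (F.map Bin.machine).Perm M) (hall : allItems F = (items : Multiset Item)) :
    (scheduleCost (scheduleOf F).val).time ≤ scheduleCostBound s := by
  have hperm := schedule_items_perm hall
  have hlen : (scheduleOf F).val.length ≤ s := by
    rw [← List.length_map (f := Prod.fst), hperm.length_eq]
    exact h.length
  have h2 : (scheduleCost (scheduleOf F).val).val.size ≤ s :=
    (size_le_self _).trans (scheduleCost_le h hall)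
  rw [scheduleCost, sumT_val] at h2
  refine (sumT_time (b := 2 * s + 2) (fun x hx => ?_) h2).trans
    (Nat.add_le_add_right (Nat.mul_le_mul_right _ hlen) 1)
  have hx1 : x.1 ∈ items := hperm.subset (List.mem_map_of_mem hx)
  have hx2 : x.2 ∈ M := by
    rw [scheduleOf_val, List.mem_flatMap] at hx
    obtain ⟨B, hB, hx⟩ := hx
    obtain ⟨y, -, rfl⟩ := List.mem_map.1 hx
    exact hm.subset (List.mem_map_of_mem hB)
  have h3 := isHome_time (h.machine_size x.2 (List.mem_append_left _ hx2)) (h.home_size hx1)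
  simp only [time_bind]
  split <;> simpa using h3

theorem matchingBound_mono {a a' b b' n n' : ℕ} (ha : a ≤ a') (hb : b ≤ b') (hn : n ≤ n') :
    matchingBound a b n ≤ matchingBound a' b' n' := by
  unfold matchingBound bidBound offerBound
  gcongr

/-- A bound for the step count of constructing the solution for one configuration. -/
def solutionBound (s : ℕ) : ℕ :=
  (s * (1 + 1) + 1) + ((s + 1) + (matchingBound (s + 1) (edgeBound s) s + ((s * placeBound s + 1) +
    ((s * fillBound s + 1) + ((s * (s * testBound s + 2) + 1) + (s * (3 * s + 3) + 1))))))

theorem exists_config_of_mem_allVacant {large : List (ℕ × Item)} {small : List Item}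
    {N : List (Vertex × Option Config)} {r : ℕ}
    (hr : r ∈ allVacant (placeKept q T large small N).val.bins) :
    ∃ p ∈ N, ∃ D, p.2 = some D ∧ r ∈ D := by
  induction N with
  | nil => simp [placeKept] at hr
  | cons p N ih =>
    obtain ⟨v, u⟩ := p
    cases u with
    | none =>
      obtain ⟨p, hp, hD⟩ := ih (by simpa [placeKept] using hr)
      exact ⟨p, List.mem_cons_of_mem _ hp, hD⟩
    | some D =>
      simp only [placeKept, val_bind, val_pure, allVacant_cons, Multiset.mem_add,
        Multiset.mem_coe] at hr
      rcases hr with hr | hr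
      · obtain ⟨K, -, -, k3, -⟩ := keepLarge_spec D v.large
        exact ⟨_, List.mem_cons_self, D, rfl, k3.subset (List.mem_append_right _ hr)⟩
      · obtain ⟨p, hp, hD⟩ := ih hr
        exact ⟨p, List.mem_cons_of_mem _ hp, hD⟩

theorem placementFor_vacant_mem {r : ℕ}
    (h : (matchingFor q T items M removed C).map Prod.snd = columns removed C)
    (hr : r ∈ allVacant (placementFor q T items M removed C).bins) : ∃ D ∈ C, r ∈ D := by
  obtain ⟨p, hp, D, hD, hrD⟩ := exists_config_of_mem_allVacant hr
  have h1 : p.2 ∈ columns removed C := by rw [← h]; exact List.mem_map_of_mem hp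
  exact ⟨D, by simpa [columns, hD] using h1, hrD⟩

theorem solutionFor_time (h : GraphBounds s q T items M removed) (hq : 0 < q) (hne : M ≠ [])
    (hC : C ∈ (configurations q M.length ((largePairs q T items).map Prod.fst)).val) :
    (solutionFor q T (items.length + 1) (setupOf q T items M removed) C).time ≤
      solutionBound s := by
  obtain ⟨hlen, hcap, hperm⟩ := mem_configurations_sound hC
  have hCs : ∀ D ∈ C, D.sum ≤ q * q := fun D hD => (hcap D hD).2
  have hML : M.length ≤ s := h.machines
  have hcols : ∀ u ∈ columns removed C, ∀ D, u = some D → D.length ≤ q ∧ D.sum ≤ q * q := by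
    intro u hu D hD
    exact hcap D (by simpa [columns, hD] using hu)
  have hrows : (allVertices q T items M removed).length = M.length + removed.length := by
    simp [allVertices]
  have hrc : (allVertices q T items M removed).length = (columns removed C).length := by
    simp [allVertices, columns, hlen]
  have hcost : ∀ v ∈ allVertices q T items M removed, ∀ u ∈ columns removed C,
      (edgeCost q T (items.length + 1) v u).val ≤ items.length + 1 :=
    fun v hv u hu => edgeCost_le h.total_le h.sorted hCs hperm hv hu
  have htime : ∀ v ∈ allVertices q T items M removed, ∀ u ∈ columns removed C,
      (edgeCost q T (items.length + 1) v u).time ≤ edgeBound s :=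
    fun v hv u hu => edgeCost_time h.toItemBounds h.bound_size h.sorted hv (hcols u hu)
  have t1 := (mapT_time (f := fun c : Config => do tick 1; pure (some c)) (l := C) (b := 1)
    (fun _ _ => by simp)).trans (Nat.add_le_add_right (Nat.mul_le_mul_right _ (hlen.trans_le hML)) 1)
  have t3 := (minCostMatching_time hrc hcost htime).trans
    (matchingBound_mono (Nat.add_le_add_right h.length 1) le_rfl
      (hrows.trans_le h.machines_length))
  obtain ⟨m1, m2, -⟩ := minCostMatching_spec hrc hcost
  change ((matchingFor q T items M removed C).map _).Perm _ at m1
  change (matchingFor q T items M removed C).map _ = _ at m2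
  have t4 := (placeKept_time h.toItemBounds h.bound_size h.sorted
    (large := (largePairs q T items).filter fun y => y.2.home = none)
    (small := (smallItems q T items).filter fun x => x.home = none)
    (N := matchingFor q T items M removed C) (fun p hp => ⟨m1.subset (List.mem_map_of_mem hp),
      hcols _ (by rw [← m2]; exact List.mem_map_of_mem hp)⟩)).trans
    (Nat.add_le_add_right (Nat.mul_le_mul_right _ (by
      have := m1.length_eq
      rw [List.length_map] at this
      rw [this, hrows]
      exact h.machines_length : _ ≤ s)) 1)
  obtain ⟨p1, p2, p3, p4, p5, p6, -⟩ := placementFor_spec h.total_le h.sorted h.nodup h.home hC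
  obtain ⟨f1, f2, f3, -⟩ := fillBins_spec hq p3 p5 p4
  obtain ⟨F, hF, hFm, hFall, -, -⟩ := solutionFor_spec hq hne h.total_le h.sorted h.nodup h.home hC
  have hPlen : (placementFor q T items M removed C).bins.length ≤ s := by
    have := p1.length_eq
    rw [List.length_map] at this
    omega
  have hlarge : (placementFor q T items M removed C).large.length ≤ s := by
    have := congrArg Multiset.card p2
    simp only [Multiset.card_add, Multiset.coe_card, List.length_map] at this
    have := h.length
    omega
  have hsizes : ∀ r ∈ (placementFor q T items M removed C).large.map Prod.fst, r.size ≤ 3 * s := by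
    -- the large items left have rounded sizes of the configuration
    intro r hr
    obtain ⟨y, hy, rfl⟩ := List.mem_map.1 hr
    obtain ⟨D, hD, hrD⟩ := placementFor_vacant_mem (q := q) (T := T) (items := items) (M := M)
      (removed := removed) (C := C) m2 (by rw [← p3]; exact hr)
    exact config_size_le h.toItemBounds (hCs D hD) _ hrD
  have t5 := (fillBins_time (s := s) (bins := (placementFor q T items M removed C).bins)
    (pool := (placementFor q T items M removed C).large) (fun B hB => by
      have h1 := vacant_le_allVacant hB
      rw [← p3] at h1
      have h2 := Multiset.card_le_card h1
      rw [Multiset.coe_card, Multiset.coe_card, List.length_map] at h2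
      exact ⟨h2.trans hlarge, fun r hr => hsizes r (Multiset.mem_of_le h1 hr)⟩)
    (fun y hy => hsizes _ (List.mem_map_of_mem hy)) hlarge).trans
    (Nat.add_le_add_right (Nat.mul_le_mul_right _ hPlen) 1)
  have hBlen : (fillBins (placementFor q T items M removed C).bins
      (placementFor q T items M removed C).large).val.length ≤ s := by
    have := congrArg List.length f1
    rw [List.length_map, List.length_map] at this
    omega
  have hsmall : (placementFor q T items M removed C).small.length ≤ s := by
    have := congrArg Multiset.card p2
    simp only [Multiset.card_add, Multiset.coe_card, List.length_map] at this
    have := h.length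
    omega
  have t6 := (firstFit_time h.toItemBounds h.bound_size
    (S := (placementFor q T items M removed C).small)
    (bins := (fillBins (placementFor q T items M removed C).bins
      (placementFor q T items M removed C).large).val) hBlen (by rw [f2, p2])).trans
    (Nat.add_le_add_right (Nat.mul_le_mul_right _ hsmall) 1)
  obtain ⟨b1, b2, -, -⟩ := firstFit_fillBins_spec hq
    (bins := (placementFor q T items M removed C).bins)
    (pool := (placementFor q T items M removed C).large)
    (S := (placementFor q T items M removed C).small) (fun e => by
      have := p1.length_eq
      rw [e, List.map_nil, List.length_nil] at this
      exact hne (List.length_eq_zero_iff.1 this.symm)) p3 p5 p4 p6 (by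
      have := p1.length_eq
      rw [List.length_map] at this
      rw [p2, this]
      simpa using h.total_le)
  rw [p2] at b2
  have b3 := congrArg List.length b1
  rw [List.length_map, List.length_map] at b3
  have t7 := (scheduleOf_time (s := s) (F := (firstFit q T
      (placementFor q T items M removed C).small
      (fillBins (placementFor q T items M removed C).bins
        (placementFor q T items M removed C).large).val).val) (fun B hB => by
      have h1 := Multiset.card_le_card (items_le_allItems hB)
      rw [b2, Multiset.coe_card, Multiset.coe_card] at h1
      exact h1.trans h.length)).trans
    (Nat.add_le_add_right (Nat.mul_le_mul_right _ (b3.trans_le hPlen)) 1)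
  have t2 : C.length + 1 ≤ s + 1 := Nat.add_le_add_right (hlen.trans_le hML) 1
  simp only [solutionFor, setupOf, time_bind, mapT_val, appendT_val, val_bind, val_pure,
    appendT_time, List.length_map]
  exact Nat.add_le_add t1 (Nat.add_le_add t2 (Nat.add_le_add t3 (Nat.add_le_add t4
    (Nat.add_le_add t5 (Nat.add_le_add t6 t7)))))

/-- A bound for the step count of treating one configuration. -/
def roundBound (s : ℕ) : ℕ := 1 + (solutionBound s + (scheduleCostBound s + (s + s + 1)))

theorem bestSolution_time (h : GraphBounds s q T items M removed) (hq : 0 < q) (hne : M ≠ [])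
    {L : List (List Config)}
    (hL : ∀ C ∈ L, C ∈ (configurations q M.length ((largePairs q T items).map Prod.fst)).val) :
    (bestSolution q T (items.length + 1) (setupOf q T items M removed) L).time ≤
      L.length * roundBound s + 1 := by
  induction L with
  | nil => simp [bestSolution]
  | cons C L ih =>
    have hL' := fun D hD => hL D (List.mem_cons_of_mem C hD)
    have h1 := ih hL'
    have hspec := fun C hC => solutionFor_spec (C := C) hq hne h.total_le h.sorted h.nodup h.home hC
    obtain ⟨F, hF, hFm, hFall, -, -⟩ := hspec C (hL C List.mem_cons_self)
    have h2 := solutionFor_time h hq hne (hL C List.mem_cons_self)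
    have h3 := scheduleCost_time h hFm hFall
    have h4 := (size_le_self _).trans (scheduleCost_le h hFall)
    rw [← hF] at h3 h4
    simp only [bestSolution, time_bind, time_tick, List.length_cons, Nat.add_mul L.length 1]
    by_cases hLn : L = []
    · subst hLn
      simp only [bestSolution, val_bind, val_pure, time_bind, time_tick, time_pure] at h1 ⊢
      unfold roundBound
      omega
    · obtain ⟨E, hE, hb, -⟩ := bestSolution_spec (q := q) (T := T) (forbidden := items.length + 1)
        (D := setupOf q T items M removed) hLn
      obtain ⟨G, hG, -, hGall, -, -⟩ := hspec E (hL' E hE)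
      have h5 := (size_le_self _).trans (scheduleCost_le h hGall)
      rw [← hG] at h5
      rw [hb]
      simp only [time_bind, time_leN]
      unfold roundBound at h1 ⊢
      split <;> simp only [time_pure] <;> omega

end

section

/-! ### Polynomial functions -/

/-- `f` is the evaluation of a polynomial with natural coefficients. -/
@[fun_prop]
def IsPolynomial (f : ℕ → ℕ) : Prop := ∃ P : Polynomial ℕ, ∀ n, P.eval n = f n

namespace IsPolynomial

variable {f g : ℕ → ℕ}

@[fun_prop]
theorem id' : IsPolynomial fun n => n := ⟨.X, fun n => by simp⟩

@[fun_prop]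
theorem const (c : ℕ) : IsPolynomial fun _ => c := ⟨.C c, fun n => by simp⟩

@[fun_prop]
theorem comp (hf : IsPolynomial f) (hg : IsPolynomial g) : IsPolynomial fun n => f (g n) := by
  obtain ⟨P, hP⟩ := hf
  obtain ⟨Q, hQ⟩ := hg
  exact ⟨P.comp Q, fun n => by simp [hP, hQ]⟩

@[fun_prop]
theorem add (hf : IsPolynomial f) (hg : IsPolynomial g) : IsPolynomial fun n => f n + g n := by
  obtain ⟨P, hP⟩ := hf
  obtain ⟨Q, hQ⟩ := hg
  exact ⟨P + Q, fun n => by simp [hP, hQ]⟩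

@[fun_prop]
theorem mul (hf : IsPolynomial f) (hg : IsPolynomial g) : IsPolynomial fun n => f n * g n := by
  obtain ⟨P, hP⟩ := hf
  obtain ⟨Q, hQ⟩ := hg
  exact ⟨P * Q, fun n => by simp [hP, hQ]⟩

@[fun_prop]
theorem pow (hf : IsPolynomial f) (k : ℕ) : IsPolynomial fun n => f n ^ k := by
  obtain ⟨P, hP⟩ := hf
  exact ⟨P ^ k, fun n => by simp [hP]⟩

end IsPolynomial

/-! ### Step count of the algorithm -/

/-- A bound for the step count of the algorithm: one summand for each of the programs it calls. -/
def algorithmBound (q s : ℕ) : ℕ :=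
  (s * (s * (2 * s + 2) + 1 + 1) + 1) + ((s * (s * (2 * s + 2) + 2) + 1) +
  ((s + 1) * (s + 3) + ((s + 1) * (s + 3) + (approxBound q s + ((s * splitBound s + 1) +
  ((s * (s * (2 * s + 2) + 1 + 1) + 1) +
  ((s * (s * (2 * s + 2 + 1) + 1 + (s * (2 * s + 2 + 1) + 1) + 1) + 1) +
  ((s * (s * (2 * s + 2 + 1) + 1 + (s * (2 * s + 2 + 1) + 1) + 1) + 1) +
  ((s + 1) + ((s * (1 + 1) + 1) + ((s * (1 + 1) + 1) + ((s * (1 + 1) + 1) +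
  ((s * (1 + 1) + 1) + (configurationsBound q s + ((s + 1 + 1) +
  (((s + 1) ^ (binConfigs q).val.length * roundBound s + 1) + (s * (1 + 1) + 1)))))))))))))))))

theorem isPolynomial_algorithmBound (q : ℕ) : IsPolynomial (algorithmBound q) := by
  unfold algorithmBound roundBound scheduleCostBound solutionBound matchingBound bidBound offerBound
    approxBound searchBound fitsBound placeBound fillBound testBound edgeBound keepSmallBound
    keepLargeBound splitBound configurationsBound
  fun_prop

/-! ### Encoding length -/

theorem sum_map_size_le {α : Type} (f : α → ℕ) (l : List α) :
    (l.map f).sum.size ≤ (l.map fun a => (f a).size).sum := by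
  induction l with
  | nil => simp
  | cons a l ih =>
    rw [List.map_cons, List.map_cons, List.sum_cons, List.sum_cons]
    exact (size_add_le _ _).trans (Nat.add_le_add_left ih _)

theorem length_le_sum_map {α : Type} {f : α → ℕ} (hf : ∀ a, 1 ≤ f a) (l : List α) :
    l.length ≤ (l.map f).sum := by
  simpa using List.sum_le_sum (l := l) (f := fun _ => 1) fun a _ => hf a

theorem le_sum_map {α : Type} (f : α → ℕ) {l : List α} {a : α} (ha : a ∈ l) :
    f a ≤ (l.map f).sum :=
  List.single_le_sum (fun _ _ => Nat.zero_le _) _ (List.mem_map_of_mem ha)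

variable {q s : ℕ} {R : Input}

/-- The numbers of the input have at most as many digits as the input has symbols. -/
theorem Input.size_bounds (R : Input) :
    R.new.machines.length + R.old.machines.length ≤ R.size ∧
    R.new.jobs.length ≤ R.size ∧ R.σ₀.length ≤ R.size ∧
    (∀ i ∈ R.new.machines, i.size ≤ R.size) ∧ (∀ i ∈ R.old.machines, i.size ≤ R.size) ∧
    (∀ j ∈ R.new.jobs, j.id.size ≤ R.size) ∧ (∀ x ∈ R.σ₀, x.1.size ≤ R.size) ∧
    (R.new.jobs.map Job.time).sum.size ≤ R.size := by
  have e : R.size = (R.old.machines.map numSize).sum +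
    (R.old.jobs.map fun j => numSize j.id + numSize j.time).sum +
    (R.σ₀.map fun x => numSize x.1 + numSize x.2).sum + ((R.new.machines.map numSize).sum +
    (R.new.jobs.map fun j => numSize j.id + numSize j.time).sum) := rfl
  have h1 := length_le_sum_map (f := numSize) (fun a => by simp [numSize]) R.new.machines
  have h2 := length_le_sum_map (f := numSize) (fun a => by simp [numSize]) R.old.machines
  have h3 := length_le_sum_map (f := fun j : Job => numSize j.id + numSize j.time)
    (fun a => by simp only [numSize]; omega) R.new.jobs
  have h4 := length_le_sum_map (f := fun x : ℕ × ℕ => numSize x.1 + numSize x.2)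
    (fun a => by simp only [numSize]; omega) R.σ₀
  refine ⟨by omega, by omega, by omega, fun i hi => ?_, fun i hi => ?_, fun j hj => ?_,
    fun x hx => ?_, ?_⟩
  · have := le_sum_map numSize hi
    have : i.size ≤ numSize i := Nat.le_succ _
    omega
  · have := le_sum_map numSize hi
    have : i.size ≤ numSize i := Nat.le_succ _
    omega
  · have := le_sum_map (fun j : Job => numSize j.id + numSize j.time) hj
    have : j.id.size ≤ numSize j.id := Nat.le_succ _
    omega
  · have := le_sum_map (fun x : ℕ × ℕ => numSize x.1 + numSize x.2) hx
    have : x.1.size ≤ numSize x.1 := Nat.le_succ _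
    omega
  · have h5 := sum_map_size_le Job.time R.new.jobs
    have h6 := List.sum_le_sum (l := R.new.jobs) (f := fun j => j.time.size)
      (g := fun j : Job => numSize j.id + numSize j.time)
      fun j _ => by simp only [numSize]; omega
    omega

theorem sum_inputItems (R : Input) :
    ((inputItems R).map Item.time).sum = (R.new.jobs.map Job.time).sum := by
  rw [((inputItems_perm R).map Item.time).sum_eq, List.map_map]
  rfl

theorem length_inputItems (R : Input) : (inputItems R).length = R.new.jobs.length := by
  rw [(inputItems_perm R).length_eq, List.length_map]

/-- The summand `2` is needed for the makespan bound, which is at most twice the total processing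
time, and the terms in `q` for the error parameter itself. -/
theorem graphBounds_of_size (hq : 0 < q) (hR : R.Valid) (hs : s = R.size + (q * q + q + 2)) :
    GraphBounds s q (makespanBound q R) (inputItems R) R.new.machines (removedMachines R) := by
  obtain ⟨b1, b2, -, b4, b5, -, -, b8⟩ := R.size_bounds
  obtain ⟨σ, hσ, ho⟩ := exists_optimal hR.2.2.1
  obtain ⟨h1, -, h3⟩ := approxMakespan_spec hq hR.2.1 hR.2.2.1 (inputItems_perm R)
  refine ⟨⟨by omega, by omega, by omega, ?_, ?_⟩, ?_, ?_, sortItems_sorted _, machines_nodup hR,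
    fun x hx i hi => home_mem hR hx hi, fun i hi => ?_, ?_⟩
  · rw [length_inputItems]
    omega
  · rw [sum_inputItems]
    omega
  · refine size_le_of_le h3 ?_
    have h2 := size_mul_le 2 ((inputItems R).map Item.time).sum
    have h4 : Nat.size 2 ≤ 2 := size_le_self 2
    rw [sum_inputItems] at h2 ⊢
    omega
  · exact (total_le_mul_makespan hR.2.1 (inputItems_perm R) hσ).trans
      (Nat.mul_le_mul_left _ (ho.trans_le h1))
  · have : i.size ≤ R.size := by
      rcases List.mem_append.1 hi with hi | hi
      · exact b4 i hi
      · exact b5 i (List.mem_of_mem_filter hi)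
    omega
  · have : (removedMachines R).length ≤ R.old.machines.length := List.length_filter_le _ _
    omega

theorem configurations_length_le {m : ℕ} {sizes : List ℕ} (hm : m ≤ s) :
    (configurations q m sizes).val.length ≤ (s + 1) ^ (binConfigs q).val.length := by
  simp only [configurations, val_bind, filterT_val]
  exact (List.length_filter_le _ _).trans ((multisets_length_le _ _).trans
    (Nat.pow_le_pow_left (Nat.add_le_add_right hm 1) _))

theorem isNew_time (x : Item) : (isNew x).time = 1 := by
  simp only [isNew, time_bind, time_tick]
  split <;> rfl

theorem algorithmWith_time (hq : 0 < q) (hR : R.Valid) (hs : s = R.size + (q * q + q + 2)) :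
    (algorithmWith q R).time ≤ algorithmBound q s := by
  obtain ⟨b1, b2, b3, b4, b5, b6, b7, -⟩ := R.size_bounds
  have h := graphBounds_of_size hq hR hs
  have hI := inputItems_perm R
  have t1 := makeItems_time (s := s) (σ₀ := R.σ₀) (l := R.new.jobs)
    (fun x hx => (b7 x hx).trans (by omega)) (fun j hj => (b6 j hj).trans (by omega)) (by omega)
    (by omega)
  have hn : (R.new.jobs.map (mkItem R.σ₀)).length ≤ s := by rw [List.length_map]; omega
  have t2 := (sortItems_time (fun y hy => h.time_size (hI.symm.subset hy)) hn).trans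
    (Nat.add_le_add_right (Nat.mul_le_mul_right _ hn) 1)
  have t3 := (lengthT_time (inputItems R)).trans
    (Nat.mul_le_mul (Nat.add_le_add_right h.length 1) (Nat.add_le_add_right h.length 3))
  have t4 := (lengthT_time R.new.machines).trans
    (Nat.mul_le_mul (Nat.add_le_add_right h.machines 1) (Nat.add_le_add_right h.machines 3))
  have t5 := approxMakespan_time h.toItemBounds
  have t6 := (splitItems_time (q := q) (T := makespanBound q R) (l := inputItems R)
    (fun x hx => h.time_size hx) h.eps_size h.bound_size).trans
    (Nat.add_le_add_right (Nat.mul_le_mul_right _ h.length) 1)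
  have t7 := (filterT_time (l := R.old.machines) (b := s * (2 * s + 2) + 1) (p := fun i => do
      let b ← memT i R.new.machines
      if b then pure false else pure true) fun i hi => by
    have h1 := (memT_time (s := s) (l := R.new.machines) ((b5 i hi).trans (by omega))
      fun j hj => (b4 j hj).trans (by omega)).trans
      (Nat.add_le_add_right (Nat.mul_le_mul_right _ h.machines) 1)
    simp only [time_bind]
    split <;> simpa using h1).trans
    (Nat.add_le_add_right (Nat.mul_le_mul_right _ (by omega : _ ≤ s)) 1)
  have hlarge := (largePairs_length_le q (makespanBound q R) (inputItems R)).trans h.length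
  have hsmall := (smallItems_length_le q (makespanBound q R) (inputItems R)).trans h.length
  have hL : ∀ y ∈ largePairs q (makespanBound q R) (inputItems R), ∀ i, y.2.home = some i →
      i.size ≤ s := fun y hy => by
    obtain ⟨x, hx, rfl⟩ := List.mem_map.1 hy
    exact h.home_size (List.mem_of_mem_filter hx)
  have hS : ∀ x ∈ smallItems q (makespanBound q R) (inputItems R), ∀ i, x.home = some i →
      i.size ≤ s := fun x hx => h.home_size (List.mem_of_mem_filter hx)
  have hm := h.machines_length
  have t8 := makeVertices_time (present := true)
    (fun i hi => h.machine_size i (List.mem_append_left _ hi)) hlarge hsmall h.machines hL hS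
  have t9 := makeVertices_time (present := false)
    (fun i hi => h.machine_size i (List.mem_append_right _ hi)) hlarge hsmall
    (by omega : (removedMachines R).length ≤ s) hL hS
  have t10 : R.new.machines.length + 1 ≤ s + 1 := Nat.add_le_add_right h.machines 1
  have t11 := (mapT_time (l := removedMachines R) (b := 1)
    (f := fun _ => do tick 1; pure (none : Option Config)) (fun _ _ => by simp)).trans
    (Nat.add_le_add_right (Nat.mul_le_mul_right _ (by omega : _ ≤ s)) 1)
  have t12 := (filterT_time (l := largePairs q (makespanBound q R) (inputItems R)) (b := 1)
    (p := fun y => isNew y.2) fun y _ => (isNew_time _).le).trans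
    (Nat.add_le_add_right (Nat.mul_le_mul_right _ hlarge) 1)
  have t13 := (filterT_time (l := smallItems q (makespanBound q R) (inputItems R)) (b := 1)
    (p := isNew) fun y _ => (isNew_time _).le).trans
    (Nat.add_le_add_right (Nat.mul_le_mul_right _ hsmall) 1)
  have t14 := (sizesOf_time (largePairs q (makespanBound q R) (inputItems R))).trans
    (Nat.add_le_add_right (Nat.mul_le_mul_right _ hlarge) 1)
  have t15 := h.configurations_time (T := makespanBound q R)
  have t16 : (inputItems R).length.size + Nat.size 1 + 1 ≤ s + 1 + 1 :=
    Nat.add_le_add_right (Nat.add_le_add ((size_le_self _).trans h.length) size_one_le) 1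
  have t17 := (bestSolution_time h hq hR.2.2.1 (fun C hC => hC)).trans (Nat.add_le_add_right
    (Nat.mul_le_mul_right _ (configurations_length_le h.machines)) 1)
  set best := (bestSolution q (makespanBound q R) ((inputItems R).length + 1)
    (setupOf q (makespanBound q R) (inputItems R) R.new.machines (removedMachines R))
    (configurations q R.new.machines.length
      ((largePairs q (makespanBound q R) (inputItems R)).map Prod.fst)).val).val with hbest
  have t18 : (match best with
      | none => (pure [] : Timed (List (ℕ × ℕ)))
      | some (_, s) => mapT (fun x : Item × ℕ => do tick 1; pure (x.1.id, x.2)) s).time ≤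
      s * (1 + 1) + 1 := by
    by_cases hne : (configurations q R.new.machines.length
      ((largePairs q (makespanBound q R) (inputItems R)).map Prod.fst)).val = []
    · rw [hbest, hne]
      simp [bestSolution]
    · obtain ⟨C, hC, hb, -⟩ := bestSolution_spec (q := q) (T := makespanBound q R)
        (forbidden := (inputItems R).length + 1)
        (D := setupOf q (makespanBound q R) (inputItems R) R.new.machines (removedMachines R)) hne
      obtain ⟨F, hF, -, hall, -⟩ := solutionFor_spec hq hR.2.2.1 h.total_le h.sorted h.nodup
        h.home hC
      have hlen := (schedule_items_perm hall).length_eq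
      rw [List.length_map] at hlen
      rw [hbest, hb, hF]
      exact (mapT_time (b := 1) fun _ _ => by simp).trans
        (Nat.add_le_add_right (Nat.mul_le_mul_right _ (hlen.trans_le h.length)) 1)
  simp only [algorithmWith, time_bind, val_bind, makeItems_val, lengthT_val, splitItems_eq, mapT_val,
    makeVertices_val, appendT_val, filter_removed, sizesOf_val, val_addN, filterT_val,
    isNew_val, val_pure, time_addN, appendT_time, List.length_map]
  exact Nat.add_le_add t1 (Nat.add_le_add t2 (Nat.add_le_add t3 (Nat.add_le_add t4
    (Nat.add_le_add t5 (Nat.add_le_add t6 (Nat.add_le_add t7 (Nat.add_le_add t8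
    (Nat.add_le_add t9 (Nat.add_le_add t10 (Nat.add_le_add t11 (Nat.add_le_add t12
    (Nat.add_le_add t13 (Nat.add_le_add t14 (Nat.add_le_add t15 (Nat.add_le_add t16
    (Nat.add_le_add t17 t18))))))))))))))))

/-- For a fixed error parameter the algorithm runs in polynomial time. -/
theorem runsInPolyTime_algorithm {ε : ℝ} (hε : 0 < ε) : RunsInPolyTime (AID ε) := by
  have hq : 0 < ⌈4 / ε⌉₊ := Nat.ceil_pos.2 (by positivity)
  obtain ⟨P, hP⟩ : IsPolynomial fun n => algorithmBound ⌈4 / ε⌉₊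
      (n + (⌈4 / ε⌉₊ * ⌈4 / ε⌉₊ + ⌈4 / ε⌉₊ + 2)) :=
    (isPolynomial_algorithmBound _).comp (IsPolynomial.id'.add (IsPolynomial.const _))
  exact ⟨P, fun R hR => (algorithmWith_time hq hR rfl).trans_eq (hP _).symm⟩

end

end Reopt

theorem mainTheorem4 (ε : ℝ) (hε : 0 < ε) :
    Reopt.RunsInPolyTime (Reopt.AID ε) ∧
    Reopt.IsReapproximation 1 (1 + ε) (fun R => (Reopt.AID ε R).val) := by
  exact ⟨Reopt.runsInPolyTime_algorithm hε, Reopt.isReapproximation_algorithm hε⟩
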